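/- Let $k$ be an algebraically closed, complete normed field of characteristic zero, and let $\mathcal O$ be one of the rings $k[x_1,x_2]_{(x_1,x_2)}$ (rational functions regular at the origin), $k\{x_1,x_2\}$ (locally convergent power series) or $k[[x_1,x_2]]$ (formal power series). Let $(C,0)=\bigcup_{\alpha=1}^r m_\alpha C_\alpha\subset(k^2,0)$ be a plane curve germ, i.e. $C=\{f_1^{m_1}\cdots f_r^{m_r}=0\}$ with $m_\alpha\ge 1$, whose pairwise distinct branches $C_\alpha=\{f_\alpha=0\}$, $f_\alpha\in\mathcal O$, are all smooth, and suppose that its tangent cone is the multiple line $\{x_1^p=0\}$, where $p=\operatorname{mult}(C,0)=\sum_\alpha m_\alpha$. Let $\mathcal M$ be a determinantal representation of $(C,0)$, i.e. a $d\times d$ matrix over $\mathcal O$ with $\mathcal M|_0=0$ such that $\det\mathcal M$ is $\prod_\alpha f_\alpha^{m_\alpha}$ up to an invertible factor, and suppose that $\mathcal M$ is maximally generated at the origin: $\operatorname{corank}\mathcal M|_0=\operatorname{mult}(C,0)$. Let $(g_1,\dots,g_p)=(f_1,\dots,f_1,f_2,\dots,f_2,\dots,f_r,\dots,f_r)$ be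 the list of the branch equations, each $f_\alpha$ repeated $m_\alpha$ times (the numbering of the branches is arbitrary). Let $\iota(g_i,g_j)=\dim_k\mathcal O/(g_i,g_j)\in\mathbb N\cup\{\infty\}$ be the intersection multiplicity of the corresponding branches; it is $\infty$ if $g_i=g_j$. Then $d=p$, and there are $A,B\in GL(p,\mathcal O)$ such that $$A\mathcal M B=\begin{pmatrix} g_1&\beta_1x_2^{n_1}&h_{13}(x_2)&\cdots&h_{1p}(x_2)\\ 0&g_2&\beta_2x_2^{n_2}&\cdots&h_{2p}(x_2)\\ \vdots&&\ddots&\ddots&\vdots\\ 0&\cdots&0&g_{p-1}&\beta_{p-1}x_2^{n_{p-1}}\\ 0&\cdots&\cdots&0&g_p\end{pmatrix},$$ where $\beta_i\in\{0,1\}$ and $1\le n_i<\iota(g_i,g_{i+1})$, and, for $j\ge i+2$, either $h_{ij}=0$ or $h_{ij}\in k[x_2]$ is a polynomial with $\operatorname{ord}_{x_2}h_{ij}\ge1$ and $\deg h_{ij}<\iota(g_i,g_j)$. (If $g_i=x_1+c_ix_2^{l_i}+\dots$ and $g_j=x_1+c_jx_2^{l_j}+\dots$ with coefficients $c_i,c_j\neq0$,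 the dots standing for terms in $x_2$ alone of higher degree, and $l_i\ne l_j$ or $c_i\neq c_j$, then $\iota(g_i,g_j)=\min(l_i,l_j)$.) -/

import Mathlib

open MvPowerSeries in
/-- A formal power series in two variables converges locally (on some polydisc around the
origin): the series `∑ ‖cₙ‖ r^|n|` is summable for some `r > 0`. -/
def ConvergesNearZero {k : Type*} [NormedField k] (F : MvPowerSeries (Fin 2) k) : Prop :=
  ∃ r : ℝ, 0 < r ∧ Summable fun n : Fin 2 →₀ ℕ => ‖coeff n F‖ * r ^ n.degree

theorem ConvergesNearZero.mono {k : Type*} [NormedField k] {F : MvPowerSeries (Fin 2) k} {r s : ℝ}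
    (hs : 0 ≤ s) (hsr : s ≤ r)
    (h : Summable fun n : Fin 2 →₀ ℕ => ‖MvPowerSeries.coeff n F‖ * r ^ n.degree) :
    Summable fun n : Fin 2 →₀ ℕ => ‖MvPowerSeries.coeff n F‖ * s ^ n.degree := by
  refine Summable.of_nonneg_of_le (fun n => by positivity) (fun n => ?_) h
  gcongr

theorem ConvergesNearZero.add {k : Type*} [NormedField k] {F G : MvPowerSeries (Fin 2) k}
    (hF : ConvergesNearZero F) (hG : ConvergesNearZero G) : ConvergesNearZero (F + G) := by
  obtain ⟨r, hr, hF⟩ := hF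
  obtain ⟨s, hs, hG⟩ := hG
  have ht : 0 < min r s := lt_min hr hs
  refine ⟨min r s, ht, ?_⟩
  refine Summable.of_nonneg_of_le (fun n => by positivity) (fun n => ?_)
    ((ConvergesNearZero.mono ht.le (min_le_left r s) hF).add
      (ConvergesNearZero.mono ht.le (min_le_right r s) hG))
  rw [← add_mul, map_add]
  gcongr
  exact norm_add_le _ _

theorem ConvergesNearZero.mul {k : Type*} [NormedField k] {F G : MvPowerSeries (Fin 2) k}
    (hF : ConvergesNearZero F) (hG : ConvergesNearZero G) : ConvergesNearZero (F * G) := by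
  classical
  obtain ⟨r, hr, hF⟩ := hF
  obtain ⟨s, hs, hG⟩ := hG
  have ht : 0 < min r s := lt_min hr hs
  refine ⟨min r s, ht, ?_⟩
  have hF' := ConvergesNearZero.mono ht.le (min_le_left r s) hF
  have hG' := ConvergesNearZero.mono ht.le (min_le_right r s) hG
  set u : (Fin 2 →₀ ℕ) → ℝ := fun n => ‖MvPowerSeries.coeff n F‖ * min r s ^ n.degree with hu
  set v : (Fin 2 →₀ ℕ) → ℝ := fun n => ‖MvPowerSeries.coeff n G‖ * min r s ^ n.degree with hv
  have hu0 : 0 ≤ u := fun n => by simp only [hu]; positivity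
  have hv0 : 0 ≤ v := fun n => by simp only [hv]; positivity
  have key : Summable fun n : Fin 2 →₀ ℕ => ∑ p ∈ Finset.HasAntidiagonal.antidiagonal n, u p.1 * v p.2 :=
    summable_sum_mul_antidiagonal_of_summable_mul (hF'.mul_of_nonneg hG' hu0 hv0)
  refine Summable.of_nonneg_of_le (fun n => by positivity) (fun n => ?_) key
  have h1 : ‖MvPowerSeries.coeff n (F * G)‖ ≤ ∑ p ∈ Finset.HasAntidiagonal.antidiagonal n,
      ‖MvPowerSeries.coeff p.1 F‖ * ‖MvPowerSeries.coeff p.2 G‖ := by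
    rw [MvPowerSeries.coeff_mul]
    refine (norm_sum_le _ _).trans (Finset.sum_le_sum fun p _ => ?_)
    rw [norm_mul]
  refine (mul_le_mul_of_nonneg_right h1 (by positivity)).trans_eq ?_
  rw [Finset.sum_mul]
  refine Finset.sum_congr rfl fun p hp => ?_
  simp only [hu, hv]
  rw [← Finset.HasAntidiagonal.mem_antidiagonal.1 hp, map_add, pow_add]
  ring

theorem ConvergesNearZero.of_polynomial {k : Type*} [NormedField k]
    (P : MvPolynomial (Fin 2) k) : ConvergesNearZero (P : MvPowerSeries (Fin 2) k) := by
  refine ⟨1, one_pos, ?_⟩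
  refine summable_of_ne_finset_zero (s := P.support) fun n hn => ?_
  rw [MvPolynomial.coeff_coe, MvPolynomial.notMem_support_iff.1 hn]
  simp

/-- The locally convergent power series `k{x₁, x₂}`. -/
noncomputable def convergentSeries (k : Type*) [NormedField k] : Subalgebra k (MvPowerSeries (Fin 2) k) where
  carrier := {F | ConvergesNearZero F}
  mul_mem' := ConvergesNearZero.mul
  add_mem' := ConvergesNearZero.add
  algebraMap_mem' c := by
    have h := ConvergesNearZero.of_polynomial (MvPolynomial.C c : MvPolynomial (Fin 2) k)
    rwa [MvPolynomial.coe_C] at h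

/-- The rational functions regular at the origin, i.e. the localization `k[x₁, x₂]_𝔪`, identified
with the subring of their Taylor expansions: the series `P / Q` with `P`, `Q` polynomials and
`Q(0) ≠ 0`. -/
noncomputable def rationalSeries (k : Type*) [Field k] : Subalgebra k (MvPowerSeries (Fin 2) k) where
  carrier := {F | ∃ P Q : MvPolynomial (Fin 2) k, MvPolynomial.constantCoeff Q ≠ 0 ∧
    (Q : MvPowerSeries (Fin 2) k) * F = P}
  mul_mem' := by
    rintro F G ⟨P, Q, hQ, h⟩ ⟨P', Q', hQ', h'⟩
    refine ⟨P * P', Q * Q', by simp [hQ, hQ'], ?_⟩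
    rw [MvPolynomial.coe_mul, MvPolynomial.coe_mul, ← h, ← h']
    ring
  add_mem' := by
    rintro F G ⟨P, Q, hQ, h⟩ ⟨P', Q', hQ', h'⟩
    refine ⟨P * Q' + P' * Q, Q * Q', by simp [hQ, hQ'], ?_⟩
    rw [MvPolynomial.coe_mul, MvPolynomial.coe_add, MvPolynomial.coe_mul, MvPolynomial.coe_mul,
      ← h, ← h']
    ring
  algebraMap_mem' c := by
    refine ⟨MvPolynomial.C c, 1, by simp, ?_⟩
    rw [MvPolynomial.coe_C, MvPolynomial.coe_one, one_mul]
    rfl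

/-- The three kinds of functions on the germ `(k², 0)`. -/
inductive FunctionKind
  | rational
  | convergent
  | formal

/-- The ring of regular functions on the germ `(k², 0)`: rational functions regular at the origin,
locally convergent power series, or formal power series, in the coordinates `x₁, x₂`. -/
noncomputable def regularFunctions (k : Type*) [NormedField k] :
    FunctionKind → Subalgebra k (MvPowerSeries (Fin 2) k)
  | .rational => rationalSeries k
  | .convergent => convergentSeries k
  | .formal => ⊤

theorem polynomial_mem_regularFunctions {k : Type*} [NormedField k] (κ : FunctionKind)
    (P : MvPolynomial (Fin 2) k) :
    (P : MvPowerSeries (Fin 2) k) ∈ regularFunctions k κ := by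
  cases κ with
  | rational => exact ⟨P, 1, by simp, by rw [MvPolynomial.coe_one, one_mul]⟩
  | convergent => exact ConvergesNearZero.of_polynomial P
  | formal => exact Algebra.mem_top

/-- The second coordinate function `x₂`. -/
noncomputable def coordTwo (k : Type*) [NormedField k] (κ : FunctionKind) : regularFunctions k κ :=
  ⟨MvPowerSeries.X 1, by
    rw [← MvPolynomial.coe_X]
    exact polynomial_mem_regularFunctions κ _⟩

/-- The value of a matrix of functions at the origin. -/
noncomputable def valueAtZero {k : Type*} [NormedField k] {κ : FunctionKind} {d : ℕ}
    (M : Matrix (Fin d) (Fin d) (regularFunctions k κ)) : Matrix (Fin d) (Fin d) k :=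
  M.map fun a => MvPowerSeries.constantCoeff (a : MvPowerSeries (Fin 2) k)

/-- The multiplicity at the origin of the curve germ `{F = 0}`: the order of vanishing of `F`. -/
noncomputable def multAtZero {k : Type*} [NormedField k] {κ : FunctionKind}
    (F : regularFunctions k κ) : ℕ∞ :=
  (F : MvPowerSeries (Fin 2) k).order

/-- The corank of a matrix of functions at the origin. -/
noncomputable def corankAtZero {k : Type*} [NormedField k] {κ : FunctionKind} {d : ℕ}
    (M : Matrix (Fin d) (Fin d) (regularFunctions k κ)) : ℕ :=
  d - (valueAtZero M).rank

/-- `M` is maximally generated at the origin: its corank there is the multiplicity of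
`{det M = 0}`. -/
def MaximallyGeneratedAtZero {k : Type*} [NormedField k] {κ : FunctionKind} {d : ℕ}
    (M : Matrix (Fin d) (Fin d) (regularFunctions k κ)) : Prop :=
  (corankAtZero M : ℕ∞) = multAtZero M.det

/-- The tangent cone of the germ `{F = 0}` is `{x₁ ^ p = 0}`, `p` being its multiplicity: the
homogeneous part of lowest degree of `F` is `c x₁ ^ p` with `c ≠ 0`. -/
def HasTangentConeXOnePow {k : Type*} [NormedField k] {κ : FunctionKind}
    (F : regularFunctions k κ) : Prop :=
  ∃ p : ℕ, multAtZero F = p ∧ ∃ c : k, c ≠ 0 ∧ ∀ n : Fin 2 →₀ ℕ, n.degree = p →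
    MvPowerSeries.coeff n (F : MvPowerSeries (Fin 2) k) = if n = Finsupp.single 0 p then c else 0

/-- Local equivalence of matrices: `N = A M B` with `A`, `B` invertible. -/
def LocallyEquivalent {R : Type*} [CommRing R] {d : ℕ} (M N : Matrix (Fin d) (Fin d) R) : Prop :=
  ∃ A B : GL (Fin d) R, N = (A : Matrix (Fin d) (Fin d) R) * M * (B : Matrix (Fin d) (Fin d) R)

/-- The intersection multiplicity at the origin of `{f = 0}` and `{g = 0}`, that is
`dim_k 𝒪 / (f, g)`; it is `⊤` if the curves have a common component. -/
noncomputable def intersectionMult {k : Type*} [NormedField k] {κ : FunctionKind}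
    (f g : regularFunctions k κ) : ℕ∞ :=
  Module.length k (regularFunctions k κ ⧸ Ideal.span {f, g})

/-- The upper-triangular normal form with diagonal `f`: the superdiagonal entries are
`β x₂ ^ n` with `β ∈ {0, 1}`, the entries above them are polynomials in `x₂`. Exponents and degrees
are less than the intersection multiplicities of the two branches concerned. -/
structure IsNormalForm {k : Type*} [NormedField k] {κ : FunctionKind} {d : ℕ}
    (f : Fin d → regularFunctions k κ) (T : Matrix (Fin d) (Fin d) (regularFunctions k κ)) :
    Prop where
  lower : ∀ i j, j < i → T i j = 0
  diag : ∀ i, T i i = f i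
  superdiag : ∀ i j : Fin d, (i : ℕ) + 1 = j → ∃ (β : k) (n : ℕ), (β = 0 ∨ β = 1) ∧
    1 ≤ n ∧ (n : ℕ∞) < intersectionMult (f i) (f j) ∧ T i j = β • coordTwo k κ ^ n
  upper : ∀ i j : Fin d, (i : ℕ) + 2 ≤ j → ∃ h : Polynomial k,
    T i j = Polynomial.aeval (coordTwo k κ) h ∧
      (h = 0 ∨ 1 ≤ h.natTrailingDegree ∧ (h.natDegree : ℕ∞) < intersectionMult (f i) (f j))

/-!
The tangent cone condition says that every branch equation is `c x₁` plus terms of order at least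
two, with `c ≠ 0` (`HasLeading expOne`). By Weierstrass division the restriction of functions to a
branch is then a retraction of `k[[x₁, x₂]]` onto `k[[x₂]]`, and modulo the ideal of two distinct
branches every function is a polynomial in `x₂` of degree less than their intersection multiplicity.

Over the formal power series the normal form arises as follows. A matrix which vanishes at the
origin, of size equal to the multiplicity of its determinant, is triangularized branch by branch
(`exists_triangular`): restricted to the first branch the matrix is singular, and a primitive vector
of its kernel yields a column divisible by `g₁`. The quotient of that column by `g₁` is primitive
again; otherwise dividing it out would leave a matrix vanishing at the origin whose determinant has
order less than its size. In a triangular matrix the entry `(i, j)` may be changed by elements of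
the ideal `(gᵢ, gⱼ)` (`exists_elimination`). All entries then become series in `x₂`, and for
different branches these are truncated to polynomials of low degree.

Within the block of a multiple branch `f` this truncation is not available, since `(f, f) = (f)`.
The block is `f + N` with `N` strictly upper triangular over `k[[x₂]]`, and conjugation by
`GL(k[[x₂]])` preserves the scalar part. Over `k((x₂))` the nilpotent matrix `N` has a Jordan basis,
and a Hermite basis of the lattice `k[[x₂]] ^ m` relative to it consists of Laurent polynomial
combinations of the Jordan basis. In that basis `N` is strictly upper triangular, its entries are
polynomials, and those next to the diagonal are `0` or powers of `x₂` (`exists_conj_polynomial`).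
Between consecutive blocks the entries next to the diagonal are `0` or units times powers of `x₂`
modulo the branch, and a block scalar conjugation removes the units (`exists_block_scaling`).

It remains to descend from formal power series to the rational and the convergent functions. The
normal form has entries in the ring at hand, so the equivalence is a solution of the linear system
`A M = T C` over the formal power series. By the Artin–Rees lemma it can be replaced by a solution
over the ring with the same value at the origin (`IsGermRing.locallyEquivalent_of_formal`). The ring
need not be known to be noetherian: it suffices that its quotient by the equation of the curve is,
because the local ring of each smooth branch is a discrete valuation ring.
-/

section

open MvPowerSeries

/-! ### Division by a series with a distinguished leading monomial -/

instance mvPowerSeriesFinTwo_isDomain {k : Type*} [Field k] :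
    IsDomain (MvPowerSeries (Fin 2) k) :=
  NoZeroDivisors.to_isDomain _

/-- The monomial `e` is the only monomial of degree at most `|e|` that occurs in `g`. -/
structure HasLeading {k : Type*} [Field k] (e : Fin 2 →₀ ℕ) (g : MvPowerSeries (Fin 2) k) :
    Prop where
  coeff_ne : coeff e g ≠ 0
  coeff_eq : ∀ b, b ≠ e → b.degree ≤ e.degree → coeff b g = 0

theorem HasLeading.coeff_mul {k : Type*} [Field k] {e : Fin 2 →₀ ℕ} {g : MvPowerSeries (Fin 2) k}
    (hg : HasLeading e g) (q : MvPowerSeries (Fin 2) k) (n : Fin 2 →₀ ℕ) :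
    coeff (n + e) (q * g) = coeff n q * coeff e g +
      ∑ p ∈ Finset.HasAntidiagonal.antidiagonal (n + e),
        if p.1.degree < n.degree then coeff p.1 q * coeff p.2 g else 0 := by
  classical
  have hmem : (n, e) ∈ Finset.HasAntidiagonal.antidiagonal (n + e) := by simp
  rw [MvPowerSeries.coeff_mul, ← Finset.add_sum_erase _ _ hmem, ← Finset.add_sum_erase _ _ hmem]
  simp only [lt_irrefl, if_false, zero_add]
  congr 1
  refine Finset.sum_congr rfl fun p hp => ?_
  obtain ⟨hne, hp⟩ := Finset.mem_erase.1 hp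
  have hp' := Finset.HasAntidiagonal.mem_antidiagonal.1 hp
  split_ifs with h
  · rfl
  · have hdeg : p.1.degree + p.2.degree = n.degree + e.degree := by
      rw [← map_add, hp', map_add]
    rw [hg.coeff_eq p.2 ?_ (by omega), mul_zero]
    rintro h2
    refine hne (Prod.ext ?_ h2)
    rw [h2] at hp'
    exact add_right_cancel hp'

/-- Weierstrass division: the recursion `HasLeading.coeff_mul` for the coefficients of the
quotient can be solved degree by degree. -/
theorem HasLeading.exists_div {k : Type*} [Field k] {e : Fin 2 →₀ ℕ}
    {g : MvPowerSeries (Fin 2) k} (hg : HasLeading e g) (h : MvPowerSeries (Fin 2) k) :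
    ∃ q : MvPowerSeries (Fin 2) k, ∀ n, coeff (n + e) (h - q * g) = 0 := by
  classical
  let q : (Fin 2 →₀ ℕ) → k := WellFounded.fix (measure fun n : Fin 2 →₀ ℕ => n.degree).wf
    fun n rec => (coeff (n + e) h - ∑ p ∈ Finset.HasAntidiagonal.antidiagonal (n + e),
      if hp : p.1.degree < n.degree then rec p.1 hp * coeff p.2 g else 0) / coeff e g
  have hq : ∀ n, q n = (coeff (n + e) h - ∑ p ∈ Finset.HasAntidiagonal.antidiagonal (n + e),
      if p.1.degree < n.degree then q p.1 * coeff p.2 g else 0) / coeff e g := by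
    intro n
    conv_lhs => rw [show q n = _ from WellFounded.fix_eq _ _ n]
    rfl
  obtain ⟨Q, hQ⟩ : ∃ Q : MvPowerSeries (Fin 2) k, ∀ n, coeff n Q = q n := ⟨q, fun _ => rfl⟩
  refine ⟨Q, fun n => ?_⟩
  rw [map_sub, hg.coeff_mul, hQ n, hq n, div_mul_cancel₀ _ hg.coeff_ne]
  simp only [hQ]
  ring

theorem HasLeading.eq_zero_of_coeff_mul {k : Type*} [Field k] {e : Fin 2 →₀ ℕ}
    {g : MvPowerSeries (Fin 2) k} (hg : HasLeading e g) {q : MvPowerSeries (Fin 2) k}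
    (h : ∀ n, coeff (n + e) (q * g) = 0) : q = 0 := by
  have key : ∀ N, ∀ n : Fin 2 →₀ ℕ, n.degree < N → coeff n q = 0 := by
    intro N
    induction N with
    | zero => intro n hn; omega
    | succ N ih =>
      intro n hn
      have h1 := h n
      rw [hg.coeff_mul, Finset.sum_eq_zero, add_zero] at h1
      · exact (mul_eq_zero.1 h1).resolve_right hg.coeff_ne
      · intro p _
        split_ifs with hp
        · rw [ih p.1 (by omega), zero_mul]
        · rfl
  ext n
  simpa using key (n.degree + 1) n (Nat.lt_succ_self _)

/-- The series in `x₂` alone, as a subring of the series in two variables. -/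
noncomputable def inclTwo (k : Type*) [Field k] : PowerSeries k →ₐ[k] MvPowerSeries (Fin 2) k :=
  rename (fun _ : Unit => (1 : Fin 2))

theorem coeff_inclTwo {k : Type*} [Field k] (F : PowerSeries k) (n : Fin 2 →₀ ℕ) :
    coeff n (inclTwo k F) = if n 0 = 0 then PowerSeries.coeff (n 1) F else 0 := by
  let e : Unit ↪ Fin 2 := ⟨fun _ => 1, fun _ _ _ => rfl⟩
  split_ifs with h
  · have : n = Finsupp.embDomain e (Finsupp.single () (n 1)) := by
      rw [Finsupp.embDomain_single]
      ext i
      fin_cases i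
      · exact h.trans (Finsupp.single_eq_of_ne (by decide)).symm
      · exact (Finsupp.single_eq_same (a := (1 : Fin 2))).symm
    conv_lhs => rw [this]
    exact coeff_embDomain_rename e F _
  · refine coeff_rename_eq_zero _ F ?_
    rintro ⟨m, rfl⟩
    apply h
    rw [Finsupp.mapDomain_of_notMem_range]
    simp

theorem inclTwo_X {k : Type*} [Field k] : inclTwo k PowerSeries.X = X 1 :=
  rename_X _ _

theorem inclTwo_injective {k : Type*} [Field k] : Function.Injective (inclTwo k) :=
  rename_injective (⟨fun _ => 1, fun _ _ _ => rfl⟩ : Unit ↪ Fin 2)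

theorem inclTwo_aeval {k : Type*} [Field k] (P : Polynomial k) :
    inclTwo k (P : PowerSeries k) = Polynomial.aeval (X 1 : MvPowerSeries (Fin 2) k) P := by
  have : (P : PowerSeries k) = Polynomial.aeval (PowerSeries.X : PowerSeries k) P := by
    induction P using Polynomial.induction_on' with
    | add p q hp hq => simp [hp, hq]
    | monomial n a =>
      rw [← Polynomial.C_mul_X_pow_eq_monomial, Polynomial.coe_mul, Polynomial.coe_C,
        Polynomial.coe_pow, Polynomial.coe_X, map_mul, Polynomial.aeval_C, map_pow,
        Polynomial.aeval_X]
      rfl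
  rw [this, ← Polynomial.aeval_algHom_apply, inclTwo_X]

theorem constantCoeff_inclTwo {k : Type*} [Field k] (F : PowerSeries k) :
    constantCoeff (inclTwo k F) = PowerSeries.constantCoeff F := by
  rw [← coeff_zero_eq_constantCoeff_apply, coeff_inclTwo]
  simp

/-- The exponent of `x₁`. Branches of the curves considered are the series with this leading
monomial: their tangent is the line `x₁ = 0`. -/
noncomputable abbrev expOne : Fin 2 →₀ ℕ := Finsupp.single 0 1

theorem exists_add_expOne {n : Fin 2 →₀ ℕ} (h : n 0 ≠ 0) : ∃ m, n = m + expOne :=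
  ⟨n - expOne, (tsub_add_cancel_of_le (by
    intro i
    fin_cases i
    · simpa [Nat.one_le_iff_ne_zero] using h
    · simp)).symm⟩

/-- Modulo a branch every function is a series in `x₂`. -/
theorem HasLeading.exists_div_inclTwo {k : Type*} [Field k] {g : MvPowerSeries (Fin 2) k}
    (hg : HasLeading expOne g) (h : MvPowerSeries (Fin 2) k) :
    ∃ (q : MvPowerSeries (Fin 2) k) (r : PowerSeries k), h = q * g + inclTwo k r := by
  obtain ⟨q, hq⟩ := hg.exists_div h
  refine ⟨q, PowerSeries.mk fun i => coeff (Finsupp.single 1 i) (h - q * g), ?_⟩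
  rw [← sub_eq_iff_eq_add']
  ext n
  rw [coeff_inclTwo]
  split_ifs with h0
  · rw [PowerSeries.coeff_mk]
    congr 1
    congr 1
    ext i
    fin_cases i
    · simpa using h0
    · simp
  · obtain ⟨m, rfl⟩ := exists_add_expOne h0
    exact hq m

theorem HasLeading.eq_zero_of_dvd {k : Type*} [Field k] {g : MvPowerSeries (Fin 2) k}
    (hg : HasLeading expOne g) {r : PowerSeries k} (h : g ∣ inclTwo k r) : r = 0 := by
  obtain ⟨q, hq⟩ := h
  have hq0 : q = 0 := hg.eq_zero_of_coeff_mul fun n => by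
    rw [mul_comm, ← hq, coeff_inclTwo, if_neg]
    simp
  rw [hq0, mul_zero] at hq
  exact inclTwo_injective (by rw [hq, map_zero])

/-- The smooth curve `{g = 0}` is parametrized by `x₂`: restriction of functions to the curve is a
retraction of `k[[x₁, x₂]]` onto `k[[x₂]]` with kernel `(g)`. -/
theorem HasLeading.exists_retraction {k : Type*} [Field k] {g : MvPowerSeries (Fin 2) k}
    (hg : HasLeading expOne g) : ∃ π : MvPowerSeries (Fin 2) k →+* PowerSeries k,
      (∀ r, π (inclTwo k r) = r) ∧ ∀ h, π h = 0 ↔ g ∣ h := by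
  let φ : PowerSeries k →+* MvPowerSeries (Fin 2) k ⧸ Ideal.span {g} :=
    (Ideal.Quotient.mk (Ideal.span {g})).comp (inclTwo k : PowerSeries k →+* _)
  have hφ : Function.Bijective φ := by
    constructor
    · rw [injective_iff_map_eq_zero]
      intro r hr
      refine hg.eq_zero_of_dvd ?_
      rw [← Ideal.mem_span_singleton]
      exact Ideal.Quotient.eq_zero_iff_mem.1 hr
    · intro x
      obtain ⟨h, rfl⟩ := Ideal.Quotient.mk_surjective x
      obtain ⟨q, r, hqr⟩ := hg.exists_div_inclTwo h
      refine ⟨r, ?_⟩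
      refine (Ideal.Quotient.eq.2 ?_).symm
      rw [Ideal.mem_span_singleton]
      refine ⟨q, ?_⟩
      rw [hqr]
      simp [mul_comm]
  refine ⟨((RingEquiv.ofBijective φ hφ).symm : _ →+* PowerSeries k).comp
    (Ideal.Quotient.mk (Ideal.span {g})), fun r => ?_, fun h => ?_⟩
  · exact (RingEquiv.ofBijective φ hφ).symm_apply_apply r
  · rw [← Ideal.mem_span_singleton, ← Ideal.Quotient.eq_zero_iff_mem]
    simp

theorem HasLeading.prime {k : Type*} [Field k] {g : MvPowerSeries (Fin 2) k}
    (hg : HasLeading expOne g) : Prime g := by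
  obtain ⟨π, h1, h2⟩ := hg.exists_retraction
  refine ⟨?_, ?_, fun a b hab => ?_⟩
  · rintro rfl
    simpa using hg.coeff_ne
  · intro hu
    have := (h2 1).2 hu.dvd
    simp at this
  · rw [← h2, map_mul, mul_eq_zero, h2, h2] at hab
    exact hab

theorem HasLeading.constantCoeff_eq {k : Type*} [Field k] {g : MvPowerSeries (Fin 2) k}
    (hg : HasLeading expOne g) : constantCoeff g = 0 := by
  rw [← coeff_zero_eq_constantCoeff_apply]
  refine hg.coeff_eq 0 ?_ (by simp)
  intro h
  have := DFunLike.congr_fun h 0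
  simp at this

/-! ### Equivalence of matrices and completion of primitive vectors -/

theorem LocallyEquivalent.refl {R : Type*} [CommRing R] {d : ℕ} (M : Matrix (Fin d) (Fin d) R) :
    LocallyEquivalent M M :=
  ⟨1, 1, by simp⟩

theorem LocallyEquivalent.trans {R : Type*} [CommRing R] {d : ℕ}
    {M N L : Matrix (Fin d) (Fin d) R} (h : LocallyEquivalent M N) (h' : LocallyEquivalent N L) :
    LocallyEquivalent M L := by
  obtain ⟨A, B, rfl⟩ := h
  obtain ⟨A', B', rfl⟩ := h'
  exact ⟨A' * A, B * B', by simp only [Units.val_mul, Matrix.mul_assoc]⟩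

theorem LocallyEquivalent.associated_det {R : Type*} [CommRing R] {d : ℕ}
    {M N : Matrix (Fin d) (Fin d) R} (h : LocallyEquivalent M N) : Associated M.det N.det := by
  obtain ⟨A, B, rfl⟩ := h
  have hA : IsUnit (A : Matrix (Fin d) (Fin d) R).det := (Matrix.isUnit_iff_isUnit_det _).1 A.isUnit
  have hB : IsUnit (B : Matrix (Fin d) (Fin d) R).det := (Matrix.isUnit_iff_isUnit_det _).1 B.isUnit
  refine ⟨hA.unit * hB.unit, ?_⟩
  rw [Matrix.det_mul, Matrix.det_mul, Units.val_mul, IsUnit.unit_spec, IsUnit.unit_spec]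
  ring

theorem LocallyEquivalent.map_eq_zero {R R' : Type*} [CommRing R] [CommRing R'] {d : ℕ}
    {M N : Matrix (Fin d) (Fin d) R} (h : LocallyEquivalent M N) (φ : R →+* R')
    (hM : M.map φ = 0) : N.map φ = 0 := by
  obtain ⟨A, B, rfl⟩ := h
  rw [Matrix.map_mul, Matrix.map_mul, hM, Matrix.mul_zero, Matrix.zero_mul]

/-- The matrix with first column `(a, 0, …, 0)`, the rest of the first row being `r`, and `A` in
the lower right corner. -/
def border {R : Type*} [CommRing R] {n : ℕ} (a : R) (r : Fin n → R)
    (A : Matrix (Fin n) (Fin n) R) : Matrix (Fin (n + 1)) (Fin (n + 1)) R :=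
  Matrix.of (Fin.cons (Fin.cons a r) fun i => Fin.cons 0 (A i))

section border

variable {R : Type*} [CommRing R] {n : ℕ} (a : R) (r : Fin n → R) (A : Matrix (Fin n) (Fin n) R)

@[simp] theorem border_zero_zero : border a r A 0 0 = a := rfl

@[simp] theorem border_zero_succ (j : Fin n) : border a r A 0 j.succ = r j := rfl

@[simp] theorem border_succ_zero (i : Fin n) : border a r A i.succ 0 = 0 := rfl

@[simp] theorem border_succ_succ (i j : Fin n) : border a r A i.succ j.succ = A i j := rfl

theorem border_mul (a' : R) (r' : Fin n → R) (A' : Matrix (Fin n) (Fin n) R) :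
    border a r A * border a' r' A' =
      border (a * a') (a • r' + Matrix.vecMul r A') (A * A') := by
  ext i j
  refine Fin.cases ?_ (fun i => ?_) i <;> refine Fin.cases ?_ (fun j => ?_) j <;>
    simp [Matrix.mul_apply, Fin.sum_univ_succ, Matrix.vecMul, dotProduct]

theorem det_border : (border a r A).det = a * A.det := by
  rw [Matrix.det_succ_column_zero, Fin.sum_univ_succ]
  simp only [border_zero_zero, border_succ_zero]
  simp
  rfl

theorem eq_border {M : Matrix (Fin (n + 1)) (Fin (n + 1)) R} (h : ∀ i : Fin n, M i.succ 0 = 0) :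
    M = border (M 0 0) (fun j => M 0 j.succ) (M.submatrix Fin.succ Fin.succ) := by
  ext i j
  refine Fin.cases ?_ (fun i => ?_) i <;> refine Fin.cases ?_ (fun j => ?_) j <;> simp [h]

theorem isUnit_border (ha : IsUnit a) (hA : IsUnit A) : IsUnit (border a r A) := by
  rw [Matrix.isUnit_iff_isUnit_det] at hA ⊢
  rw [det_border]
  exact ha.mul hA

end border

/-- A vector with an invertible coordinate is the first column of an invertible matrix: replace
a column of the identity matrix by the vector and permute. -/
theorem exists_GL_col_eq {R : Type*} [CommRing R] {n : ℕ} (v : Fin (n + 1) → R)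
    {i : Fin (n + 1)} (hv : IsUnit (v i)) :
    ∃ B : GL (Fin (n + 1)) R, ∀ l, (B : Matrix (Fin (n + 1)) (Fin (n + 1)) R) l 0 = v l := by
  let σ := Equiv.swap (0 : Fin (n + 1)) i
  let B : Matrix (Fin (n + 1)) (Fin (n + 1)) R :=
    ((1 : Matrix _ _ R).updateCol 0 (v ∘ σ)).submatrix σ id
  have hB : IsUnit B := by
    rw [Matrix.isUnit_iff_isUnit_det, Matrix.det_permute, ← Matrix.cramer_apply,
      Matrix.cramer_one]
    refine IsUnit.mul ?_ ?_
    · exact (Units.map (Int.castRingHom R : ℤ →* R) (Equiv.Perm.sign σ)).isUnit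
    · simpa [σ] using hv
  refine ⟨hB.unit, fun l => ?_⟩
  rw [IsUnit.unit_spec]
  simp [B, σ]

/-- A nonzero vector over `k[[t]]` is a power of `t` times a vector with an invertible
coordinate. -/
theorem exists_eq_X_pow_mul_primitive {k : Type*} [Field k] {ι : Type*} [Finite ι]
    {v : ι → PowerSeries k} (hv : v ≠ 0) :
    ∃ (a : ℕ) (w : ι → PowerSeries k) (i : ι), (∀ l, v l = PowerSeries.X ^ a * w l) ∧
      IsUnit (w i) := by
  obtain ⟨i₀, hi₀⟩ := Function.ne_iff.1 hv
  have : Nonempty ι := ⟨i₀⟩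
  obtain ⟨i, hi⟩ := Finite.exists_min fun l => (v l).order
  have hne : v i ≠ 0 := by
    intro h
    have := hi i₀
    simp only [h, PowerSeries.order_zero, top_le_iff, PowerSeries.order_eq_top] at this
    exact hi₀ this
  have hdvd : ∀ l, PowerSeries.X ^ (v i).order.toNat ∣ v l := by
    intro l
    rw [PowerSeries.X_pow_dvd_iff]
    intro m hm
    refine PowerSeries.coeff_of_lt_order m (lt_of_lt_of_le ?_ (hi l))
    rw [← ENat.natCast_toNat (PowerSeries.order_eq_top.not.2 hne)]
    exact_mod_cast hm
  choose w hw using hdvd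
  refine ⟨_, w, i, hw, ?_⟩
  rw [PowerSeries.isUnit_iff_constantCoeff, isUnit_iff_ne_zero]
  intro h0
  have h1 : PowerSeries.X ∣ w i := PowerSeries.X_dvd_iff.2 h0
  have h2 : PowerSeries.X ^ ((v i).order.toNat + 1) ∣ v i := by
    conv_rhs => rw [hw i]
    rw [pow_succ]
    exact mul_dvd_mul_left _ h1
  have h3 := PowerSeries.X_pow_dvd_iff.1 h2 (v i).order.toNat (Nat.lt_succ_self _)
  exact PowerSeries.coeff_order hne h3

/-! ### Triangular form -/

theorem le_order_det_of_map_eq_zero {k : Type*} [Field k] {n : ℕ}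
    {M : Matrix (Fin n) (Fin n) (MvPowerSeries (Fin 2) k)} (h : M.map constantCoeff = 0) :
    (n : ℕ∞) ≤ M.det.order := by
  have hM : ∀ i j, 1 ≤ (M i j).order := fun i j => by
    rw [one_le_order_iff_constCoeff_eq_zero]
    exact congrFun (congrFun h i) j
  refine nat_le_order fun e he => ?_
  rw [Matrix.det_apply, map_sum]
  refine Finset.sum_eq_zero fun σ _ => ?_
  have : coeff e (∏ i, M (σ i) i) = 0 := by
    refine coeff_of_lt_order (lt_of_lt_of_le (Nat.cast_lt.2 he) ?_)
    rw [order_prod]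
    calc (n : ℕ∞) = ∑ _i : Fin n, 1 := by simp
      _ ≤ _ := Finset.sum_le_sum fun i _ => hM _ _
  rcases Int.units_eq_one_or (Equiv.Perm.sign σ) with h | h <;> simp [h, this]

theorem HasLeading.order_eq {k : Type*} [Field k] {e : Fin 2 →₀ ℕ} {g : MvPowerSeries (Fin 2) k}
    (hg : HasLeading e g) : g.order = e.degree := by
  rw [order_eq_nat]
  refine ⟨⟨e, hg.coeff_ne, rfl⟩, fun b hb => hg.coeff_eq b ?_ hb.le⟩
  rintro rfl
  exact lt_irrefl _ hb

/-- A matrix vanishing at the origin whose determinant is a product of as many branch equations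
as it has columns can be made triangular, with these equations on the diagonal in any
prescribed order: the kernel of the matrix restricted to the first branch contains a primitive
vector, and the column which it yields is the first equation times a vector, again primitive
because of the order of the determinant. -/
theorem exists_triangular {k : Type*} [Field k] {n : ℕ} (g : Fin n → MvPowerSeries (Fin 2) k)
    (hg : ∀ i, HasLeading expOne (g i)) (M : Matrix (Fin n) (Fin n) (MvPowerSeries (Fin 2) k))
    (h0 : M.map constantCoeff = 0) (hdet : Associated M.det (∏ i, g i)) :
    ∃ T, LocallyEquivalent M T ∧ (∀ i j, j < i → T i j = 0) ∧ ∀ i, T i i = g i := by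
  induction n with
  | zero => exact ⟨M, .refl M, fun i => i.elim0, fun i => i.elim0⟩
  | succ n ih =>
    obtain ⟨π, hπ, hker⟩ := (hg 0).exists_retraction
    have hg0 : g 0 ≠ 0 := (hg 0).prime.ne_zero
    obtain ⟨v, hv, hMv⟩ : ∃ v, v ≠ 0 ∧ (M.map π).mulVec v = 0 := by
      rw [Matrix.exists_mulVec_eq_zero_iff, ← RingHom.mapMatrix_apply, ← RingHom.map_det, hker]
      exact (Finset.dvd_prod_of_mem g (Finset.mem_univ 0)).trans hdet.symm.dvd
    obtain ⟨a, v', i, hvv', hi⟩ := exists_eq_X_pow_mul_primitive hv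
    obtain ⟨B, hB⟩ := exists_GL_col_eq (fun l => inclTwo k (v' l)) (hi.map (inclTwo k))
    have hcol : ∀ l, g 0 ∣
        (M * (B : Matrix (Fin (n + 1)) (Fin (n + 1)) (MvPowerSeries (Fin 2) k))) l 0 := by
      intro l
      rw [← hker, Matrix.mul_apply, map_sum]
      have h1 := congrFun hMv l
      simp only [Matrix.mulVec, dotProduct, Matrix.map_apply, hvv', Pi.zero_apply] at h1
      simp only [hB, map_mul, hπ]
      have h2 : PowerSeries.X ^ a * ∑ x, π (M l x) * v' x = 0 := by
        rw [Finset.mul_sum, ← h1]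
        exact Finset.sum_congr rfl fun x _ => by ring
      exact (mul_eq_zero.1 h2).resolve_left (pow_ne_zero _ PowerSeries.X_ne_zero)
    choose w hw using hcol
    set MB := M * (B : Matrix (Fin (n + 1)) (Fin (n + 1)) (MvPowerSeries (Fin 2) k)) with hMB
    have hMMB : LocallyEquivalent M MB := ⟨1, B, by simp [hMB]⟩
    have hMB0 := hMMB.map_eq_zero _ h0
    have hdetMB : MB.det = g 0 * (MB.updateCol 0 w).det := by
      rw [← Matrix.det_updateCol_smul]
      congr 1
      ext l j
      refine Fin.cases ?_ (fun j => ?_) j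
      · simp [hw]
      · simp
    have hcancel : ∀ x, Associated M.det (g 0 * x) → Associated x (∏ i : Fin n, g i.succ) := by
      intro x hx
      have := hx.symm.trans hdet
      rw [Fin.prod_univ_succ] at this
      exact Associated.of_mul_left this (Associated.refl _) hg0
    -- If `w` vanished at the origin, the order of the determinant would be too small.
    obtain ⟨l, hl⟩ : ∃ l, IsUnit (w l) := by
      by_contra hcon
      push Not at hcon
      have hzero : (MB.updateCol 0 w).map constantCoeff = 0 := by
        ext l j
        refine Fin.cases ?_ (fun j => ?_) j
        · have := hcon l
          rw [isUnit_iff_constantCoeff, isUnit_iff_ne_zero, not_not] at this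
          simpa using this
        · simpa using congrFun (congrFun hMB0 l) j.succ
      have h1 := le_order_det_of_map_eq_zero hzero
      obtain ⟨u, hu⟩ := hcancel _ (hdetMB ▸ hMMB.associated_det)
      have h2 : (∏ i : Fin n, g i.succ).order = n := by
        rw [order_prod]
        simp [fun i => (hg i).order_eq]
      rw [← hu, order_mul] at h2
      have h3 := h1.trans (le_self_add.trans h2.le)
      exact absurd (Nat.cast_le.1 h3) (by omega)
    obtain ⟨A, hA⟩ := exists_GL_col_eq w hl
    set N := ((A⁻¹ : GL _ _) : Matrix (Fin (n + 1)) (Fin (n + 1)) (MvPowerSeries (Fin 2) k)) * MB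
      with hN
    have hMN : LocallyEquivalent M N := hMMB.trans ⟨A⁻¹, 1, by simp [hN]⟩
    have hNcol : ∀ i, N i 0 = if i = 0 then g 0 else 0 := by
      intro i
      have h1 : ((A⁻¹ : GL _ _) : Matrix (Fin (n + 1)) (Fin (n + 1)) (MvPowerSeries (Fin 2) k)) *
          (A : Matrix (Fin (n + 1)) (Fin (n + 1)) (MvPowerSeries (Fin 2) k)) = 1 := by
        rw [← Units.val_mul, inv_mul_cancel, Units.val_one]
      have h2 := congrFun (congrFun h1 i) 0
      rw [Matrix.mul_apply] at h2
      rw [hN, Matrix.mul_apply]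
      calc _ = g 0 * ∑ x,
            ((A⁻¹ : GL _ _) : Matrix (Fin (n + 1)) (Fin (n + 1)) (MvPowerSeries (Fin 2) k)) i x *
            (A : Matrix (Fin (n + 1)) (Fin (n + 1)) (MvPowerSeries (Fin 2) k)) x 0 := by
            rw [Finset.mul_sum]
            refine Finset.sum_congr rfl fun x _ => ?_
            rw [hw, hA]
            ring
        _ = _ := by
            rw [h2, Matrix.one_apply]
            split_ifs <;> simp
    have hNb := eq_border (M := N) fun i => by rw [hNcol]; simp
    have hN00 : N 0 0 = g 0 := by rw [hNcol]; simp
    rw [hN00] at hNb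
    have hN0 := hMN.map_eq_zero _ h0
    obtain ⟨T', ⟨A', B', hT'⟩, hlow, hdiag⟩ := ih (fun i => g i.succ) (fun i => hg _)
      (N.submatrix Fin.succ Fin.succ)
      (by ext i j; simpa using congrFun (congrFun hN0 i.succ) j.succ)
      (hcancel _ (by
        have := hMN.associated_det
        rw [hNb, det_border] at this
        exact this))
    have hA1 := isUnit_border (1 : MvPowerSeries (Fin 2) k) 0 _ isUnit_one A'.isUnit
    have hB1 := isUnit_border (1 : MvPowerSeries (Fin 2) k) 0 _ isUnit_one B'.isUnit
    refine ⟨border (g 0) (Matrix.vecMul (fun j : Fin n => N 0 j.succ) B') T',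
      hMN.trans ⟨hA1.unit, hB1.unit, ?_⟩, ?_, ?_⟩
    · rw [IsUnit.unit_spec, IsUnit.unit_spec]
      conv_rhs => rw [hNb]
      rw [border_mul, border_mul, hT']
      simp
    · intro i j
      refine Fin.cases ?_ (fun i => ?_) i <;> refine Fin.cases ?_ (fun j => ?_) j
      · simp
      · simp
      · simp
      · simpa using hlow i j
    · intro i
      refine Fin.cases ?_ (fun i => ?_) i
      · simp
      · simpa using hdiag i

/-! ### Elimination above the diagonal -/

theorem isUnit_one_sub_of_strictly_upper {R : Type*} [CommRing R] {d : ℕ}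
    {a : Matrix (Fin d) (Fin d) R} (h : ∀ i j, j ≤ i → a i j = 0) : IsUnit (1 - a) := by
  rw [Matrix.isUnit_iff_isUnit_det, Matrix.det_of_isUpperTriangular]
  · refine IsUnit.prod_univ_iff.2 fun i => ?_
    simp [h i i le_rfl]
  · intro i j hij
    have hij : j < i := hij
    simp [h i j hij.le, Matrix.one_apply_ne hij.ne']

/-- In a triangular matrix the entry `(i, j)` can be changed by any element of the ideal of the
diagonal entries `(i, i)` and `(j, j)`, at the cost of changing entries further away from the
diagonal. Proceeding diagonal by diagonal, all entries in an upward closed set `Q` of positions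
are brought into a prescribed shape `P`. -/
theorem exists_elimination {R : Type*} [CommRing R] {d : ℕ} (T : Matrix (Fin d) (Fin d) R)
    (hT : ∀ i j, j < i → T i j = 0) (Q : Fin d → Fin d → Prop) (hQlt : ∀ i j, Q i j → i < j)
    (hQ : ∀ i j i' j', Q i j → i' ≤ i → j ≤ j' → Q i' j') (P : Fin d → Fin d → R → Prop)
    (hP : ∀ i j, Q i j → ∀ x, ((i : ℕ) + 1 = j → x = T i j) →
      ∃ y, P i j y ∧ x - y ∈ Ideal.span {T i i, T j j}) :
    ∃ T', LocallyEquivalent T T' ∧ (∀ i j, ¬ Q i j → T' i j = T i j) ∧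
      ∀ i j, Q i j → P i j (T' i j) := by
  classical
  have key : ∀ w : ℕ, ∃ T', LocallyEquivalent T T' ∧ (∀ i j, ¬ Q i j → T' i j = T i j) ∧
      (∀ i j, Q i j → (j : ℕ) ≤ i + w → P i j (T' i j)) ∧ (w = 0 → T' = T) := by
    intro w
    induction w with
    | zero =>
      refine ⟨T, .refl T, fun _ _ _ => rfl, fun i j h h' => ?_, fun _ => rfl⟩
      have h1 : (i : ℕ) < j := hQlt i j h
      omega
    | succ w ih =>
      obtain ⟨T', hTT', hnQ, hPw, hw0⟩ := ih
      have hup : ∀ i j, j < i → T' i j = 0 := fun i j hij => by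
        rw [hnQ i j fun h => (hQlt i j h).not_gt hij, hT i j hij]
      have hdiag : ∀ i, T' i i = T i i := fun i => hnQ i i fun h => (hQlt i i h).false
      have hch : ∀ i j, ∃ α β : R, Q i j → (j : ℕ) = i + (w + 1) →
          P i j (T' i j - (α * T i i + β * T j j)) := by
        intro i j
        by_cases h : Q i j ∧ (j : ℕ) = i + (w + 1)
        · obtain ⟨y, hy, hmem⟩ := hP i j h.1 (T' i j) fun h1 => by rw [hw0 (by omega)]
          obtain ⟨α, β, hαβ⟩ := Ideal.mem_span_pair.1 hmem
          refine ⟨α, β, fun _ _ => ?_⟩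
          rwa [hαβ, sub_sub_cancel]
        · exact ⟨0, 0, fun h1 h2 => absurd ⟨h1, h2⟩ h⟩
      choose α β hαβ using hch
      let a : Matrix (Fin d) (Fin d) R := fun i j =>
        if Q i j ∧ (j : ℕ) = i + (w + 1) then β i j else 0
      let b : Matrix (Fin d) (Fin d) R := fun i j =>
        if Q i j ∧ (j : ℕ) = i + (w + 1) then α i j else 0
      have ha : ∀ i j, ¬ (Q i j ∧ (j : ℕ) = i + (w + 1)) → a i j = 0 := fun i j h => if_neg h
      have hb : ∀ i j, ¬ (Q i j ∧ (j : ℕ) = i + (w + 1)) → b i j = 0 := fun i j h => if_neg h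
      have hua : IsUnit (1 - a) := isUnit_one_sub_of_strictly_upper fun i j hij =>
        ha i j fun h => by
        have : (j : ℕ) ≤ i := hij
        omega
      have hub : IsUnit (1 - b) := isUnit_one_sub_of_strictly_upper fun i j hij =>
        hb i j fun h => by
        have : (j : ℕ) ≤ i := hij
        omega
      have h1 : ∀ i l j, ¬ (Q i l ∧ (l : ℕ) = i + (w + 1) ∧ l ≤ j) → a i l * T' l j = 0 := by
        intro i l j h
        by_cases hl : l ≤ j
        · rw [ha i l fun h' => h ⟨h'.1, h'.2, hl⟩, zero_mul]
        · rw [hup l j (not_le.1 hl), mul_zero]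
      have h2 : ∀ i l j, ¬ (Q l j ∧ (j : ℕ) = l + (w + 1) ∧ i ≤ l) → T' i l * b l j = 0 := by
        intro i l j h
        by_cases hl : i ≤ l
        · rw [hb l j fun h' => h ⟨h'.1, h'.2, hl⟩, mul_zero]
        · rw [hup i l (not_le.1 hl), zero_mul]
      have hexp : (1 - a) * T' * (1 - b) = T' - a * T' - T' * b + a * T' * b := by noncomm_ring
      have hjle : ∀ i j, ¬ Q i j ∨ (j : ℕ) ≤ i + (w + 1) → (a * T' * b) i j = 0 := by
        intro i j hij
        rw [Matrix.mul_apply]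
        refine Finset.sum_eq_zero fun m _ => ?_
        rw [Matrix.mul_apply, Finset.sum_mul]
        refine Finset.sum_eq_zero fun l _ => ?_
        by_cases h : Q i l ∧ (l : ℕ) = i + (w + 1) ∧ l ≤ m
        · have hlm : (l : ℕ) ≤ m := h.2.2
          rw [hb m j, mul_zero]
          rintro ⟨hm1, hm2⟩
          rcases hij with hij | hij
          · exact hij (hQ i l i j h.1 le_rfl (h.2.2.trans (hQlt m j hm1).le))
          · omega
        · rw [h1 i l m h, zero_mul]
      refine ⟨(1 - a) * T' * (1 - b), hTT'.trans ⟨hua.unit, hub.unit, rfl⟩, ?_, ?_, by simp⟩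
      · intro i j hij
        rw [hexp, ← hnQ i j hij]
        simp only [Matrix.add_apply, Matrix.sub_apply]
        rw [hjle i j (Or.inl hij), Matrix.mul_apply, Matrix.mul_apply, Finset.sum_eq_zero,
          Finset.sum_eq_zero]
        · ring
        · exact fun l _ => h2 i l j fun h => hij (hQ l j i j h.1 h.2.2 le_rfl)
        · exact fun l _ => h1 i l j fun h => hij (hQ i l i j h.1 le_rfl h.2.2)
      · intro i j hij hle
        rw [hexp]
        simp only [Matrix.add_apply, Matrix.sub_apply]
        rw [hjle i j (Or.inr hle), add_zero]
        rcases hle.lt_or_eq with hlt | heq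
        · rw [Matrix.mul_apply, Matrix.mul_apply, Finset.sum_eq_zero, Finset.sum_eq_zero, sub_zero,
            sub_zero]
          · exact hPw i j hij (by omega)
          · refine fun l _ => h2 i l j fun h => ?_
            have : (i : ℕ) ≤ l := h.2.2
            omega
          · refine fun l _ => h1 i l j fun h => ?_
            have : (l : ℕ) ≤ j := h.2.2
            omega
        · have hs1 : (a * T') i j = β i j * T j j := by
            rw [Matrix.mul_apply, Finset.sum_eq_single j]
            · rw [hdiag, show a i j = β i j from if_pos ⟨hij, heq⟩]
            · exact fun l _ hl => h1 i l j fun h => hl (Fin.ext (by omega))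
            · simp
          have hs2 : (T' * b) i j = α i j * T i i := by
            rw [Matrix.mul_apply, Finset.sum_eq_single i]
            · rw [hdiag, show b i j = α i j from if_pos ⟨hij, heq⟩, mul_comm]
            · exact fun l _ hl => h2 i l j fun h => hl (Fin.ext (by omega))
            · simp
          rw [hs1, hs2, sub_sub, add_comm (β i j * T j j)]
          exact hαβ i j hij heq
  obtain ⟨T', h1, h2, h3, -⟩ := key d
  exact ⟨T', h1, h2, fun i j h => h3 i j h (by omega)⟩

end

/-! ### Jordan form of nilpotent matrices over a field -/

open Polynomial in
theorem exists_basis_quotient_X_pow (K : Type*) [Field K] (e : ℕ) :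
    ∃ b : Module.Basis (Fin e) K (K[X] ⧸ Submodule.span K[X] {(X : K[X]) ^ e}),
      ∀ a, b a = Submodule.Quotient.mk (X ^ (a : ℕ)) := by
  have hdim : (AdjoinRoot.powerBasis' (monic_X_pow (R := K) e)).dim = e := by
    rw [AdjoinRoot.powerBasis'_dim, natDegree_X_pow]
  have : ∃ b : Module.Basis (Fin e) K (AdjoinRoot ((X : K[X]) ^ e)),
      ∀ a, b a = AdjoinRoot.mk _ (X ^ (a : ℕ)) := by
    refine ⟨(AdjoinRoot.powerBasis' (monic_X_pow (R := K) e)).basis.reindex (finCongr hdim),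
      fun a => ?_⟩
    rw [Module.Basis.reindex_apply, PowerBasis.basis_eq_pow, AdjoinRoot.powerBasis'_gen, map_pow]
    rfl
  exact this

open Polynomial in
/-- A nilpotent endomorphism has a basis consisting of chains, by the structure theorem for
torsion modules over `K[X]`. -/
theorem exists_chain_basis {K V : Type*} [Field K] [AddCommGroup V] [Module K V]
    [FiniteDimensional K V] {f : Module.End K V} (hf : IsNilpotent f) :
    ∃ (d : ℕ) (e : Fin d → ℕ) (b : Module.Basis (Σ i, Fin (e i)) K V),
      ∀ i (a : Fin (e i)), f (b ⟨i, a⟩) =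
        if h : (a : ℕ) + 1 < e i then b ⟨i, ⟨a + 1, h⟩⟩ else 0 := by
  obtain ⟨n, hn⟩ := hf
  have htors : Module.IsTorsion' (Module.AEval' f) (Submonoid.powers (X : K[X])) := by
    intro x
    refine ⟨⟨X ^ n, n, rfl⟩, ?_⟩
    obtain ⟨v, rfl⟩ := (Module.AEval'.of f).surjective x
    change (X ^ n : K[X]) • (Module.AEval'.of f) v = 0
    rw [Module.AEval'.X_pow_smul_of, hn]
    simp
  obtain ⟨d, e, ⟨φ⟩⟩ := Module.torsion_by_prime_power_decomposition (irreducible_X (R := K)) htors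
  choose b₀ hb₀ using fun i => exists_basis_quotient_X_pow K (e i)
  let B : Module.Basis (Σ i, Fin (e i)) K
      (DirectSum (Fin d) fun i => K[X] ⧸ Submodule.span K[X] {(X : K[X]) ^ e i}) :=
    DFinsupp.basis b₀
  have hB : ∀ i a, B ⟨i, a⟩ = DirectSum.lof K[X] (Fin d)
      (fun i => K[X] ⧸ Submodule.span K[X] {(X : K[X]) ^ e i}) i (b₀ i a) := by
    intro i a
    refine Module.Basis.apply_eq_iff.2 ?_
    change (sigmaFinsuppLequivDFinsupp K).symm (DFinsupp.mapRange.linearEquiv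
      (fun i => (b₀ i).repr) (DFinsupp.single i (b₀ i a))) = _
    rw [LinearEquiv.symm_apply_eq]
    simp [DFinsupp.mapRange_single]
  let b := (B.map (φ.restrictScalars K).symm).map (Module.AEval'.of f).symm
  have hb : ∀ s, Module.AEval'.of f (b s) = φ.symm (B s) := by
    intro s
    simp [b]
  refine ⟨d, e, b, fun i a => ?_⟩
  apply (Module.AEval'.of f).injective
  rw [← Module.AEval'.X_smul_of, hb, ← map_smul, hB, ← map_smul, hb₀, ← Submodule.Quotient.mk_smul,
    smul_eq_mul, ← pow_succ']
  split_ifs with h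
  · rw [hb, hB, hb₀]
  · rw [map_zero, (Submodule.Quotient.mk_eq_zero _).2, map_zero, map_zero]
    rw [Submodule.mem_span_singleton]
    refine ⟨X ^ ((a : ℕ) + 1 - e i), ?_⟩
    rw [smul_eq_mul, ← pow_add]
    congr 1
    omega

/-- The Jordan form of a nilpotent matrix over a field that need not be algebraically closed. -/
theorem exists_jordan_form {K : Type*} [Field K] {m : ℕ} {N : Matrix (Fin m) (Fin m) K}
    (hN : IsNilpotent N) : ∃ (Q : GL (Fin m) K) (J : Matrix (Fin m) (Fin m) K),
      N * (Q : Matrix (Fin m) (Fin m) K) = (Q : Matrix (Fin m) (Fin m) K) * J ∧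
      (∀ i j : Fin m, (i : ℕ) + 1 ≠ j → J i j = 0) ∧ ∀ i j, J i j = 0 ∨ J i j = 1 := by
  classical
  have hf : IsNilpotent (Matrix.toLin' N) := by
    obtain ⟨n, hn⟩ := hN
    exact ⟨n, by rw [← Matrix.toLin'_pow, hn, map_zero]⟩
  obtain ⟨d, e, b, hb⟩ := exists_chain_basis hf
  have hcard : ∑ i, e i = m := by
    have h1 := Module.finrank_eq_card_basis b
    simpa using h1.symm
  -- The order is reversed, so that the chains run upwards as the superdiagonal form requires.
  let E : (Σ i, Fin (e i)) ≃ Fin m := (finSigmaFinEquiv.trans (finCongr hcard)).trans Fin.revPerm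
  have hE : ∀ i (a : Fin (e i)) (h : (a : ℕ) + 1 < e i),
      (E ⟨i, ⟨a + 1, h⟩⟩ : ℕ) + 1 = E ⟨i, a⟩ := by
    intro i a h
    have h1 : ((finSigmaFinEquiv (⟨i, ⟨a + 1, h⟩⟩ : Σ i, Fin (e i)) : Fin _) : ℕ) =
        (finSigmaFinEquiv (⟨i, a⟩ : Σ i, Fin (e i)) : Fin _) + 1 := by
      simp only [finSigmaFinEquiv_apply]
      ring
    have h2 := (finSigmaFinEquiv (⟨i, ⟨a + 1, h⟩⟩ : Σ i, Fin (e i))).isLt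
    simp only [E, Equiv.trans_apply, Fin.revPerm_apply, Fin.val_rev, finCongr_apply, Fin.val_cast]
    omega
  let c := b.reindex E
  have hc : ∀ j : Fin m, Matrix.toLin' N (c j) = 0 ∨ ∃ l : Fin m, (l : ℕ) + 1 = j ∧
      Matrix.toLin' N (c j) = c l := by
    intro j
    obtain ⟨⟨i, a⟩, rfl⟩ := E.surjective j
    have h1 : c (E ⟨i, a⟩) = b ⟨i, a⟩ := by simp [c]
    rw [h1, hb]
    split_ifs with h
    · exact Or.inr ⟨_, hE i a h, by simp [c]⟩
    · exact Or.inl rfl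
  have hQ : IsUnit ((Pi.basisFun K (Fin m)).toMatrix c) := by
    have := (Pi.basisFun K (Fin m)).invertibleToMatrix c
    exact isUnit_of_invertible _
  refine ⟨hQ.unit, LinearMap.toMatrix c c (Matrix.toLin' N), ?_, ?_, ?_⟩
  · rw [IsUnit.unit_spec, basis_toMatrix_mul_linearMap_toMatrix]
    conv_lhs => rw [← LinearMap.toMatrix'_toLin' N, ← LinearMap.toMatrix_eq_toMatrix']
    rw [linearMap_toMatrix_mul_basis_toMatrix]
  · intro i j hij
    rw [LinearMap.toMatrix_apply]
    rcases hc j with h | ⟨l, hl, h⟩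
    · simp [h]
    · rw [h, Module.Basis.repr_self, Finsupp.single_eq_of_ne]
      rintro rfl
      exact hij hl
  · intro i j
    rw [LinearMap.toMatrix_apply]
    rcases hc j with h | ⟨l, hl, h⟩
    · simp [h]
    · rw [h, Module.Basis.repr_self, Finsupp.single_apply]
      split_ifs <;> simp

/-! ### Lattices over power series and Laurent polynomials -/

section Laurent

variable (k K : Type*) [Field k] [Field K] [Algebra (PowerSeries k) K]

/-- The Laurent polynomials inside a field containing the power series. -/
def laurentPolynomials : Subring K where
  carrier := {x | ∃ (n : ℕ) (P : Polynomial k), x * algebraMap (PowerSeries k) K PowerSeries.X ^ n =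
    algebraMap (PowerSeries k) K P}
  mul_mem' := by
    rintro x y ⟨n, P, hx⟩ ⟨m, Q, hy⟩
    refine ⟨n + m, P * Q, ?_⟩
    rw [Polynomial.coe_mul, map_mul, ← hx, ← hy]
    ring
  one_mem' := ⟨0, 1, by simp⟩
  add_mem' := by
    rintro x y ⟨n, P, hx⟩ ⟨m, Q, hy⟩
    refine ⟨n + m, P * Polynomial.X ^ m + Q * Polynomial.X ^ n, ?_⟩
    rw [Polynomial.coe_add, Polynomial.coe_mul, Polynomial.coe_mul, map_add, map_mul, map_mul,
      ← hx, ← hy, Polynomial.coe_pow, Polynomial.coe_pow, Polynomial.coe_X, map_pow, map_pow]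
    ring
  zero_mem' := ⟨0, 0, by simp⟩
  neg_mem' := by
    rintro x ⟨n, P, hx⟩
    exact ⟨n, -P, by rw [neg_mul, hx, Polynomial.coe_neg, map_neg]⟩

variable [IsFractionRing (PowerSeries k) K]

theorem algebraMap_X_ne_zero : algebraMap (PowerSeries k) K PowerSeries.X ≠ 0 := by
  simp

theorem zpow_mem_laurentPolynomials (a : ℤ) :
    algebraMap (PowerSeries k) K PowerSeries.X ^ a ∈ laurentPolynomials k K := by
  refine ⟨(-a).toNat, Polynomial.X ^ a.toNat, ?_⟩
  rw [Polynomial.coe_pow, Polynomial.coe_X, map_pow, ← zpow_natCast, ← zpow_natCast,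
    ← zpow_add₀ (algebraMap_X_ne_zero k K)]
  congr 1
  omega

variable {k K}

theorem exists_polynomial_of_mem_laurentPolynomials {x : PowerSeries k}
    (hx : algebraMap (PowerSeries k) K x ∈ laurentPolynomials k K) :
    ∃ P : Polynomial k, x = P := by
  obtain ⟨n, P, h⟩ := hx
  rw [← map_pow, ← map_mul] at h
  have h' := IsFractionRing.injective (PowerSeries k) K h
  refine ⟨PowerSeries.trunc (P.natDegree + 1) x, ?_⟩
  ext i
  rw [Polynomial.coeff_coe, PowerSeries.coeff_trunc]
  split_ifs with hi
  · rfl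
  · have h1 := congrArg (PowerSeries.coeff (i + n)) h'
    rw [PowerSeries.coeff_mul_X_pow, Polynomial.coeff_coe] at h1
    rw [h1]
    exact Polynomial.coeff_eq_zero_of_natDegree_lt (by omega)

variable (k)

/-- Every element of the fraction field of `k[[t]]` is a power series divided by a power
of `t`. -/
theorem exists_mul_X_pow (x : K) : ∃ (n : ℕ) (d : PowerSeries k),
    x * algebraMap (PowerSeries k) K PowerSeries.X ^ n = algebraMap (PowerSeries k) K d := by
  obtain ⟨a, b, hb, rfl⟩ := IsFractionRing.div_surjective (A := PowerSeries k) x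
  have hb0 : b ≠ 0 := nonZeroDivisors.ne_zero hb
  obtain ⟨n, w, i, hw, hi⟩ := exists_eq_X_pow_mul_primitive (ι := Unit) (v := fun _ => b)
    (fun h => hb0 (congrFun h ()))
  have hi' := hi.map (algebraMap (PowerSeries k) K)
  obtain ⟨u, hu⟩ := hi
  refine ⟨n, a * ((u⁻¹ : (PowerSeries k)ˣ) : PowerSeries k), ?_⟩
  have h1 : algebraMap (PowerSeries k) K b ≠ 0 := by simpa using hb0
  rw [div_mul_eq_mul_div, div_eq_iff h1, hw (), ← map_pow, ← map_mul, ← map_mul]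
  congr 1
  have h2 : ((u⁻¹ : (PowerSeries k)ˣ) : PowerSeries k) * w () = 1 := by
    rw [show w () = w i from rfl, ← hu, Units.inv_mul]
  calc a * PowerSeries.X ^ n =
        a * PowerSeries.X ^ n * (((u⁻¹ : (PowerSeries k)ˣ) : PowerSeries k) * w ()) := by
        rw [h2, mul_one]
    _ = _ := by ring

theorem exists_add_laurentPolynomials (x : K) : ∃ d : PowerSeries k,
    x - algebraMap (PowerSeries k) K d ∈ laurentPolynomials k K := by
  obtain ⟨n, d, h⟩ := exists_mul_X_pow k x
  refine ⟨PowerSeries.mk fun i => PowerSeries.coeff (i + n) d, n, PowerSeries.trunc n d, ?_⟩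
  rw [sub_mul, h, ← map_pow, ← map_mul, ← map_sub]
  congr 1
  rw [sub_eq_iff_eq_add, add_comm, mul_comm]
  exact PowerSeries.eq_X_pow_mul_shift_add_trunc n d

theorem exists_eq_X_zpow_mul_primitive {ι : Type*} [Fintype ι] {v : ι → K} (hv : v ≠ 0) :
    ∃ (a : ℤ) (w : ι → PowerSeries k) (i : ι),
      (∀ l, v l = algebraMap (PowerSeries k) K PowerSeries.X ^ a *
        algebraMap (PowerSeries k) K (w l)) ∧ IsUnit (w i) := by
  classical
  choose n d hd using fun l => exists_mul_X_pow k (v l)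
  have hX := algebraMap_X_ne_zero k K
  let s := ∑ l, n l
  have hs : ∀ l, v l * algebraMap (PowerSeries k) K PowerSeries.X ^ s =
      algebraMap (PowerSeries k) K (d l * PowerSeries.X ^ (s - n l)) := by
    intro l
    have hle : n l ≤ s := Finset.single_le_sum (fun _ _ => Nat.zero_le _) (Finset.mem_univ l)
    rw [map_mul, ← hd, map_pow, mul_assoc, ← pow_add, Nat.add_sub_cancel' hle]
  have hne : (fun l => d l * PowerSeries.X ^ (s - n l)) ≠ 0 := by
    intro h
    apply hv
    funext l
    have h1 := hs l
    rw [congrFun h l] at h1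
    simpa [hX] using h1
  obtain ⟨a, w, i, hw, hi⟩ := exists_eq_X_pow_mul_primitive hne
  refine ⟨a - s, w, i, fun l => ?_, hi⟩
  have h1 := hs l
  rw [show d l * PowerSeries.X ^ (s - n l) = _ from hw l, map_mul, map_pow] at h1
  rw [zpow_sub₀ hX, zpow_natCast, zpow_natCast, div_mul_eq_mul_div, ← h1,
    mul_div_cancel_right₀ _ (pow_ne_zero _ hX)]

variable {k}

open Matrix in
/-- Hermite normal form: an invertible matrix over the fraction field of `k[[t]]` becomes upper
triangular after multiplication by an invertible matrix over `k[[t]]`, and its entries can be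
truncated to Laurent polynomials. -/
theorem exists_hermite_form {m : ℕ} (Q : Matrix (Fin m) (Fin m) K) (hQ : Q.det ≠ 0) :
    ∃ (U : GL (Fin m) (PowerSeries k)) (P : Matrix (Fin m) (Fin m) K),
      (U : Matrix (Fin m) (Fin m) (PowerSeries k)).map (algebraMap _ K) * Q = P ∧
      (∀ i j, j < i → P i j = 0) ∧ (∀ i j, P i j ∈ laurentPolynomials k K) ∧
      ∀ i, ∃ a : ℤ, P i i = algebraMap (PowerSeries k) K PowerSeries.X ^ a := by
  induction m with
  | zero =>
    exact ⟨1, Q, by ext i; exact i.elim0, fun i => i.elim0, fun i => i.elim0, fun i => i.elim0⟩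
  | succ m ih =>
    have hX := algebraMap_X_ne_zero k K
    have hcol : (fun l => Q l 0) ≠ 0 := fun h =>
      hQ (Matrix.det_eq_zero_of_column_eq_zero 0 fun l => congrFun h l)
    obtain ⟨a, w, i, hw, hi⟩ := exists_eq_X_zpow_mul_primitive k hcol
    obtain ⟨A, hA⟩ := exists_GL_col_eq w hi
    set x := algebraMap (PowerSeries k) K PowerSeries.X ^ a with hx
    have hx0 : x ≠ 0 := zpow_ne_zero _ hX
    set N := ((A⁻¹ : GL _ _) : Matrix (Fin (m + 1)) (Fin (m + 1)) (PowerSeries k)).map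
      (algebraMap _ K) * Q with hN
    have hNcol : ∀ i, N i 0 = if i = 0 then x else 0 := by
      intro i
      have h1 : ((A⁻¹ : GL _ _) : Matrix (Fin (m + 1)) (Fin (m + 1)) (PowerSeries k)) *
          (A : Matrix (Fin (m + 1)) (Fin (m + 1)) (PowerSeries k)) = 1 := by
        rw [← Units.val_mul, inv_mul_cancel, Units.val_one]
      have h2 := congrFun (congrFun h1 i) 0
      rw [Matrix.mul_apply] at h2
      rw [hN, Matrix.mul_apply]
      calc _ = x * algebraMap _ K (∑ l, ((A⁻¹ : GL _ _) : Matrix (Fin (m + 1)) (Fin (m + 1))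
            (PowerSeries k)) i l *
              (A : Matrix (Fin (m + 1)) (Fin (m + 1)) (PowerSeries k)) l 0) := by
            rw [map_sum, Finset.mul_sum]
            refine Finset.sum_congr rfl fun l _ => ?_
            rw [show Q l 0 = _ from hw l, hA, Matrix.map_apply, map_mul]
            ring
        _ = _ := by
            rw [h2, Matrix.one_apply]
            split_ifs <;> simp
    have hNb := eq_border (M := N) fun i => by rw [hNcol]; simp
    rw [show N 0 0 = x by rw [hNcol]; simp] at hNb
    set r : Fin m → K := fun j => N 0 j.succ
    set Q' := N.submatrix Fin.succ Fin.succ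
    have hQ' : Q'.det ≠ 0 := by
      have h1 : IsUnit (((A⁻¹ : GL _ _) : Matrix (Fin (m + 1)) (Fin (m + 1)) (PowerSeries k)).map
          (algebraMap _ K)) :=
        (A⁻¹).isUnit.map (algebraMap (PowerSeries k) K).mapMatrix
      have h2 : N.det ≠ 0 := by
        rw [hN, Matrix.det_mul]
        exact mul_ne_zero ((Matrix.isUnit_iff_isUnit_det _).1 h1).ne_zero hQ
      rw [hNb, det_border] at h2
      exact right_ne_zero_of_mul h2
    obtain ⟨U', P', hU', hlow, hmem, hdiag⟩ := ih Q' hQ'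
    have hP' : IsUnit P'.det := by
      rw [← hU', Matrix.det_mul]
      have h1 : IsUnit ((U' : Matrix (Fin m) (Fin m) (PowerSeries k)).map (algebraMap _ K)) :=
        U'.isUnit.map (algebraMap (PowerSeries k) K).mapMatrix
      exact ((Matrix.isUnit_iff_isUnit_det _).1 h1).mul hQ'.isUnit
    -- The rest of the first row, in coordinates relative to the rows of `P'`, is truncated.
    choose c hc using fun j => exists_add_laurentPolynomials k ((r ᵥ* P'⁻¹) j)
    have hr : r = (r ᵥ* P'⁻¹) ᵥ* P' := by
      rw [Matrix.vecMul_vecMul, Matrix.nonsing_inv_mul _ hP', Matrix.vecMul_one]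
    have hU := isUnit_border (1 : PowerSeries k)
      (-c ᵥ* (U' : Matrix (Fin m) (Fin m) (PowerSeries k))) _ isUnit_one U'.isUnit
    have hmapb : (border (1 : PowerSeries k) (-c ᵥ* (U' : Matrix (Fin m) (Fin m) (PowerSeries k)))
        (U' : Matrix (Fin m) (Fin m) (PowerSeries k))).map (algebraMap _ K) =
        border 1 ((fun j => -algebraMap _ K (c j)) ᵥ*
          (U' : Matrix (Fin m) (Fin m) (PowerSeries k)).map (algebraMap _ K))
          ((U' : Matrix (Fin m) (Fin m) (PowerSeries k)).map (algebraMap _ K)) := by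
      ext i j
      refine Fin.cases ?_ (fun i => ?_) i <;> refine Fin.cases ?_ (fun j => ?_) j <;>
        simp [Matrix.vecMul, dotProduct, map_sum]
    refine ⟨hU.unit * A⁻¹, border x ((fun j => (r ᵥ* P'⁻¹) j - algebraMap _ K (c j)) ᵥ* P') P',
      ?_, ?_, ?_, ?_⟩
    · rw [Units.val_mul, IsUnit.unit_spec, Matrix.map_mul, Matrix.mul_assoc, ← hN, hNb, hmapb,
        border_mul, hU', one_mul, one_smul, Matrix.vecMul_vecMul, hU']
      congr 1
      conv_lhs => rw [hr]
      rw [← Matrix.add_vecMul]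
      congr 1
      funext j
      exact (sub_eq_add_neg _ _).symm
    · intro i j
      refine Fin.cases ?_ (fun i => ?_) i <;> refine Fin.cases ?_ (fun j => ?_) j
      · simp
      · simp
      · simp
      · simpa using hlow i j
    · intro i j
      refine Fin.cases ?_ (fun i => ?_) i <;> refine Fin.cases ?_ (fun j => ?_) j
      · exact zpow_mem_laurentPolynomials k K a
      · rw [border_zero_succ, Matrix.vecMul, dotProduct]
        exact sum_mem fun l _ => mul_mem (hc l) (hmem l j)
      · exact zero_mem _
      · exact hmem i j
    · intro i
      refine Fin.cases ?_ (fun i => ?_) i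
      · exact ⟨a, rfl⟩
      · exact hdiag i

/-- A nilpotent matrix over `k[[t]]` is conjugate to a strictly upper triangular matrix of
polynomials, with zeros and powers of `t` above the diagonal. Indeed the nilpotent matrix has a
Jordan form over the field of fractions, and the invariant lattice on which it acts has a basis
consisting of Laurent polynomial combinations of the Jordan basis. -/
theorem exists_conj_polynomial {k : Type*} [Field k] {m : ℕ}
    {N : Matrix (Fin m) (Fin m) (PowerSeries k)} (hN : IsNilpotent N) :
    ∃ (U : GL (Fin m) (PowerSeries k)) (N' : Matrix (Fin m) (Fin m) (PowerSeries k)),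
      (U : Matrix (Fin m) (Fin m) (PowerSeries k)) * N =
        N' * (U : Matrix (Fin m) (Fin m) (PowerSeries k)) ∧
      (∀ i j, j ≤ i → N' i j = 0) ∧ (∀ i j, ∃ P : Polynomial k, N' i j = P) ∧
      ∀ i j : Fin m, (i : ℕ) + 1 = j → N' i j = 0 ∨ ∃ n : ℕ, N' i j = PowerSeries.X ^ n := by
  classical
  let K := FractionRing (PowerSeries k)
  let φ := algebraMap (PowerSeries k) K
  have hφ : Function.Injective φ := IsFractionRing.injective _ _
  have hX : φ PowerSeries.X ≠ 0 := algebraMap_X_ne_zero k K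
  obtain ⟨Q, J, hQJ, hJ0, hJ1⟩ := exists_jordan_form (K := K) (N := N.map φ)
    (hN.map φ.mapMatrix)
  obtain ⟨U, P, hUP, hlow, hmem, hdiag⟩ := exists_hermite_form (k := k)
    (Q : Matrix (Fin m) (Fin m) K) ((Matrix.isUnit_iff_isUnit_det _).1 Q.isUnit).ne_zero
  let N' := (U : Matrix (Fin m) (Fin m) (PowerSeries k)) * N *
    ((U⁻¹ : GL _ _) : Matrix (Fin m) (Fin m) (PowerSeries k))
  have hUN : (U : Matrix (Fin m) (Fin m) (PowerSeries k)) * N =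
      N' * (U : Matrix (Fin m) (Fin m) (PowerSeries k)) := by
    simp only [N']
    rw [Matrix.mul_assoc, ← Units.val_mul, inv_mul_cancel, Units.val_one, Matrix.mul_one]
  have hNP : N'.map φ * P = P * J := by
    rw [← hUP, ← Matrix.mul_assoc, ← Matrix.map_mul, ← hUN, Matrix.map_mul, Matrix.mul_assoc, hQJ,
      Matrix.mul_assoc]
  choose a ha using hdiag
  have hup : P.BlockTriangular id := fun i j hij => hlow i j hij
  have hdet : P.det = φ PowerSeries.X ^ ∑ i, a i := by
    rw [Matrix.det_of_isUpperTriangular hup, Finset.prod_congr rfl fun i _ => ha i]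
    induction (Finset.univ : Finset (Fin m)) using Finset.induction_on with
    | empty => simp
    | insert i s hi ih => rw [Finset.prod_insert hi, Finset.sum_insert hi, ih, zpow_add₀ hX]
  have hdet0 : IsUnit P.det := by
    rw [hdet]
    exact (zpow_ne_zero _ hX).isUnit
  have hinvP : Invertible P := P.invertibleOfIsUnitDet hdet0
  have hN' : N'.map φ = P * J * P⁻¹ := by
    rw [← hNP, Matrix.mul_assoc, Matrix.mul_nonsing_inv _ hdet0, Matrix.mul_one]
  have hJup : J.BlockTriangular id := fun i j hij => hJ0 i j fun h => by
    have hij : (j : ℕ) < i := hij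
    omega
  have hN'up : (N'.map φ).BlockTriangular id := by
    rw [hN']
    exact (hup.mul hJup).mul (Matrix.blockTriangular_inv_of_blockTriangular hup)
  have hP0 : ∀ i, P i i ≠ 0 := fun i => by
    rw [ha]
    exact zpow_ne_zero _ hX
  have hdiagN : ∀ i, N' i i = 0 := by
    intro i
    have h1 := congrFun (congrFun hNP i) i
    rw [Matrix.mul_apply, Matrix.mul_apply, Finset.sum_eq_single i, Finset.sum_eq_single i] at h1
    · rw [hJ0 i i (by omega), mul_zero] at h1
      exact hφ (by simpa using (mul_eq_zero.1 h1).resolve_right (hP0 i))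
    · intro l _ hl
      rcases lt_or_gt_of_ne hl with h | h
      · rw [hlow i l h, zero_mul]
      · rw [hJup h, mul_zero]
    · simp
    · intro l _ hl
      rcases lt_or_gt_of_ne hl with h | h
      · rw [hN'up h, zero_mul]
      · rw [hlow l i h, mul_zero]
    · simp
  refine ⟨U, N', hUN, ?_, ?_, ?_⟩
  · intro i j hij
    rcases hij.eq_or_lt with rfl | hij
    · exact hdiagN _
    · exact hφ (by simpa using hN'up hij)
  · intro i j
    apply exists_polynomial_of_mem_laurentPolynomials (K := K)
    change (N'.map φ) i j ∈ _
    have hJmem : ∀ i j, J i j ∈ laurentPolynomials k K := fun i j => by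
      rcases hJ1 i j with h | h
      · rw [h]; exact zero_mem _
      · rw [h]; exact one_mem _
    let P₀ : Matrix (Fin m) (Fin m) (laurentPolynomials k K) := fun i j => ⟨P i j, hmem i j⟩
    have hadj : ∀ i j, P.adjugate i j ∈ laurentPolynomials k K := by
      intro i j
      have : P = (laurentPolynomials k K).subtype.mapMatrix P₀ := rfl
      rw [this, ← RingHom.map_adjugate]
      exact (P₀.adjugate i j).2
    have hinv : ∀ i j, P⁻¹ i j ∈ laurentPolynomials k K := by
      intro i j
      rw [Matrix.inv_def, Matrix.smul_apply, smul_eq_mul, hdet, Ring.inverse_eq_inv', ← zpow_neg]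
      exact mul_mem (zpow_mem_laurentPolynomials k K _) (hadj i j)
    rw [hN', Matrix.mul_apply]
    refine sum_mem fun l _ => mul_mem ?_ (hinv l j)
    rw [Matrix.mul_apply]
    exact sum_mem fun l' _ => mul_mem (hmem _ _) (hJmem _ _)
  · intro i j hij
    have hij' : i < j := by
      change (i : ℕ) < j
      omega
    have h1 := congrFun (congrFun hNP i) j
    rw [Matrix.mul_apply, Matrix.mul_apply, Finset.sum_eq_single j, Finset.sum_eq_single i] at h1
    · rcases hJ1 i j with h0 | h0
      · left
        rw [h0, mul_zero] at h1
        exact hφ (by simpa using (mul_eq_zero.1 h1).resolve_right (hP0 j))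
      · right
        rw [h0, mul_one, ha, ha, Matrix.map_apply, ← eq_div_iff (zpow_ne_zero _ hX),
          ← zpow_sub₀ hX] at h1
        have hX1 : ¬ IsUnit (PowerSeries.X : PowerSeries k) := by
          rw [PowerSeries.isUnit_iff_constantCoeff]
          simp
        have hnn : 0 ≤ a i - a j := by
          by_contra hneg
          push Not at hneg
          obtain ⟨n, hn⟩ : ∃ n : ℕ, a i - a j = -((n : ℤ) + 1) :=
            ⟨(-(a i - a j) - 1).toNat, by omega⟩
          rw [hn, zpow_neg, ← Nat.cast_succ, zpow_natCast, ← one_div,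
            eq_div_iff (pow_ne_zero _ hX), ← map_pow, ← map_mul, ← map_one φ] at h1
          have h2 := hφ h1
          rw [pow_succ, ← mul_assoc] at h2
          exact hX1 (IsUnit.of_mul_eq_one_right _ h2)
        obtain ⟨n, hn⟩ := Int.eq_ofNat_of_zero_le hnn
        refine ⟨n, hφ ?_⟩
        rw [h1, hn, map_pow]
        simp
    · intro l _ hl
      rw [hJ0 l j, mul_zero]
      intro h
      exact hl (Fin.ext (by omega))
    · simp
    · intro l _ hl
      rcases lt_or_gt_of_ne hl with h | h
      · have h2 : l ≤ i := by
          have h : (l : ℕ) < j := h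
          change (l : ℕ) ≤ i
          omega
        rcases h2.eq_or_lt with rfl | h2
        · simp [hdiagN]
        · rw [hN'up h2, zero_mul]
      · rw [hlow l j h, mul_zero]
    · simp

end Laurent

open MvPowerSeries

/-! ### The normal form over the formal power series -/

theorem isNilpotent_of_strictly_upper {R : Type*} [CommRing R] {d : ℕ}
    {N : Matrix (Fin d) (Fin d) R} (h : ∀ i j, j ≤ i → N i j = 0) : IsNilpotent N := by
  have key : ∀ w (i j : Fin d), (j : ℕ) < i + w → (N ^ w) i j = 0 := by
    intro w
    induction w with
    | zero =>
      intro i j hij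
      rw [pow_zero, Matrix.one_apply_ne]
      rintro rfl
      omega
    | succ w ih =>
      intro i j hij
      rw [pow_succ, Matrix.mul_apply]
      refine Finset.sum_eq_zero fun l _ => ?_
      by_cases hl : (l : ℕ) < i + w
      · rw [ih i l hl, zero_mul]
      · rw [h l j (by change (j : ℕ) ≤ l; omega), mul_zero]
  exact ⟨d, by ext i j; exact key d i j (by omega)⟩

/-- `exists_conj_polynomial` for a block diagonal matrix, the blocks being the fibres
of `c`. -/
theorem exists_block_conj_polynomial {k : Type*} [Field k] {d r : ℕ} (c : Fin d → Fin r)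
    {N : Matrix (Fin d) (Fin d) (PowerSeries k)} (hN : ∀ i j, ¬ (i < j ∧ c i = c j) → N i j = 0) :
    ∃ (U : GL (Fin d) (PowerSeries k)) (N' : Matrix (Fin d) (Fin d) (PowerSeries k)),
      (U : Matrix (Fin d) (Fin d) (PowerSeries k)) * N =
        N' * (U : Matrix (Fin d) (Fin d) (PowerSeries k)) ∧
      (∀ i j, c i ≠ c j → (U : Matrix (Fin d) (Fin d) (PowerSeries k)) i j = 0) ∧
      (∀ i j, c i ≠ c j →
        ((U⁻¹ : GL _ _) : Matrix (Fin d) (Fin d) (PowerSeries k)) i j = 0) ∧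
      (∀ i j, ¬ (i < j ∧ c i = c j) → N' i j = 0) ∧ (∀ i j, ∃ P : Polynomial k, N' i j = P) ∧
      ∀ i j : Fin d, (i : ℕ) + 1 = j → N' i j = 0 ∨ ∃ n : ℕ, N' i j = PowerSeries.X ^ n := by
  classical
  let e : ∀ α : Fin r, Fin (Fintype.card {i // c i = α}) ≃o {i // c i = α} := fun α =>
    monoEquivOfFin _ rfl
  let E : (Σ α : Fin r, Fin (Fintype.card {i // c i = α})) ≃ Fin d :=
    (Equiv.sigmaCongrRight fun α => (e α).toEquiv).trans (Equiv.sigmaFiberEquiv c)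
  have hE : ∀ α a, E ⟨α, a⟩ = (e α a : Fin d) := fun α a => rfl
  have hcE : ∀ α a, c (E ⟨α, a⟩) = α := fun α a => (e α a).2
  have hlt : ∀ α a b, E ⟨α, a⟩ < E ⟨α, b⟩ ↔ a < b := by
    intro α a b
    rw [hE, hE, Subtype.coe_lt_coe, OrderIso.lt_iff_lt]
  let Nb : ∀ α, Matrix (Fin (Fintype.card {i // c i = α})) (Fin (Fintype.card {i // c i = α}))
    (PowerSeries k) := fun α a b => N (E ⟨α, a⟩) (E ⟨α, b⟩)
  have hNb : ∀ α, IsNilpotent (Nb α) := fun α => isNilpotent_of_strictly_upper fun a b hab =>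
    hN _ _ fun h => absurd ((hlt α a b).1 h.1) (not_lt.2 hab)
  choose Ub Nb' hU hlow hpoly hsup using fun α => exists_conj_polynomial (hNb α)
  let F := fun A : ∀ α, Matrix (Fin (Fintype.card {i // c i = α}))
    (Fin (Fintype.card {i // c i = α})) (PowerSeries k) =>
      (Matrix.blockDiagonal' A).submatrix E.symm E.symm
  have hFmul : ∀ A B, F A * F B = F (fun α => A α * B α) := by
    intro A B
    simp only [F, Matrix.blockDiagonal'_mul, Matrix.submatrix_mul_equiv]
  have hFone : F (fun _ => 1) = 1 := by
    simp only [F]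
    rw [show (fun α => (1 : Matrix (Fin (Fintype.card {i // c i = α}))
      (Fin (Fintype.card {i // c i = α})) (PowerSeries k))) = 1 from rfl, Matrix.blockDiagonal'_one,
      Matrix.submatrix_one_equiv]
  have hFne : ∀ A i j, c i ≠ c j → F A i j = 0 := by
    intro A i j hij
    obtain ⟨⟨α, a⟩, rfl⟩ := E.surjective i
    obtain ⟨⟨β, b⟩, rfl⟩ := E.surjective j
    rw [hcE, hcE] at hij
    simp only [F, Matrix.submatrix_apply, Equiv.symm_apply_apply]
    exact Matrix.blockDiagonal'_apply_ne _ _ _ hij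
  have hFeq : ∀ A α a b, F A (E ⟨α, a⟩) (E ⟨α, b⟩) = A α a b := by
    intro A α a b
    simp only [F, Matrix.submatrix_apply, Equiv.symm_apply_apply]
    exact Matrix.blockDiagonal'_apply_eq _ _ _ _
  have hcase : ∀ i j, c i = c j → ∃ α a b, i = E ⟨α, a⟩ ∧ j = E ⟨α, b⟩ := by
    intro i j hij
    obtain ⟨⟨α, a⟩, rfl⟩ := E.surjective i
    obtain ⟨⟨β, b⟩, rfl⟩ := E.surjective j
    rw [hcE, hcE] at hij
    subst hij
    exact ⟨_, _, _, rfl, rfl⟩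
  have hNF : N = F Nb := by
    ext1 i j
    by_cases hij : c i = c j
    · obtain ⟨α, a, b, rfl, rfl⟩ := hcase i j hij
      rw [hFeq]
    · rw [hFne _ _ _ hij, hN]
      exact fun h => hij h.2
  refine ⟨⟨F fun α => Ub α, F fun α => ((Ub α)⁻¹ : GL _ _), ?_, ?_⟩, F Nb', ?_, ?_, ?_, ?_, ?_, ?_⟩
  · rw [hFmul, ← hFone]
    simp
  · rw [hFmul, ← hFone]
    simp
  · change F _ * N = F Nb' * F _
    rw [hNF, hFmul, hFmul]
    congr 1
    funext α
    exact hU α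
  · exact fun i j hij => hFne _ i j hij
  · exact fun i j hij => hFne _ i j hij
  · intro i j h
    by_cases hij : c i = c j
    · obtain ⟨α, a, b, rfl, rfl⟩ := hcase i j hij
      rw [hFeq]
      refine hlow α a b (not_lt.1 fun hab => h ⟨(hlt α a b).2 hab, hij⟩)
    · exact hFne _ i j hij
  · intro i j
    by_cases hij : c i = c j
    · obtain ⟨α, a, b, rfl, rfl⟩ := hcase i j hij
      rw [hFeq]
      exact hpoly α a b
    · exact ⟨0, by rw [hFne _ i j hij, Polynomial.coe_zero]⟩
  · intro i j h1
    by_cases hij : c i = c j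
    · obtain ⟨α, a, b, rfl, rfl⟩ := hcase i j hij
      rw [hFeq]
      refine hsup α a b ?_
      have hab : a < b := (hlt α a b).1 (by rw [Fin.lt_def]; omega)
      have hab' : (a : ℕ) < b := hab
      by_contra hne
      have h2 := (hlt α a ⟨a + 1, by omega⟩).2 (by rw [Fin.lt_def]; simp)
      have h3 := (hlt α ⟨a + 1, by omega⟩ b).2 (by rw [Fin.lt_def]; simp; omega)
      rw [Fin.lt_def] at h2 h3
      omega
    · exact Or.inl (hFne _ i j hij)

theorem eq_zero_or_eq_unit_mul_X_pow {k : Type*} [Field k] (ρ : PowerSeries k) :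
    ρ = 0 ∨ ∃ (u : (PowerSeries k)ˣ) (n : ℕ), ρ = (u : PowerSeries k) * PowerSeries.X ^ n := by
  by_cases h : ρ = 0
  · exact Or.inl h
  · obtain ⟨n, w, i, hw, hi⟩ := exists_eq_X_pow_mul_primitive (ι := Unit) (v := fun _ => ρ)
      (fun h' => h (congrFun h' ()))
    obtain ⟨u, hu⟩ := hi
    exact Or.inr ⟨u, n, by rw [hu, mul_comm]; exact hw ()⟩

/-- On a branch every function is zero or a unit times a power of `x₂`. -/
theorem HasLeading.exists_unit_mul {k : Type*} [Field k] {g : MvPowerSeries (Fin 2) k}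
    (hg : HasLeading expOne g) (h : MvPowerSeries (Fin 2) k) :
    ∃ (u : (MvPowerSeries (Fin 2) k)ˣ) (y : MvPowerSeries (Fin 2) k),
      (y = 0 ∨ ∃ n : ℕ, y = X 1 ^ n) ∧ g ∣ h - u * y := by
  obtain ⟨q, ρ, rfl⟩ := hg.exists_div_inclTwo h
  rcases eq_zero_or_eq_unit_mul_X_pow ρ with rfl | ⟨u, n, rfl⟩
  · exact ⟨1, 0, Or.inl rfl, ⟨q, by simp [mul_comm]⟩⟩
  · refine ⟨Units.map (inclTwo k : PowerSeries k →* MvPowerSeries (Fin 2) k) u, X 1 ^ n,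
      Or.inr ⟨n, rfl⟩, q, ?_⟩
    simp [inclTwo_X, mul_comm]

theorem HasLeading.exists_polynomial {k : Type*} [Field k] {g : MvPowerSeries (Fin 2) k}
    (hg : HasLeading expOne g) {I : Ideal (MvPowerSeries (Fin 2) k)} {s : ℕ} (hgI : g ∈ I)
    (hs : X 1 ^ s ∈ I) (x : MvPowerSeries (Fin 2) k) :
    ∃ h : Polynomial k, h.degree < s ∧ x - Polynomial.aeval (X 1) h ∈ I := by
  obtain ⟨q, ρ, rfl⟩ := hg.exists_div_inclTwo x
  refine ⟨PowerSeries.trunc s ρ, PowerSeries.degree_trunc_lt ρ s, ?_⟩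
  rw [← inclTwo_aeval, add_sub_assoc, ← map_sub]
  refine I.add_mem (I.mul_mem_left _ hgI) ?_
  have : ρ - (PowerSeries.trunc s ρ : PowerSeries k) =
      PowerSeries.X ^ s * PowerSeries.mk fun i => PowerSeries.coeff (i + s) ρ :=
    sub_eq_iff_eq_add.2 (PowerSeries.eq_X_pow_mul_shift_add_trunc s ρ)
  rw [this, map_mul, map_pow, inclTwo_X]
  exact I.mul_mem_right _ hs

/-- The normal form up to the entries relating different branches: within the block of a branch
the entries are as required. -/
theorem exists_block_normal_form {k : Type*} [Field k] {r d : ℕ}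
    (f : Fin r → MvPowerSeries (Fin 2) k) (hf : ∀ α, HasLeading expOne (f α)) (c : Fin d → Fin r)
    (hc : Monotone c) (M : Matrix (Fin d) (Fin d) (MvPowerSeries (Fin 2) k))
    (h0 : M.map constantCoeff = 0) (hdet : Associated M.det (∏ i, f (c i))) :
    ∃ T, LocallyEquivalent M T ∧ (∀ i j, j < i → T i j = 0) ∧ (∀ i, T i i = f (c i)) ∧
      (∀ i j, i < j → c i = c j → ∃ h : Polynomial k, T i j = Polynomial.aeval (X 1) h) ∧
      ∀ i j : Fin d, (i : ℕ) + 1 = j → c i = c j → T i j = 0 ∨ ∃ n : ℕ, T i j = X 1 ^ n := by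
  classical
  obtain ⟨T₀, hMT₀, hlow₀, hdiag₀⟩ := exists_triangular (fun i => f (c i)) (fun i => hf _) M h0 hdet
  obtain ⟨T₁, hT₀₁, hnQ, hQ⟩ := exists_elimination T₀ hlow₀ (fun i j => i < j) (fun _ _ h => h)
    (fun i j i' j' h hi hj => hi.trans_lt (h.trans_le hj))
    (fun i j y => ∃ ρ : PowerSeries k, y = inclTwo k ρ ∨ c i ≠ c j) (fun i j _ x _ => by
      obtain ⟨q, ρ, hx⟩ := (hf (c i)).exists_div_inclTwo x
      refine ⟨inclTwo k ρ, ⟨ρ, Or.inl rfl⟩, ?_⟩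
      rw [hx, add_sub_cancel_right, hdiag₀]
      exact Ideal.mul_mem_left _ _ (Ideal.subset_span (by simp)))
  choose! ρ hρ using hQ
  let N : Matrix (Fin d) (Fin d) (PowerSeries k) :=
    Matrix.of fun i j => if i < j ∧ c i = c j then ρ i j else 0
  let O : Matrix (Fin d) (Fin d) (MvPowerSeries (Fin 2) k) := Matrix.of fun i j =>
    if c i < c j then T₁ i j else 0
  let G : Matrix (Fin d) (Fin d) (MvPowerSeries (Fin 2) k) := Matrix.diagonal fun i => f (c i)
  have hG : ∀ i j, i ≠ j → G i j = 0 := fun i j h => Matrix.diagonal_apply_ne _ h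
  have hG' : ∀ i, G i i = f (c i) := fun i => Matrix.diagonal_apply_eq _ i
  have hT₁ : T₁ = G + N.map (inclTwo k) + O := by
    ext1 i j
    simp only [Matrix.add_apply, G, N, O, Matrix.map_apply, Matrix.of_apply]
    rcases lt_trichotomy i j with h | rfl | h
    · rcases (hc h.le).lt_or_eq with h' | h'
      · rw [Matrix.diagonal_apply_ne _ h.ne, if_neg fun h'' => h'.ne h''.2, if_pos h']
        simp
      · rw [Matrix.diagonal_apply_ne _ h.ne, if_pos ⟨h, h'⟩, if_neg h'.not_lt]
        simpa [h'] using hρ i j h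
    · rw [Matrix.diagonal_apply_eq, if_neg fun h => h.1.false, if_neg (lt_irrefl _),
        hnQ i i (lt_irrefl _), hdiag₀]
      simp
    · rw [Matrix.diagonal_apply_ne _ h.ne', if_neg fun h' => h.not_gt h'.1,
        if_neg (hc h.le).not_gt, hnQ i j h.not_gt, hlow₀ i j h]
      simp
  obtain ⟨U, N', hUN, hU, hUi, hN', hpoly, hsup⟩ := exists_block_conj_polynomial c (N := N)
    fun i j h => if_neg h
  let V : GL (Fin d) (MvPowerSeries (Fin 2) k) :=
    Units.map (inclTwo k : PowerSeries k →+* MvPowerSeries (Fin 2) k).mapMatrix.toMonoidHom U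
  have hV : ∀ i j, (V : Matrix (Fin d) (Fin d) (MvPowerSeries (Fin 2) k)) i j =
    inclTwo k ((U : Matrix (Fin d) (Fin d) (PowerSeries k)) i j) := fun i j => rfl
  have hVi : ∀ i j, ((V⁻¹ : GL _ _) : Matrix (Fin d) (Fin d) (MvPowerSeries (Fin 2) k)) i j =
    inclTwo k (((U⁻¹ : GL _ _) : Matrix (Fin d) (Fin d) (PowerSeries k)) i j) := fun i j => rfl
  set V₁ := (V : Matrix (Fin d) (Fin d) (MvPowerSeries (Fin 2) k)) with hV₁
  set V₂ := ((V⁻¹ : GL _ _) : Matrix (Fin d) (Fin d) (MvPowerSeries (Fin 2) k)) with hV₂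
  have hV₁₂ : V₁ * V₂ = 1 := by rw [hV₁, hV₂, ← Units.val_mul, mul_inv_cancel, Units.val_one]
  have hVG : V₁ * G * V₂ = G := by
    have : V₁ * G = G * V₁ := by
      ext1 i j
      rw [Matrix.mul_diagonal, Matrix.diagonal_mul]
      by_cases h : c i = c j
      · rw [h, mul_comm]
      · rw [hV, hU i j h]
        simp
    rw [this, Matrix.mul_assoc, hV₁₂, Matrix.mul_one]
  have hVN : V₁ * N.map (inclTwo k) * V₂ = N'.map (inclTwo k) := by
    have h1 : V₁ * N.map (inclTwo k) = N'.map (inclTwo k) * V₁ := by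
      have h2 := congrArg (inclTwo k : PowerSeries k →+* MvPowerSeries (Fin 2) k).mapMatrix hUN
      rw [map_mul, map_mul] at h2
      exact h2
    rw [h1, Matrix.mul_assoc, hV₁₂, Matrix.mul_one]
  have hO : ∀ i j, ¬ c i < c j → (V₁ * O * V₂) i j = 0 := by
    intro i j hij
    rw [Matrix.mul_apply]
    refine Finset.sum_eq_zero fun m _ => ?_
    by_cases hm : c m = c j
    · rw [Matrix.mul_apply, Finset.sum_mul]
      refine Finset.sum_eq_zero fun l _ => ?_
      by_cases hl : c i = c l
      · rw [show O l m = 0 from if_neg (by rw [hm, ← hl]; exact hij)]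
        simp
      · rw [hV, hU i l hl]
        simp
    · rw [hVi, hUi m j hm]
      simp
  have hT₂ : V₁ * T₁ * V₂ = G + N'.map (inclTwo k) + V₁ * O * V₂ := by
    rw [hT₁, Matrix.mul_add, Matrix.mul_add, Matrix.add_mul, Matrix.add_mul, hVG, hVN]
  have hin : ∀ i j, i < j → c i = c j → (V₁ * T₁ * V₂) i j = inclTwo k (N' i j) := by
    intro i j hij hcij
    rw [hT₂, Matrix.add_apply, Matrix.add_apply, hO i j (by rw [hcij]; exact lt_irrefl _),
      hG i j hij.ne]
    simp
  refine ⟨V₁ * T₁ * V₂, (hMT₀.trans hT₀₁).trans ⟨V, V⁻¹, rfl⟩, ?_, ?_, ?_, ?_⟩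
  · intro i j hij
    rw [hT₂, Matrix.add_apply, Matrix.add_apply, hO i j (hc hij.le).not_gt,
      hG i j hij.ne', Matrix.map_apply, hN' i j fun h => hij.not_gt h.1]
    simp
  · intro i
    rw [hT₂, Matrix.add_apply, Matrix.add_apply, hO i i (lt_irrefl _),
      hG', Matrix.map_apply, hN' i i fun h => h.1.false]
    simp
  · intro i j hij hcij
    obtain ⟨P, hP⟩ := hpoly i j
    exact ⟨P, by rw [hin i j hij hcij, hP, inclTwo_aeval]⟩
  · intro i j hij hcij
    rw [hin i j (by rw [Fin.lt_def]; omega) hcij]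
    rcases hsup i j hij with h | ⟨n, h⟩
    · exact Or.inl (by rw [h, map_zero])
    · exact Or.inr ⟨n, by rw [h, map_pow, inclTwo_X]⟩

/-- Conjugation by a diagonal matrix, constant on the blocks, makes the units vanish from the
entries next to the diagonal. -/
theorem exists_block_scaling {A : Type*} [CommGroup A] {r d : ℕ} (c : Fin d → Fin r)
    (hc : Monotone c) (u : Fin d → Fin d → A) :
    ∃ δ : Fin d → A, (∀ i j, c i = c j → δ i = δ j) ∧
      ∀ i j : Fin d, (i : ℕ) + 1 = j → c i ≠ c j → δ j = δ i * u i j := by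
  let W : ℕ → A := fun l => if h : l + 1 < d then
    (if c ⟨l, by omega⟩ = c ⟨l + 1, h⟩ then 1 else u ⟨l, by omega⟩ ⟨l + 1, h⟩) else 1
  let Δ : ℕ → A := fun n => ∏ l ∈ Finset.range n, W l
  have hW : ∀ i j : Fin d, (i : ℕ) + 1 = j → W i = if c i = c j then 1 else u i j := by
    rintro ⟨i, hi⟩ ⟨j, hj⟩ hij
    dsimp only at hij
    subst hij
    exact dif_pos hj
  have hconst : ∀ (i : Fin d) (n : ℕ), (i : ℕ) ≤ n → ∀ hn : n < d, c ⟨n, hn⟩ = c i → Δ n = Δ i := by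
    intro i n hin
    induction n, hin using Nat.le_induction with
    | base => exact fun _ _ => rfl
    | succ n hin ih =>
      intro hn hcn
      have h1 : c i ≤ c ⟨n, by omega⟩ := hc (by rw [Fin.le_def]; exact hin)
      have h2 : c ⟨n, by omega⟩ ≤ c ⟨n + 1, hn⟩ := hc (by rw [Fin.le_def]; simp)
      have h3 : c ⟨n, by omega⟩ = c i := le_antisymm (hcn ▸ h2) h1
      have h4 : W n = 1 := by
        have := hW ⟨n, by omega⟩ ⟨n + 1, hn⟩ rfl
        rw [if_pos (h3.trans hcn.symm)] at this
        exact this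
      rw [← ih (by omega) h3]
      simp only [Δ]
      rw [Finset.prod_range_succ, h4, mul_one]
  refine ⟨fun i => Δ i, fun i j hij => ?_, fun i j hij hcij => ?_⟩
  · rcases le_total i j with h | h
    · exact (hconst i j h j.2 hij.symm).symm
    · exact hconst j i h i.2 hij
  · have h1 := hW i j hij
    rw [if_neg hcij] at h1
    dsimp only [Δ]
    rw [← hij, Finset.prod_range_succ, h1]

/-- The normal form over the formal power series. The bound `s α β` on the exponents for different
branches is any exponent with `x₂ ^ s ∈ (f α, f β)`. -/
theorem exists_formal_normal_form {k : Type*} [Field k] {r d : ℕ}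
    (f : Fin r → MvPowerSeries (Fin 2) k) (hf : ∀ α, HasLeading expOne (f α))
    (s : Fin r → Fin r → ℕ) (hs : ∀ α β, α ≠ β → X 1 ^ s α β ∈ Ideal.span {f α, f β})
    (c : Fin d → Fin r) (hc : Monotone c)
    (M : Matrix (Fin d) (Fin d) (MvPowerSeries (Fin 2) k)) (h0 : M.map constantCoeff = 0)
    (hdet : Associated M.det (∏ i, f (c i))) :
    ∃ T, LocallyEquivalent M T ∧ (∀ i j, j < i → T i j = 0) ∧ (∀ i, T i i = f (c i)) ∧
      (∀ i j : Fin d, (i : ℕ) + 1 = j → T i j = 0 ∨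
        ∃ n : ℕ, T i j = X 1 ^ n ∧ (c i ≠ c j → n < s (c i) (c j))) ∧
      ∀ i j : Fin d, (i : ℕ) + 2 ≤ j → ∃ h : Polynomial k, T i j = Polynomial.aeval (X 1) h ∧
        (c i ≠ c j → h.degree < s (c i) (c j)) := by
  classical
  obtain ⟨T, hMT, hlow, hdiag, hpoly, hsup⟩ := exists_block_normal_form f hf c hc M h0 hdet
  choose u y hy huy using fun i j => (hf (c i)).exists_unit_mul (T i j)
  obtain ⟨δ, hδ, hδ'⟩ := exists_block_scaling c hc u
  let D₁ : Matrix (Fin d) (Fin d) (MvPowerSeries (Fin 2) k) :=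
    Matrix.diagonal fun i => (δ i : MvPowerSeries (Fin 2) k)
  let D₂ : Matrix (Fin d) (Fin d) (MvPowerSeries (Fin 2) k) :=
    Matrix.diagonal fun i => ((δ i)⁻¹ : (MvPowerSeries (Fin 2) k)ˣ)
  let Δ : GL (Fin d) (MvPowerSeries (Fin 2) k) := ⟨D₁, D₂, by simp [D₁, D₂], by simp [D₁, D₂]⟩
  have hT' : ∀ i j, (D₁ * T * D₂) i j = ((δ i * (δ j)⁻¹ : (MvPowerSeries (Fin 2) k)ˣ) :
      MvPowerSeries (Fin 2) k) * T i j := by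
    intro i j
    rw [Matrix.mul_diagonal, Matrix.diagonal_mul, Units.val_mul]
    ring
  have hsame : ∀ i j, c i = c j → (D₁ * T * D₂) i j = T i j := by
    intro i j hij
    rw [hT', hδ i j hij, mul_inv_cancel, Units.val_one, one_mul]
  have hlow' : ∀ i j, j < i → (D₁ * T * D₂) i j = 0 := fun i j hij => by
    rw [hT', hlow i j hij, mul_zero]
  have hdiag' : ∀ i, (D₁ * T * D₂) i i = f (c i) := fun i => by rw [hsame i i rfl, hdiag]
  have hclt : ∀ i j, c i < c j → i < j := fun i j hij => by
    by_contra h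
    exact (hc (not_lt.1 h)).not_gt hij
  obtain ⟨T₂, hT₂, hnQ, hQ⟩ := exists_elimination (D₁ * T * D₂) hlow' (fun i j => c i < c j) hclt
    (fun i j i' j' h hi hj => (hc hi).trans_lt (h.trans_le (hc hj)))
    (fun i j x => ((i : ℕ) + 1 = j → x = 0 ∨ ∃ n : ℕ, x = X 1 ^ n ∧ n < s (c i) (c j)) ∧
      ((i : ℕ) + 2 ≤ j → ∃ h : Polynomial k, x = Polynomial.aeval (X 1) h ∧
        h.degree < s (c i) (c j))) (by
      intro i j hij x hx
      have hmem : f (c i) ∈ Ideal.span {f (c i), f (c j)} := Ideal.subset_span (by simp)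
      rw [hdiag', hdiag']
      by_cases hadj : (i : ℕ) + 1 = j
      · have hxy : x - y i j ∈ Ideal.span {f (c i), f (c j)} := by
          obtain ⟨q, hq⟩ := huy i j
          have h1 : x - y i j = ((u i j)⁻¹ : (MvPowerSeries (Fin 2) k)ˣ) * q * f (c i) := by
            rw [hx hadj, hT', hδ' i j hadj hij.ne, mul_inv, mul_inv_cancel_left,
              mul_assoc, mul_comm q, ← hq, mul_sub, ← mul_assoc, Units.inv_mul, one_mul]
          rw [h1]
          exact Ideal.mul_mem_left _ _ hmem
        rcases hy i j with h | ⟨n, h⟩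
        · exact ⟨0, ⟨fun _ => Or.inl rfl, fun h' => by omega⟩, h ▸ hxy⟩
        · by_cases hn : n < s (c i) (c j)
          · exact ⟨y i j, ⟨fun _ => Or.inr ⟨n, h, hn⟩, fun h' => by omega⟩, hxy⟩
          · refine ⟨0, ⟨fun _ => Or.inl rfl, fun h' => by omega⟩, ?_⟩
            rw [sub_zero, ← sub_add_cancel x (y i j)]
            refine Ideal.add_mem _ hxy ?_
            rw [h, ← Nat.sub_add_cancel (not_lt.1 hn), pow_add]
            exact Ideal.mul_mem_left _ _ (hs _ _ hij.ne)
      · obtain ⟨h, hdeg, hh⟩ := (hf (c i)).exists_polynomial hmem (hs _ _ hij.ne) x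
        exact ⟨_, ⟨fun h' => absurd h' hadj, fun _ => ⟨h, rfl, hdeg⟩⟩, hh⟩)
  have hT₂T : ∀ i j, ¬ c i < c j → T₂ i j = (D₁ * T * D₂) i j := hnQ
  refine ⟨T₂, hMT.trans (LocallyEquivalent.trans ⟨Δ, Δ⁻¹, rfl⟩ hT₂), ?_, ?_, ?_, ?_⟩
  · intro i j hij
    rw [hnQ i j (hc hij.le).not_gt, hlow' i j hij]
  · intro i
    rw [hnQ i i (lt_irrefl _), hdiag']
  · intro i j hij
    by_cases hcij : c i = c j
    · rw [hnQ i j (by rw [hcij]; exact lt_irrefl _), hsame i j hcij]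
      rcases hsup i j hij hcij with h | ⟨n, h⟩
      · exact Or.inl h
      · exact Or.inr ⟨n, h, fun h' => absurd hcij h'⟩
    · have hle : i ≤ j := by rw [Fin.le_def]; omega
      rcases (hQ i j ((hc hle).lt_of_ne hcij)).1 hij with h | ⟨n, h, hn⟩
      · exact Or.inl h
      · exact Or.inr ⟨n, h, fun _ => hn⟩
  · intro i j hij
    have hlt : i < j := by rw [Fin.lt_def]; omega
    by_cases hcij : c i = c j
    · rw [hnQ i j (by rw [hcij]; exact lt_irrefl _), hsame i j hcij]
      obtain ⟨h, hh⟩ := hpoly i j hlt hcij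
      exact ⟨h, hh, fun h' => absurd hcij h'⟩
    · obtain ⟨h, hh, hdeg⟩ := (hQ i j ((hc hlt.le).lt_of_ne hcij)).2 hij
      exact ⟨h, hh, fun _ => hdeg⟩

/-! ### Rings of functions on the germ -/

/-- The properties of the rings of rational, convergent and formal functions used below: they
contain the polynomials, a quotient of two of their elements lies in them if it is a power
series, and their elements vanishing at the origin lie in the ideal `(x₁, x₂)`. The second
property is only needed for denominators with a leading monomial. -/
structure IsGermRing {k : Type*} [Field k] (R : Subalgebra k (MvPowerSeries (Fin 2) k)) :
    Prop where
  poly_mem : ∀ P : MvPolynomial (Fin 2) k, (P : MvPowerSeries (Fin 2) k) ∈ R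
  div_mem : ∀ e g q, HasLeading e g → g ∈ R → q * g ∈ R → q ∈ R
  split : ∀ F ∈ R, constantCoeff F = 0 → ∃ a ∈ R, ∃ b ∈ R, F = X 0 * a + X 1 * b

theorem hasLeading_zero {k : Type*} [Field k] {F : MvPowerSeries (Fin 2) k}
    (hF : constantCoeff F ≠ 0) : HasLeading 0 F := by
  refine ⟨by simpa using hF, fun b hb hdeg => absurd ?_ hb⟩
  rw [map_zero, Nat.le_zero, Finsupp.degree_eq_zero_iff] at hdeg
  exact hdeg

theorem isUnit_iff_of_inv_mem {k : Type*} [Field k] {R : Subalgebra k (MvPowerSeries (Fin 2) k)}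
    (hR : ∀ F ∈ R, constantCoeff F ≠ 0 → F⁻¹ ∈ R) (x : R) :
    IsUnit x ↔ constantCoeff (x : MvPowerSeries (Fin 2) k) ≠ 0 := by
  constructor
  · intro h
    exact (isUnit_iff_constantCoeff.1 (h.map R.val)).ne_zero
  · intro h
    exact IsUnit.of_mul_eq_one ⟨_, hR _ x.2 h⟩ (Subtype.ext (MvPowerSeries.mul_inv_cancel _ h))

theorem isLocalRing_of_inv_mem {k : Type*} [Field k] {R : Subalgebra k (MvPowerSeries (Fin 2) k)}
    (hR : ∀ F ∈ R, constantCoeff F ≠ 0 → F⁻¹ ∈ R) : IsLocalRing R := by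
  refine IsLocalRing.of_isUnit_or_isUnit_one_sub_self fun x => ?_
  rw [isUnit_iff_of_inv_mem hR, isUnit_iff_of_inv_mem hR]
  by_contra! h
  have h2 := h.2
  simp [h.1] at h2

/-- The polynomials inside a ring of functions. -/
noncomputable def polynomialHom {k : Type*} [Field k] {R : Subalgebra k (MvPowerSeries (Fin 2) k)}
    (hR : ∀ P : MvPolynomial (Fin 2) k, (P : MvPowerSeries (Fin 2) k) ∈ R) :
    MvPolynomial (Fin 2) k →+* R :=
  (MvPolynomial.coeToMvPowerSeries.ringHom (σ := Fin 2) (R := k)).codRestrict R hR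

theorem coe_polynomialHom {k : Type*} [Field k] {R : Subalgebra k (MvPowerSeries (Fin 2) k)}
    (hR : ∀ P : MvPolynomial (Fin 2) k, (P : MvPowerSeries (Fin 2) k) ∈ R)
    (P : MvPolynomial (Fin 2) k) : (polynomialHom hR P : MvPowerSeries (Fin 2) k) = P := rfl

theorem polynomialHom_mem_pow {k : Type*} [Field k] {R : Subalgebra k (MvPowerSeries (Fin 2) k)}
    (hR : ∀ P : MvPolynomial (Fin 2) k, (P : MvPowerSeries (Fin 2) k) ∈ R)
    {P : MvPolynomial (Fin 2) k} {N : ℕ} (hP : (N : ℕ∞) ≤ (P : MvPowerSeries (Fin 2) k).order) :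
    polynomialHom hR P ∈ (MvPolynomial.idealOfVars (Fin 2) k).map (polynomialHom hR) ^ N := by
  rw [← Ideal.map_pow]
  refine Ideal.mem_map_of_mem _ ((MvPolynomial.mem_pow_idealOfVars_iff' _ _).2 fun x hx => ?_)
  rw [← MvPolynomial.coeff_coe]
  exact coeff_of_lt_order (lt_of_lt_of_le (Nat.cast_lt.2 hx) hP)

theorem constantCoeff_of_mem_map_idealOfVars {k : Type*} [Field k]
    {R : Subalgebra k (MvPowerSeries (Fin 2) k)}
    (hR : ∀ P : MvPolynomial (Fin 2) k, (P : MvPowerSeries (Fin 2) k) ∈ R) {x : R}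
    (hx : x ∈ (MvPolynomial.idealOfVars (Fin 2) k).map (polynomialHom hR)) :
    constantCoeff (x : MvPowerSeries (Fin 2) k) = 0 := by
  have : (MvPolynomial.idealOfVars (Fin 2) k).map (polynomialHom hR) ≤
      RingHom.ker ((constantCoeff (σ := Fin 2) (R := k)).comp (R.val : R →+* _)) := by
    rw [Ideal.map_le_iff_le_comap, MvPolynomial.idealOfVars, Ideal.span_le]
    rintro _ ⟨i, rfl⟩
    change constantCoeff ((polynomialHom hR (MvPolynomial.X i) : R) : MvPowerSeries (Fin 2) k) = 0
    rw [coe_polynomialHom, MvPolynomial.coe_X, constantCoeff_X]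
  exact this hx

theorem le_order_of_mem_pow {k : Type*} [Field k]
    {R : Subalgebra k (MvPowerSeries (Fin 2) k)}
    (hR : ∀ P : MvPolynomial (Fin 2) k, (P : MvPowerSeries (Fin 2) k) ∈ R) {N : ℕ} {x : R}
    (hx : x ∈ (MvPolynomial.idealOfVars (Fin 2) k).map (polynomialHom hR) ^ N) :
    (N : ℕ∞) ≤ (x : MvPowerSeries (Fin 2) k).order := by
  induction N generalizing x with
  | zero => simp
  | succ N ih =>
    rw [pow_succ] at hx
    induction hx using Submodule.mul_induction_on' with
    | mem_mul_mem a ha b hb =>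
      rw [MulMemClass.coe_mul, order_mul, Nat.cast_succ]
      exact add_le_add (ih ha) (one_le_order_iff_constCoeff_eq_zero.2
        (constantCoeff_of_mem_map_idealOfVars hR hb))
    | add a _ b _ ha hb =>
      rw [AddMemClass.coe_add]
      exact (le_min ha hb).trans min_order_le_add

/-! ### Rational functions -/

theorem rationalSeries_poly_mem {k : Type*} [Field k] (P : MvPolynomial (Fin 2) k) :
    (P : MvPowerSeries (Fin 2) k) ∈ rationalSeries k :=
  ⟨P, 1, by simp, by rw [MvPolynomial.coe_one, one_mul]⟩

theorem constantCoeff_coe_mvPolynomial {k : Type*} [Field k] (Q : MvPolynomial (Fin 2) k) :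
    constantCoeff (Q : MvPowerSeries (Fin 2) k) = MvPolynomial.constantCoeff Q := by
  rw [← coeff_zero_eq_constantCoeff_apply, MvPolynomial.coeff_coe, MvPolynomial.constantCoeff_eq]

theorem rationalSeries_inv_mem {k : Type*} [Field k] {F : MvPowerSeries (Fin 2) k}
    (hF : F ∈ rationalSeries k) (h0 : constantCoeff F ≠ 0) : F⁻¹ ∈ rationalSeries k := by
  obtain ⟨P, Q, hQ, h⟩ := hF
  refine ⟨Q, P, ?_, ?_⟩
  · rw [← constantCoeff_coe_mvPolynomial] at hQ ⊢
    rw [← h, map_mul]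
    exact mul_ne_zero hQ h0
  · rw [← h, mul_assoc, MvPowerSeries.mul_inv_cancel _ h0, mul_one]

/-- Each rational function is a unit times a polynomial. -/
theorem rationalSeries_eq_unit_mul {k : Type*} [Field k] (x : rationalSeries k) :
    ∃ (u : (rationalSeries k)ˣ) (P : MvPolynomial (Fin 2) k),
      polynomialHom rationalSeries_poly_mem P = u * x := by
  obtain ⟨P, Q, hQ, h⟩ := x.2
  have hu : IsUnit (polynomialHom rationalSeries_poly_mem Q : rationalSeries k) := by
    rw [isUnit_iff_of_inv_mem fun F hF => rationalSeries_inv_mem hF, coe_polynomialHom,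
      constantCoeff_coe_mvPolynomial]
    exact hQ
  exact ⟨hu.unit, P, Subtype.ext h.symm⟩

theorem isNoetherianRing_rationalSeries {k : Type*} [Field k] :
    IsNoetherianRing (rationalSeries k) := by
  rw [isNoetherianRing_iff_ideal_fg]
  intro J
  let φ : MvPolynomial (Fin 2) k →+* rationalSeries k := polynomialHom rationalSeries_poly_mem
  have hJ : J = (J.comap φ).map φ := by
    refine le_antisymm (fun x hx => ?_) Ideal.map_comap_le
    obtain ⟨u, P, h⟩ := rationalSeries_eq_unit_mul x
    have h1 : φ P ∈ J := by
      rw [show φ P = u * x from h]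
      exact J.mul_mem_left _ hx
    rw [← Units.inv_mul_cancel_left u x, ← h]
    exact Ideal.mul_mem_left _ _ (Ideal.mem_map_of_mem φ h1)
  rw [hJ]
  exact ((isNoetherianRing_iff_ideal_fg _).1 inferInstance _).map φ

theorem rationalSeries_mem_pow {k : Type*} [Field k] {x : rationalSeries k} {N : ℕ}
    (hx : (N : ℕ∞) ≤ (x : MvPowerSeries (Fin 2) k).order) :
    x ∈ (MvPolynomial.idealOfVars (Fin 2) k).map
      (polynomialHom (R := rationalSeries k) rationalSeries_poly_mem) ^ N := by
  obtain ⟨u, P, h⟩ := rationalSeries_eq_unit_mul x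
  have h1 := polynomialHom_mem_pow (R := rationalSeries k) rationalSeries_poly_mem (P := P) (N := N)
    (by
      rw [← coe_polynomialHom (R := rationalSeries k) rationalSeries_poly_mem P, h,
        MulMemClass.coe_mul, order_mul]
      exact hx.trans le_add_self)
  rw [h] at h1
  exact (Ideal.unit_mul_mem_iff_mem _ u.isUnit).1 h1

theorem le_order_sub_truncTotal {k : Type*} [Field k] (F : MvPowerSeries (Fin 2) k) (N : ℕ) :
    (N : ℕ∞) ≤ (F - (truncTotal N F : MvPolynomial (Fin 2) k)).order := by
  refine nat_le_order fun n hn => ?_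
  rw [map_sub, MvPolynomial.coeff_coe, coeff_truncTotal _ hn, sub_self]

/-- Principal ideals of a noetherian local ring are closed, by Krull's intersection theorem. -/
theorem dvd_of_forall_sub_mul_mem_pow {R : Type*} [CommRing R] [IsNoetherianRing R] [IsLocalRing R]
    {I : Ideal R} (hI : I ≠ ⊤) {g h : R} (H : ∀ N, ∃ q, h - q * g ∈ I ^ N) : g ∣ h := by
  rw [← Ideal.mem_span_singleton, ← Ideal.Quotient.eq_zero_iff_mem, ← Submodule.mem_bot R,
    ← Ideal.iInf_pow_smul_eq_bot_of_isLocalRing (M := R ⧸ Ideal.span {g}) I hI, Submodule.mem_iInf]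
  intro N
  obtain ⟨q, hq⟩ := H N
  have h1 : Ideal.Quotient.mk (Ideal.span {g}) h = (h - q * g) • (1 : R ⧸ Ideal.span {g}) := by
    rw [← Algebra.algebraMap_eq_smul_one, Ideal.Quotient.algebraMap_eq, Ideal.Quotient.eq,
      sub_sub_cancel]
    exact Ideal.mul_mem_left _ _ (Ideal.subset_span rfl)
  rw [h1]
  exact Submodule.smul_mem_smul hq trivial

/-- The quotient of two rational functions is rational if it is a power series, by Krull's
intersection theorem. -/
theorem rationalSeries_div_mem {k : Type*} [Field k] {g q : MvPowerSeries (Fin 2) k} (hg0 : g ≠ 0)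
    (hg : g ∈ rationalSeries k) (hq : q * g ∈ rationalSeries k) : q ∈ rationalSeries k := by
  have := isNoetherianRing_rationalSeries (k := k)
  have := isLocalRing_of_inv_mem (R := rationalSeries k) fun F hF => rationalSeries_inv_mem hF
  let φ : MvPolynomial (Fin 2) k →+* rationalSeries k := polynomialHom rationalSeries_poly_mem
  let 𝔪 := (MvPolynomial.idealOfVars (Fin 2) k).map φ
  have h𝔪 : 𝔪 ≠ ⊤ := by
    rw [Ideal.ne_top_iff_one]
    intro h
    have := constantCoeff_of_mem_map_idealOfVars rationalSeries_poly_mem h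
    simp at this
  let g' : rationalSeries k := ⟨g, hg⟩
  let h' : rationalSeries k := ⟨q * g, hq⟩
  have hmem : g' ∣ h' := by
    refine dvd_of_forall_sub_mul_mem_pow h𝔪 fun N =>
      ⟨φ (truncTotal N q), rationalSeries_mem_pow ?_⟩
    have : ((h' - φ (truncTotal N q) * g' : rationalSeries k) : MvPowerSeries (Fin 2) k) =
        (q - (truncTotal N q : MvPolynomial (Fin 2) k)) * g := by
      rw [sub_mul]
      rfl
    rw [this, order_mul]
    exact (le_order_sub_truncTotal q N).trans le_self_add
  obtain ⟨q', hq'⟩ := hmem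
  have h2 : q * g = g * q' := congrArg Subtype.val hq'
  rw [mul_comm g] at h2
  rw [mul_right_cancel₀ hg0 h2]
  exact q'.2

theorem HasLeading.ne_zero {k : Type*} [Field k] {e : Fin 2 →₀ ℕ} {g : MvPowerSeries (Fin 2) k}
    (hg : HasLeading e g) : g ≠ 0 := by
  rintro rfl
  simpa using hg.coeff_ne

theorem isGermRing_rationalSeries {k : Type*} [Field k] : IsGermRing (rationalSeries k) where
  poly_mem := rationalSeries_poly_mem
  div_mem e g q hg := rationalSeries_div_mem hg.ne_zero
  split F hF h0 := by
    obtain ⟨u, P, h⟩ := rationalSeries_eq_unit_mul ⟨F, hF⟩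
    have hP : P ∈ MvPolynomial.idealOfVars (Fin 2) k := by
      rw [← pow_one (MvPolynomial.idealOfVars (Fin 2) k), MvPolynomial.mem_pow_idealOfVars_iff']
      intro x hx
      rw [Nat.lt_one_iff, Finsupp.degree_eq_zero_iff] at hx
      have h1 := congrArg (fun y : rationalSeries k =>
        constantCoeff (y : MvPowerSeries (Fin 2) k)) h
      simp only [coe_polynomialHom, MulMemClass.coe_mul, map_mul, h0, mul_zero] at h1
      rw [hx, ← MvPolynomial.coeff_coe]
      exact h1
    have hvars : MvPolynomial.idealOfVars (Fin 2) k =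
        Ideal.span {MvPolynomial.X 0, MvPolynomial.X 1} := by
      rw [MvPolynomial.idealOfVars]
      congr 1
      ext x
      simp [Fin.exists_fin_two, eq_comm]
    rw [hvars, Ideal.mem_span_pair] at hP
    obtain ⟨a, b, hab⟩ := hP
    let φ : MvPolynomial (Fin 2) k →+* rationalSeries k := polynomialHom rationalSeries_poly_mem
    refine ⟨_, ((u⁻¹ : (rationalSeries k)ˣ) * φ a : rationalSeries k).2, _,
      ((u⁻¹ : (rationalSeries k)ˣ) * φ b : rationalSeries k).2, ?_⟩
    have h2 : (⟨F, hF⟩ : rationalSeries k) = (u⁻¹ : (rationalSeries k)ˣ) *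
        (φ a * φ (MvPolynomial.X 0) + φ b * φ (MvPolynomial.X 1)) := by
      rw [← map_mul, ← map_mul, ← map_add, hab, show φ P = _ from h, Units.inv_mul_cancel_left]
    have h3 := congrArg Subtype.val h2
    have hX : ∀ i, ((φ (MvPolynomial.X i) : rationalSeries k) : MvPowerSeries (Fin 2) k) = X i :=
      fun i => MvPolynomial.coe_X i
    simp only [MulMemClass.coe_mul, AddMemClass.coe_add, hX] at h3 ⊢
    rw [h3]
    ring

/-! ### Convergent and formal power series -/

theorem coeff_add_single_X_mul {k : Type*} [Field k] (i : Fin 2) (m : Fin 2 →₀ ℕ)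
    (φ : MvPowerSeries (Fin 2) k) : coeff (m + Finsupp.single i 1) (X i * φ) = coeff m φ := by
  rw [X, add_comm, coeff_add_monomial_mul, one_mul]

theorem coeff_X_mul_eq_zero {k : Type*} [Field k] {i : Fin 2} {n : Fin 2 →₀ ℕ} (hn : n i = 0)
    {φ : MvPowerSeries (Fin 2) k} : coeff n (X i * φ) = 0 := by
  classical
  rw [X, coeff_monomial_mul, if_neg]
  intro h
  have := h i
  simp [hn] at this

/-- The splitting `F = x₁ a + x₂ b` in which `x₁ a` collects the monomials divisible by `x₁`: the
coefficients of `a` and `b` are among those of `F`, so `a` and `b` converge if `F` does. -/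
theorem exists_split {k : Type*} [Field k] {F : MvPowerSeries (Fin 2) k}
    (hF : constantCoeff F = 0) : ∃ a b : MvPowerSeries (Fin 2) k, F = X 0 * a + X 1 * b ∧
      (∀ n, coeff n a = coeff (n + Finsupp.single 0 1) F) ∧
      ∀ n, coeff n b = 0 ∨ coeff n b = coeff (n + Finsupp.single 1 1) F := by
  classical
  obtain ⟨a, ha⟩ : ∃ a : MvPowerSeries (Fin 2) k,
      ∀ n, coeff n a = coeff (n + Finsupp.single 0 1) F :=
    ⟨fun n => coeff (n + Finsupp.single 0 1) F, fun _ => rfl⟩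
  obtain ⟨b, hb⟩ : ∃ b : MvPowerSeries (Fin 2) k,
      ∀ n, coeff n b = if n 0 = 0 then coeff (n + Finsupp.single 1 1) F else 0 :=
    ⟨fun n => if n 0 = 0 then coeff (n + Finsupp.single 1 1) F else 0, fun _ => rfl⟩
  refine ⟨a, b, ?_, ha, fun n => ?_⟩
  · ext n
    rw [map_add]
    by_cases h0 : n 0 = 0
    · rw [coeff_X_mul_eq_zero h0, zero_add]
      by_cases h1 : n 1 = 0
      · rw [coeff_X_mul_eq_zero h1]
        have : n = 0 := by
          ext i
          fin_cases i <;> assumption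
        rw [this]
        exact hF
      · obtain ⟨m, rfl⟩ : ∃ m, n = m + Finsupp.single 1 1 :=
          ⟨n - Finsupp.single 1 1, (tsub_add_cancel_of_le (by
            rw [Finsupp.single_le_iff]
            exact Nat.one_le_iff_ne_zero.2 h1)).symm⟩
        rw [coeff_add_single_X_mul, hb, if_pos]
        simpa using h0
    · obtain ⟨m, rfl⟩ := exists_add_expOne h0
      rw [coeff_add_single_X_mul, ha]
      by_cases h1 : m 1 = 0
      · rw [coeff_X_mul_eq_zero (by simpa using h1), add_zero]
      · obtain ⟨l, rfl⟩ : ∃ l, m = l + Finsupp.single 1 1 :=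
          ⟨m - Finsupp.single 1 1, (tsub_add_cancel_of_le (by
            rw [Finsupp.single_le_iff]
            exact Nat.one_le_iff_ne_zero.2 h1)).symm⟩
        rw [add_right_comm l (Finsupp.single 1 1) expOne, coeff_add_single_X_mul, hb, if_neg,
          add_zero]
        simp
  · rw [hb]
    split_ifs
    · exact Or.inr rfl
    · exact Or.inl rfl

theorem summable_pow_degree {ρ : ℝ} (h0 : 0 ≤ ρ) (h1 : ρ < 1) :
    Summable fun n : Fin 2 →₀ ℕ => ρ ^ n.degree := by
  have h := summable_geometric_of_lt_one h0 h1
  have h2 := h.mul_of_nonneg h (fun _ => by positivity) (fun _ => by positivity)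
  let e : (Fin 2 →₀ ℕ) ≃ ℕ × ℕ := Finsupp.equivFunOnFinite.trans (finTwoArrowEquiv ℕ)
  refine (e.summable_iff.2 h2).congr fun n => ?_
  rw [Finsupp.degree_eq_sum, Fin.sum_univ_two, pow_add]
  rfl

theorem convergesNearZero_of_bounded {k : Type*} [NormedField k] {F : MvPowerSeries (Fin 2) k}
    {r C : ℝ} (hr : 0 < r) (h : ∀ n : Fin 2 →₀ ℕ, ‖coeff n F‖ * r ^ n.degree ≤ C) :
    ConvergesNearZero F := by
  refine ⟨r / 2, by positivity, ?_⟩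
  refine Summable.of_nonneg_of_le (fun n => by positivity) (fun n => ?_)
    ((summable_pow_degree (ρ := 1 / 2) (by norm_num) (by norm_num)).mul_left C)
  have : (r / 2) ^ n.degree = r ^ n.degree * (1 / 2) ^ n.degree := by
    rw [← mul_pow]
    congr 1
    ring
  rw [this, ← mul_assoc]
  exact mul_le_mul_of_nonneg_right (h n) (by positivity)

theorem ConvergesNearZero.exists_bound {k : Type*} [NormedField k] {F : MvPowerSeries (Fin 2) k}
    (hF : ConvergesNearZero F) : ∃ r C : ℝ, 0 < r ∧ 0 ≤ C ∧
      (∀ s, 0 ≤ s → s ≤ r → ∀ n : Fin 2 →₀ ℕ, ‖coeff n F‖ * s ^ n.degree ≤ C) ∧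
      Summable fun n : Fin 2 →₀ ℕ => ‖coeff n F‖ * r ^ n.degree := by
  obtain ⟨r, hr, h⟩ := hF
  refine ⟨r, ∑' n : Fin 2 →₀ ℕ, ‖coeff n F‖ * r ^ n.degree, hr,
    tsum_nonneg fun n => by positivity, fun s hs hsr n => ?_, h⟩
  refine le_trans ?_ (h.le_tsum n fun m _ => by positivity)
  gcongr

/-- If the quotient of two convergent series is a power series, it converges. At a small radius
`s` the leading term of the denominator `g` dominates the rest by a factor `2`, and the recursion
for the coefficients of the quotient propagates the bound. -/
theorem convergentSeries_div_mem {k : Type*} [NormedField k] {e : Fin 2 →₀ ℕ}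
    {g q : MvPowerSeries (Fin 2) k} (hg : HasLeading e g) (hgc : ConvergesNearZero g)
    (hq : ConvergesNearZero (q * g)) : ConvergesNearZero q := by
  classical
  obtain ⟨r₁, H, hr₁, hH, hbound, -⟩ := hq.exists_bound
  obtain ⟨r₂, -, hr₂, -, -, hsum⟩ := hgc.exists_bound
  set K := ∑' n : Fin 2 →₀ ℕ, ‖coeff n g‖ * r₂ ^ n.degree with hK
  have hK0 : 0 ≤ K := tsum_nonneg fun n => by positivity
  have hge : 0 < ‖coeff e g‖ := norm_pos_iff.2 hg.coeff_ne
  -- `s = ρ r₂` with `ρ` so small that the tail of `g` is at most half of its leading term.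
  obtain ⟨ρ, hρ0, hρ1, hρr, hρK⟩ : ∃ ρ : ℝ, 0 < ρ ∧ ρ ≤ 1 ∧ ρ * r₂ ≤ r₁ ∧
      K * ρ ≤ ‖coeff e g‖ * r₂ ^ e.degree / 2 := by
    refine ⟨min 1 (min (r₁ / r₂) (‖coeff e g‖ * r₂ ^ e.degree / 2 / (K + 1))), by positivity,
      min_le_left _ _, ?_, ?_⟩
    · rw [← le_div_iff₀ hr₂]
      exact (min_le_right _ _).trans (min_le_left _ _)
    · calc _ ≤ (K + 1) * (‖coeff e g‖ * r₂ ^ e.degree / 2 / (K + 1)) := by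
            refine mul_le_mul (by linarith) ((min_le_right _ _).trans (min_le_right _ _))
              (by positivity) (by positivity)
        _ = _ := by field_simp
  set s := ρ * r₂ with hs
  have hs0 : 0 < s := by positivity
  let v : (Fin 2 →₀ ℕ) → ℝ := fun b => if e.degree < b.degree then ‖coeff b g‖ * s ^ b.degree else 0
  have hv0 : ∀ b, 0 ≤ v b := fun b => by
    simp only [v]
    split_ifs <;> positivity
  have hvle : ∀ b, v b ≤ ‖coeff b g‖ * r₂ ^ b.degree * ρ ^ (e.degree + 1) := by
    intro b
    simp only [v]
    split_ifs with hb
    · rw [hs, mul_pow, mul_comm (ρ ^ _), ← mul_assoc]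
      exact mul_le_mul_of_nonneg_left (pow_le_pow_of_le_one hρ0.le hρ1 hb) (by positivity)
    · positivity
  have hvs : Summable v := Summable.of_nonneg_of_le hv0 hvle (hsum.mul_right _)
  have hvt : ∑' b, v b ≤ ‖coeff e g‖ * s ^ e.degree / 2 := by
    calc ∑' b, v b ≤ ∑' b : Fin 2 →₀ ℕ, ‖coeff b g‖ * r₂ ^ b.degree * ρ ^ (e.degree + 1) :=
          hvs.tsum_le_tsum hvle (hsum.mul_right _)
      _ = K * ρ * ρ ^ e.degree := by rw [tsum_mul_right, pow_succ]; ring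
      _ ≤ ‖coeff e g‖ * r₂ ^ e.degree / 2 * ρ ^ e.degree := by gcongr
      _ = _ := by rw [hs, mul_pow]; ring
  set G := ‖coeff e g‖ * s ^ e.degree with hG
  have hG0 : 0 < G := by positivity
  refine convergesNearZero_of_bounded (C := 2 * H / G) hs0 ?_
  have key : ∀ N, ∀ n : Fin 2 →₀ ℕ, n.degree < N → ‖coeff n q‖ * s ^ n.degree ≤ 2 * H / G := by
    intro N
    induction N with
    | zero => intro n hn; omega
    | succ N ih =>
      intro n hn
      have hC0 : 0 ≤ 2 * H / G := by positivity
      have h1 := hg.coeff_mul q n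
      have h2 : ‖coeff n q‖ * ‖coeff e g‖ ≤ ‖coeff (n + e) (q * g)‖ +
          ∑ p ∈ Finset.HasAntidiagonal.antidiagonal (n + e),
            ‖if p.1.degree < n.degree then coeff p.1 q * coeff p.2 g else 0‖ := by
        rw [← norm_mul, ← sub_eq_iff_eq_add.2 h1]
        exact (norm_sub_le _ _).trans (add_le_add_right (norm_sum_le _ _) _)
      have h3 : ∀ p ∈ Finset.HasAntidiagonal.antidiagonal (n + e),
          ‖if p.1.degree < n.degree then coeff p.1 q * coeff p.2 g else 0‖ * s ^ (n + e).degree ≤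
            2 * H / G * v p.2 := by
        intro p hp
        have hp' := Finset.HasAntidiagonal.mem_antidiagonal.1 hp
        have hdeg : p.1.degree + p.2.degree = n.degree + e.degree := by
          rw [← map_add, hp', map_add]
        split_ifs with hlt
        · have hv : v p.2 = ‖coeff p.2 g‖ * s ^ p.2.degree := if_pos (by omega)
          rw [hv, norm_mul, ← hp', map_add, pow_add]
          calc _ = (‖coeff p.1 q‖ * s ^ p.1.degree) * (‖coeff p.2 g‖ * s ^ p.2.degree) := by ring
            _ ≤ _ := by
              gcongr
              exact ih p.1 (by omega)
        · rw [norm_zero, zero_mul]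
          exact mul_nonneg hC0 (hv0 _)
      have h4 : ∑ p ∈ Finset.HasAntidiagonal.antidiagonal (n + e), v p.2 ≤ ∑' b, v b := by
        rw [← Finset.sum_image (f := v) (g := Prod.snd)
          (s := Finset.HasAntidiagonal.antidiagonal (n + e))]
        · exact hvs.sum_le_tsum _ fun b _ => hv0 b
        · intro p hp p' hp' hpp
          have e1 := Finset.HasAntidiagonal.mem_antidiagonal.1 hp
          have e2 := Finset.HasAntidiagonal.mem_antidiagonal.1 hp'
          refine Prod.ext ?_ hpp
          rw [← e2, show p.2 = p'.2 from hpp] at e1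
          exact add_right_cancel e1
      have h5 : ‖coeff n q‖ * s ^ n.degree * G ≤ H + 2 * H / G * (G / 2) := by
        calc ‖coeff n q‖ * s ^ n.degree * G
            = ‖coeff n q‖ * ‖coeff e g‖ * s ^ (n + e).degree := by
              rw [hG, map_add, pow_add]; ring
          _ ≤ (‖coeff (n + e) (q * g)‖ + ∑ p ∈ Finset.HasAntidiagonal.antidiagonal (n + e),
                ‖if p.1.degree < n.degree then coeff p.1 q * coeff p.2 g else 0‖) *
                s ^ (n + e).degree := by gcongr
          _ ≤ H + ∑ p ∈ Finset.HasAntidiagonal.antidiagonal (n + e), 2 * H / G * v p.2 := by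
              rw [add_mul, Finset.sum_mul]
              exact add_le_add (hbound s hs0.le hρr _) (Finset.sum_le_sum h3)
          _ ≤ H + 2 * H / G * (G / 2) := by
              rw [← Finset.mul_sum]
              gcongr
              exact h4.trans hvt
      rw [le_div_iff₀ hG0]
      refine h5.trans_eq ?_
      field_simp
      ring
  exact fun n => key (n.degree + 1) n (Nat.lt_succ_self _)

theorem convergesNearZero_of_shift {k : Type*} [NormedField k] {F a : MvPowerSeries (Fin 2) k}
    {i : Fin 2} (hF : ConvergesNearZero F)
    (h : ∀ n, coeff n a = 0 ∨ coeff n a = coeff (n + Finsupp.single i 1) F) :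
    ConvergesNearZero a := by
  obtain ⟨r, C, hr, hC, hb, -⟩ := hF.exists_bound
  refine convergesNearZero_of_bounded (C := C / r) hr fun n => ?_
  rcases h n with h | h
  · rw [h, norm_zero, zero_mul]
    positivity
  · rw [h, le_div_iff₀ hr]
    refine le_trans (le_of_eq ?_) (hb r hr.le le_rfl (n + Finsupp.single i 1))
    rw [map_add, Finsupp.degree_single, pow_succ]
    ring

theorem isGermRing_regularFunctions {k : Type*} [NormedField k] (κ : FunctionKind) :
    IsGermRing (regularFunctions k κ) := by
  cases κ with
  | rational => exact isGermRing_rationalSeries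
  | convergent =>
    refine ⟨ConvergesNearZero.of_polynomial, fun e g q hg h h' =>
      convergentSeries_div_mem hg h h', fun F hF h0 => ?_⟩
    obtain ⟨a, b, hab, ha, hb⟩ := exists_split h0
    exact ⟨a, convergesNearZero_of_shift hF fun n => Or.inr (ha n), b,
      convergesNearZero_of_shift hF hb, hab⟩
  | formal =>
    refine ⟨fun _ => Algebra.mem_top, fun _ _ _ _ _ _ => Algebra.mem_top, fun F _ h0 => ?_⟩
    obtain ⟨a, b, hab, -, -⟩ := exists_split h0
    exact ⟨a, Algebra.mem_top, b, Algebra.mem_top, hab⟩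

/-! ### Descent of equivalences from formal power series -/

section generic

variable {R : Type*} [CommRing R]

theorem isNoetherian_quotient_mul {f g : R} (hf : IsNoetherian R (R ⧸ Ideal.span {f}))
    (hg : IsNoetherian R (R ⧸ Ideal.span {g})) : IsNoetherian R (R ⧸ Ideal.span {f * g}) := by
  let φ : (R ⧸ Ideal.span {f}) →ₗ[R] (R ⧸ Ideal.span {f * g}) :=
    Submodule.mapQ (Ideal.span {f}) (Ideal.span {f * g}) (LinearMap.mulRight R g) (by
      rw [Ideal.span, Submodule.span_singleton_le_iff_mem, Submodule.mem_comap]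
      exact Ideal.mem_span_singleton_self _)
  let ψ : (R ⧸ Ideal.span {f * g}) →ₗ[R] (R ⧸ Ideal.span {g}) :=
    Submodule.mapQ (Ideal.span {f * g}) (Ideal.span {g}) LinearMap.id (by
      rw [Ideal.span, Submodule.span_singleton_le_iff_mem, Submodule.mem_comap]
      exact Ideal.mem_span_singleton.2 (dvd_mul_left _ _))
  refine isNoetherian_of_range_eq_ker φ ψ ?_
  ext x
  obtain ⟨x, rfl⟩ := Submodule.Quotient.mk_surjective _ x
  rw [LinearMap.mem_ker, LinearMap.mem_range]
  change _ ↔ Submodule.Quotient.mk x = 0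
  rw [Submodule.Quotient.mk_eq_zero, Ideal.mem_span_singleton]
  constructor
  · rintro ⟨y, hy⟩
    obtain ⟨y, rfl⟩ := Submodule.Quotient.mk_surjective _ y
    have hy : (Submodule.Quotient.mk (y * g) : R ⧸ Ideal.span {f * g}) =
        Submodule.Quotient.mk x := hy
    rw [Submodule.Quotient.eq, Ideal.mem_span_singleton] at hy
    have h1 : g ∣ y * g - x := (dvd_mul_left g f).trans hy
    exact (dvd_sub_right (dvd_mul_left g y)).1 h1
  · rintro ⟨y, rfl⟩
    refine ⟨Submodule.Quotient.mk y, ?_⟩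
    exact congrArg _ (mul_comm y g)

theorem isNoetherianRing_quotient {I : Ideal R} (h : IsNoetherian R (R ⧸ I)) :
    IsNoetherianRing (R ⧸ I) :=
  isNoetherian_of_tower R h

theorem isNoetherian_quotient_prod {ι : Type*} (s : Finset ι) (g : ι → R)
    (hg : ∀ i, IsNoetherian R (R ⧸ Ideal.span {g i})) :
    IsNoetherian R (R ⧸ Ideal.span {∏ i ∈ s, g i}) := by
  classical
  induction s using Finset.induction_on with
  | empty =>
    rw [Finset.prod_empty, Ideal.span_singleton_one]
    infer_instance
  | insert i s hi ih =>
    rw [Finset.prod_insert hi]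
    exact isNoetherian_quotient_mul (hg i) ih

theorem mem_ideal_smul_top_matrix {d : ℕ} {I : Ideal R} {X : Matrix (Fin d) (Fin d) R} :
    X ∈ I • (⊤ : Submodule R (Matrix (Fin d) (Fin d) R)) ↔ ∀ i j, X i j ∈ I := by
  classical
  constructor
  · intro h
    induction h using Submodule.smul_induction_on' with
    | smul a ha X _ =>
      intro i j
      exact I.mul_mem_right _ ha
    | add X _ Y _ hX hY => exact fun i j => I.add_mem (hX i j) (hY i j)
  · intro h
    rw [Matrix.matrix_eq_sum_single X]
    refine Submodule.sum_mem _ fun i _ => Submodule.sum_mem _ fun j _ => ?_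
    have : Matrix.single i j (X i j) = X i j • Matrix.single i j (1 : R) := by
      rw [Matrix.smul_single, smul_eq_mul, mul_one]
    rw [this]
    exact Submodule.smul_mem_smul (h i j) trivial

theorem exists_map_eq_of_mem_map {d : ℕ} (F : R) {I : Ideal R}
    {X : Matrix (Fin d) (Fin d) (R ⧸ Ideal.span {F})}
    (hX : ∀ i j, X i j ∈ I.map (Ideal.Quotient.mk (Ideal.span {F}))) :
    ∃ X' : Matrix (Fin d) (Fin d) R, (∀ i j, X' i j ∈ I) ∧
      X'.map (Ideal.Quotient.mk (Ideal.span {F})) = X := by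
  choose X' hX' h using fun i j =>
    (Ideal.mem_map_iff_of_surjective _ Ideal.Quotient.mk_surjective).1 (hX i j)
  exact ⟨Matrix.of X', hX', by ext i j; exact h i j⟩

/-- The Artin–Rees lemma for the linear map `(A, C) ↦ A M - T C` on matrices modulo `F`: a
sufficiently good approximate solution of `A M = T C` differs by a small correction from a
solution modulo `F`. -/
theorem exists_artinRees_correction {d : ℕ} (F : R)
    (hF : IsNoetherianRing (R ⧸ Ideal.span {F})) (I : Ideal R) (M T : Matrix (Fin d) (Fin d) R) :
    ∃ N : ℕ, ∀ A C : Matrix (Fin d) (Fin d) R, (∀ i j, (A * M - T * C) i j ∈ I ^ N) →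
      ∃ A' C' Y : Matrix (Fin d) (Fin d) R, (∀ i j, A' i j ∈ I) ∧ (∀ i j, C' i j ∈ I) ∧
        A * M - T * C = A' * M - T * C' + F • Y := by
  let q := Ideal.Quotient.mk (Ideal.span {F})
  let L : (Matrix (Fin d) (Fin d) (R ⧸ Ideal.span {F}) ×
      Matrix (Fin d) (Fin d) (R ⧸ Ideal.span {F}))
      →ₗ[R ⧸ Ideal.span {F}] Matrix (Fin d) (Fin d) (R ⧸ Ideal.span {F}) :=
    { toFun := fun p => p.1 * M.map q - T.map q * p.2
      map_add' := fun p p' => by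
        simp only [Prod.fst_add, Prod.snd_add, Matrix.add_mul, Matrix.mul_add]
        abel
      map_smul' := fun a p => by
        simp only [Prod.smul_fst, Prod.smul_snd, Matrix.smul_mul, Matrix.mul_smul, smul_sub,
          RingHom.id_apply] }
  obtain ⟨K, hK⟩ := Ideal.exists_pow_inf_eq_pow_smul (I.map q) (LinearMap.range L)
  refine ⟨K + 1, fun A C hAC => ?_⟩
  have hmap : (A * M - T * C).map q = L (A.map q, C.map q) := by
    change q.mapMatrix (A * M - T * C) = _
    rw [map_sub, map_mul, map_mul]
    rfl
  have h1 : (A * M - T * C).map q ∈ I.map q ^ (K + 1) •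
      (⊤ : Submodule (R ⧸ Ideal.span {F}) (Matrix (Fin d) (Fin d) (R ⧸ Ideal.span {F}))) ⊓
        LinearMap.range L := by
    refine ⟨mem_ideal_smul_top_matrix.2 fun i j => ?_, hmap ▸ LinearMap.mem_range_self _ _⟩
    rw [← Ideal.map_pow]
    exact Ideal.mem_map_of_mem q (hAC i j)
  rw [hK (K + 1) (Nat.le_succ K), Nat.add_sub_cancel_left, pow_one] at h1
  have h2 : (A * M - T * C).map q ∈ I.map q • LinearMap.range L :=
    Submodule.smul_mono le_rfl inf_le_right h1
  rw [LinearMap.range_eq_map, ← Submodule.map_smul''] at h2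
  obtain ⟨⟨X, Z⟩, hXZ, hL⟩ := h2
  have hX : ∀ i j, X i j ∈ I.map q := mem_ideal_smul_top_matrix.1 (by
    have := Submodule.mem_map_of_mem (f := LinearMap.fst (R ⧸ Ideal.span {F}) _ _) hXZ
    rw [Submodule.map_smul''] at this
    exact Submodule.smul_mono le_rfl le_top this)
  have hZ : ∀ i j, Z i j ∈ I.map q := mem_ideal_smul_top_matrix.1 (by
    have := Submodule.mem_map_of_mem (f := LinearMap.snd (R ⧸ Ideal.span {F}) _ _) hXZ
    rw [Submodule.map_smul''] at this
    exact Submodule.smul_mono le_rfl le_top this)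
  obtain ⟨A', hA', rfl⟩ := exists_map_eq_of_mem_map F hX
  obtain ⟨C', hC', rfl⟩ := exists_map_eq_of_mem_map F hZ
  have h3 : (A * M - T * C - (A' * M - T * C')).map q = 0 := by
    change q.mapMatrix (A * M - T * C - (A' * M - T * C')) = 0
    rw [map_sub, sub_eq_zero]
    refine Eq.trans hL.symm ?_
    rw [map_sub, map_mul, map_mul]
    rfl
  have h4 : ∀ i j, ∃ y, (A * M - T * C - (A' * M - T * C')) i j = F * y := fun i j =>
    Ideal.mem_span_singleton.1 (Ideal.Quotient.eq_zero_iff_mem.1 (congrFun (congrFun h3 i) j))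
  choose Y hY using h4
  refine ⟨A', C', Matrix.of Y, hA', hC', ?_⟩
  rw [← sub_eq_iff_eq_add']
  ext i j
  exact hY i j

end generic

namespace IsGermRing

variable {k : Type*} [Field k] {R : Subalgebra k (MvPowerSeries (Fin 2) k)} (hR : IsGermRing R)

include hR

theorem isUnit_iff (x : R) : IsUnit x ↔ constantCoeff (x : MvPowerSeries (Fin 2) k) ≠ 0 :=
  isUnit_iff_of_inv_mem (fun F hF h0 => hR.div_mem 0 F _ (hasLeading_zero h0) hF (by
    rw [MvPowerSeries.inv_mul_cancel _ h0]
    exact R.one_mem)) x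

/-- Functions are approximated by polynomials in the adic topology of the ring itself. -/
theorem exists_sub_mem_pow (N : ℕ) (x : R) : ∃ P : MvPolynomial (Fin 2) k,
    x - polynomialHom hR.poly_mem P ∈
      (MvPolynomial.idealOfVars (Fin 2) k).map (polynomialHom hR.poly_mem) ^ N := by
  induction N generalizing x with
  | zero => exact ⟨0, by simp⟩
  | succ N ih =>
    let φ := polynomialHom hR.poly_mem
    let c := constantCoeff (x : MvPowerSeries (Fin 2) k)
    have hmem : (x - φ (MvPolynomial.C c) : R).1 ∈ R := (x - φ (MvPolynomial.C c)).2
    obtain ⟨a, ha, b, hb, hab⟩ := hR.split _ hmem (by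
      rw [AddSubgroupClass.coe_sub, coe_polynomialHom, MvPolynomial.coe_C, map_sub,
        constantCoeff_C, sub_self])
    obtain ⟨P, hP⟩ := ih ⟨a, ha⟩
    obtain ⟨Q, hQ⟩ := ih ⟨b, hb⟩
    have hX : ∀ i, ((φ (MvPolynomial.X i) : R) : MvPowerSeries (Fin 2) k) = X i :=
      fun i => MvPolynomial.coe_X i
    have hX𝔪 : ∀ i, φ (MvPolynomial.X i) ∈ (MvPolynomial.idealOfVars (Fin 2) k).map φ := fun i =>
      Ideal.mem_map_of_mem _ (Ideal.subset_span ⟨i, rfl⟩)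
    have hx : x = φ (MvPolynomial.C c) + (φ (MvPolynomial.X 0) * ⟨a, ha⟩ +
        φ (MvPolynomial.X 1) * ⟨b, hb⟩) := by
      rw [← sub_eq_iff_eq_add']
      refine Subtype.ext (hab.trans ?_)
      simp only [AddMemClass.coe_add, MulMemClass.coe_mul, hX]
    refine ⟨MvPolynomial.C c + (MvPolynomial.X 0 * P + MvPolynomial.X 1 * Q), ?_⟩
    have : x - φ (MvPolynomial.C c + (MvPolynomial.X 0 * P + MvPolynomial.X 1 * Q)) =
        φ (MvPolynomial.X 0) * (⟨a, ha⟩ - φ P) + φ (MvPolynomial.X 1) * (⟨b, hb⟩ - φ Q) := by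
      conv_lhs => rw [hx]
      simp only [map_add, map_mul]
      ring
    change x - φ _ ∈ _
    rw [this, pow_succ']
    exact Ideal.add_mem _ (Ideal.mul_mem_mul (hX𝔪 0) hP) (Ideal.mul_mem_mul (hX𝔪 1) hQ)

theorem mem_pow_of_le_order {N : ℕ} {x : R} (hx : (N : ℕ∞) ≤ (x : MvPowerSeries (Fin 2) k).order) :
    x ∈ (MvPolynomial.idealOfVars (Fin 2) k).map (polynomialHom hR.poly_mem) ^ N := by
  obtain ⟨P, hP⟩ := hR.exists_sub_mem_pow N x
  rw [← sub_add_cancel x (polynomialHom hR.poly_mem P)]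
  refine Ideal.add_mem _ hP (polynomialHom_mem_pow hR.poly_mem ?_)
  have h1 := le_order_of_mem_pow hR.poly_mem hP
  have h2 : (P : MvPowerSeries (Fin 2) k) = (x : MvPowerSeries (Fin 2) k) +
      -(x - polynomialHom hR.poly_mem P : R) := by
    rw [AddSubgroupClass.coe_sub, coe_polynomialHom]
    ring
  rw [h2]
  refine le_trans (le_min hx ?_) min_order_le_add
  rwa [order_neg]

/-- The function `x₂`. -/
noncomputable def xTwo : R := ⟨X 1, by
  rw [← MvPolynomial.coe_X]
  exact hR.poly_mem _⟩

/-- At a smooth point of the curve `{g = 0}`, the function `x₂` generates the maximal ideal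
modulo `g`. -/
theorem exists_eq_add {g : R} (hg : HasLeading expOne (g : MvPowerSeries (Fin 2) k)) (x : R)
    (hx : constantCoeff (x : MvPowerSeries (Fin 2) k) = 0) :
    ∃ α β : R, x = g * α + hR.xTwo * β := by
  obtain ⟨a, ha, b, hb, hab⟩ := hR.split _ x.2 hx
  obtain ⟨a', ha', b', hb', hab'⟩ := hR.split _ g.2 hg.constantCoeff_eq
  have hx1 : (X 0 : MvPowerSeries (Fin 2) k) ∈ R := by
    rw [← MvPolynomial.coe_X]
    exact hR.poly_mem _
  have hu : IsUnit (⟨a', ha'⟩ : R) := by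
    rw [hR.isUnit_iff]
    have h1 := hg.coeff_ne
    have h2 : coeff expOne (X 0 * a' : MvPowerSeries (Fin 2) k) = constantCoeff a' := by
      rw [← coeff_zero_eq_constantCoeff_apply, ← coeff_add_single_X_mul 0 0 a', zero_add]
    have h3 : coeff expOne (X 1 * b' : MvPowerSeries (Fin 2) k) = 0 :=
      coeff_X_mul_eq_zero (by simp)
    rwa [hab', map_add, h2, h3, add_zero] at h1
  obtain ⟨u, hu⟩ := hu
  have hg' : g = ⟨X 0, hx1⟩ * u + hR.xTwo * ⟨b', hb'⟩ := by
    rw [hu]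
    exact Subtype.ext hab'
  have hx' : x = ⟨X 0, hx1⟩ * ⟨a, ha⟩ + hR.xTwo * ⟨b, hb⟩ := Subtype.ext hab
  refine ⟨(u⁻¹ : Rˣ) * ⟨a, ha⟩, ⟨b, hb⟩ - ⟨b', hb'⟩ * (u⁻¹ : Rˣ) * ⟨a, ha⟩, ?_⟩
  have h1 : g * (u⁻¹ : Rˣ) = ⟨X 0, hx1⟩ + hR.xTwo * ⟨b', hb'⟩ * (u⁻¹ : Rˣ) := by
    rw [hg', add_mul, mul_assoc, Units.mul_inv, mul_one]
  rw [← mul_assoc, h1, hx']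
  ring

theorem dvd_of_coe_dvd {g h : R} {e : Fin 2 →₀ ℕ}
    (hg : HasLeading e (g : MvPowerSeries (Fin 2) k))
    (hgh : (g : MvPowerSeries (Fin 2) k) ∣ h) : g ∣ h := by
  obtain ⟨q, hq⟩ := hgh
  have hqR : q ∈ R := hR.div_mem e g q hg g.2 (by rw [mul_comm, ← hq]; exact h.2)
  exact ⟨⟨q, hqR⟩, Subtype.ext hq⟩

/-- The local ring of a branch is a discrete valuation ring with uniformizer `x₂`. -/
theorem dvd_or_exists_unit {g : R} (hg : HasLeading expOne (g : MvPowerSeries (Fin 2) k)) (h : R) :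
    g ∣ h ∨ ∃ (n : ℕ) (u : Rˣ), g ∣ h - hR.xTwo ^ n * u := by
  by_contra! hcon
  obtain ⟨hndvd, hnu⟩ := hcon
  have key : ∀ N : ℕ, ∃ α β : R, h = g * α + hR.xTwo ^ N * β := by
    intro N
    induction N with
    | zero => exact ⟨0, h, by simp⟩
    | succ N ih =>
      obtain ⟨α, β, hαβ⟩ := ih
      have hβ : constantCoeff (β : MvPowerSeries (Fin 2) k) = 0 := by
        by_contra hne
        obtain ⟨u, rfl⟩ := (hR.isUnit_iff β).2 hne
        exact hnu N u ⟨α, by rw [hαβ]; ring⟩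
      obtain ⟨α', β', hβ'⟩ := hR.exists_eq_add hg β hβ
      exact ⟨α + hR.xTwo ^ N * α', β', by rw [hαβ, hβ']; ring⟩
  refine hndvd (hR.dvd_of_coe_dvd hg ?_)
  refine dvd_of_forall_sub_mul_mem_pow (I := Ideal.span {(X 1 : MvPowerSeries (Fin 2) k)}) ?_ ?_
  · rw [Ne, Ideal.span_singleton_eq_top, isUnit_iff_constantCoeff]
    simp
  · intro N
    obtain ⟨α, β, hαβ⟩ := key N
    refine ⟨α, ?_⟩
    rw [Ideal.span_singleton_pow, Ideal.mem_span_singleton]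
    refine ⟨β, ?_⟩
    rw [hαβ]
    simp only [AddMemClass.coe_add, MulMemClass.coe_mul, SubmonoidClass.coe_pow]
    rw [mul_comm (α : MvPowerSeries (Fin 2) k), add_sub_cancel_left]
    rfl

/-- Every nonzero ideal of the local ring of a branch is generated by a power of `x₂`. -/
theorem isNoetherian_quotient {g : R} (hg : HasLeading expOne (g : MvPowerSeries (Fin 2) k)) :
    IsNoetherian R (R ⧸ Ideal.span {g}) := by
  classical
  refine ⟨fun J => ?_⟩
  have hmk : ∀ a b : R, g ∣ a - b →
      (Submodule.Quotient.mk a : R ⧸ Ideal.span {g}) = Submodule.Quotient.mk b := fun a b hab =>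
    (Submodule.Quotient.eq _).2 (Ideal.mem_span_singleton.2 hab)
  by_cases hJ : ∃ n : ℕ, (Submodule.Quotient.mk (hR.xTwo ^ n) : R ⧸ Ideal.span {g}) ∈ J
  · refine ⟨{Submodule.Quotient.mk (hR.xTwo ^ Nat.find hJ)}, ?_⟩
    rw [Finset.coe_singleton]
    refine le_antisymm ((Submodule.span_singleton_le_iff_mem _ _).2 (Nat.find_spec hJ)) ?_
    intro x hx
    obtain ⟨x, rfl⟩ := Submodule.Quotient.mk_surjective _ x
    rcases hR.dvd_or_exists_unit hg x with h | ⟨n, u, h⟩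
    · rw [(Submodule.Quotient.mk_eq_zero _).2 (Ideal.mem_span_singleton.2 h)]
      exact zero_mem _
    · rw [hmk _ _ h] at hx ⊢
      have hn : (Submodule.Quotient.mk (hR.xTwo ^ n) : R ⧸ Ideal.span {g}) ∈ J := by
        have h1 := J.smul_mem ((u⁻¹ : Rˣ) : R) hx
        rw [← Submodule.Quotient.mk_smul, smul_eq_mul, mul_comm, mul_assoc, Units.mul_inv,
          mul_one] at h1
        exact h1
      have hle := Nat.find_min' hJ hn
      rw [Submodule.mem_span_singleton]
      refine ⟨hR.xTwo ^ (n - Nat.find hJ) * u, ?_⟩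
      rw [← Submodule.Quotient.mk_smul, smul_eq_mul, mul_right_comm, ← pow_add,
        Nat.sub_add_cancel hle]
  · refine ⟨∅, ?_⟩
    rw [Finset.coe_empty, Submodule.span_empty, eq_comm, eq_bot_iff]
    intro x hx
    obtain ⟨x, rfl⟩ := Submodule.Quotient.mk_surjective _ x
    rcases hR.dvd_or_exists_unit hg x with h | ⟨n, u, h⟩
    · exact (Submodule.Quotient.mk_eq_zero _).2 (Ideal.mem_span_singleton.2 h)
    · rw [hmk _ _ h] at hx
      refine absurd ⟨n, ?_⟩ hJ
      have h1 := J.smul_mem ((u⁻¹ : Rˣ) : R) hx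
      rw [← Submodule.Quotient.mk_smul, smul_eq_mul, mul_comm, mul_assoc, Units.mul_inv,
        mul_one] at h1
      exact h1

theorem isUnit_matrix_of_approx {d : ℕ} {A : Matrix (Fin d) (Fin d) R}
    {B : Matrix (Fin d) (Fin d) (MvPowerSeries (Fin 2) k)} (hB : IsUnit B)
    (h : ∀ i j, constantCoeff (A i j : MvPowerSeries (Fin 2) k) = constantCoeff (B i j)) :
    IsUnit A := by
  rw [Matrix.isUnit_iff_isUnit_det, hR.isUnit_iff]
  have h1 : constantCoeff ((A.det : R) : MvPowerSeries (Fin 2) k) = constantCoeff B.det := by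
    have h2 : ((A.det : R) : MvPowerSeries (Fin 2) k) = (A.map R.val).det :=
      RingHom.map_det (R.val : R →+* MvPowerSeries (Fin 2) k) A
    rw [h2, RingHom.map_det, RingHom.map_det]
    congr 1
    ext i j
    exact h i j
  rw [h1]
  exact (isUnit_iff_constantCoeff.1 ((Matrix.isUnit_iff_isUnit_det _).1 hB)).ne_zero

/-- Matrices over a ring of functions on the germ which are equivalent over the formal power series
are equivalent: the formal equivalence is an exact solution of the linear system `A M = T C`, and
by the Artin–Rees lemma it can be approximated by solutions over the ring. -/
theorem locallyEquivalent_of_formal {d : ℕ} {M T : Matrix (Fin d) (Fin d) R}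
    {ι : Type*} [Fintype ι] (g : ι → R)
    (hg : ∀ i, HasLeading expOne (g i : MvPowerSeries (Fin 2) k)) {y : R}
    (hy : M.det * y = ∏ i, g i) (hy0 : constantCoeff (y : MvPowerSeries (Fin 2) k) = 0)
    (h : LocallyEquivalent (M.map R.val) (T.map R.val)) : LocallyEquivalent M T := by
  obtain ⟨A₀, B₀, hAB⟩ := h
  set C₀ := ((B₀⁻¹ : GL _ _) : Matrix (Fin d) (Fin d) (MvPowerSeries (Fin 2) k)) with hC₀
  have heq : (A₀ : Matrix (Fin d) (Fin d) (MvPowerSeries (Fin 2) k)) * M.map R.val =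
      T.map R.val * C₀ := by
    rw [hAB, hC₀, Matrix.mul_assoc, ← Units.val_mul, mul_inv_cancel, Units.val_one, Matrix.mul_one]
  have hnoeth : IsNoetherian R (R ⧸ Ideal.span {∏ i, g i}) :=
    isNoetherian_quotient_prod _ g fun i => hR.isNoetherian_quotient (hg i)
  have hnoeth' : IsNoetherianRing (R ⧸ Ideal.span {∏ i, g i}) :=
    isNoetherianRing_quotient hnoeth
  let φ := polynomialHom hR.poly_mem
  let 𝔪 := (MvPolynomial.idealOfVars (Fin 2) k).map φ
  have h𝔪 : ∀ x : R, x ∈ 𝔪 → constantCoeff (x : MvPowerSeries (Fin 2) k) = 0 := fun x hx =>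
    constantCoeff_of_mem_map_idealOfVars hR.poly_mem hx
  obtain ⟨N, hN⟩ := exists_artinRees_correction (∏ i, g i) hnoeth' 𝔪 M T
  -- The truncations of the formal solution.
  let tr : Matrix (Fin d) (Fin d) (MvPowerSeries (Fin 2) k) → Matrix (Fin d) (Fin d) R :=
    fun X => Matrix.of fun i j => φ (truncTotal (N + 1) (X i j))
  have htr : ∀ X i j, ((N + 1 : ℕ) : ℕ∞) ≤
      (X i j - (tr X i j : MvPowerSeries (Fin 2) k)).order := fun X i j =>
    le_order_sub_truncTotal _ _
  have htr0 : ∀ X i j, constantCoeff (tr X i j : MvPowerSeries (Fin 2) k) =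
      constantCoeff (X i j) := by
    intro X i j
    have h1 := one_le_order_iff_constCoeff_eq_zero.1 (le_trans (by simp) (htr X i j))
    rw [map_sub, sub_eq_zero] at h1
    exact h1.symm
  obtain ⟨A', C', Y, hA', hC', hY⟩ := hN (tr A₀) (tr C₀) fun i j => by
    refine hR.mem_pow_of_le_order ?_
    have h1 : (((tr A₀ * M - T * tr C₀) i j : R) : MvPowerSeries (Fin 2) k) =
        (((tr A₀).map R.val * M.map R.val - T.map R.val * (tr C₀).map R.val) :
          Matrix (Fin d) (Fin d) (MvPowerSeries (Fin 2) k)) i j := by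
      rw [← Matrix.map_mul, ← Matrix.map_mul]
      rfl
    have h2 : (tr A₀).map R.val * M.map R.val - T.map R.val * (tr C₀).map R.val =
        T.map R.val * (C₀ - (tr C₀).map R.val) -
          ((A₀ : Matrix (Fin d) (Fin d) (MvPowerSeries (Fin 2) k)) - (tr A₀).map R.val) *
            M.map R.val := by
      rw [Matrix.mul_sub, Matrix.sub_mul, heq]
      abel
    have hsum : ∀ (X X' : Matrix (Fin d) (Fin d) (MvPowerSeries (Fin 2) k)),
        (∀ i j, (N : ℕ∞) ≤ (X i j).order) ∨ (∀ i j, (N : ℕ∞) ≤ (X' i j).order) →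
        ∀ i j, (N : ℕ∞) ≤ ((X * X') i j).order := by
      intro X X' hX i j
      refine nat_le_order fun e he => ?_
      rw [Matrix.mul_apply, map_sum]
      refine Finset.sum_eq_zero fun l _ => coeff_of_lt_order (lt_of_lt_of_le (Nat.cast_lt.2 he) ?_)
      rw [order_mul]
      rcases hX with hX | hX
      · exact (hX i l).trans le_self_add
      · exact (hX l j).trans le_add_self
    have hle : ((N : ℕ) : ℕ∞) ≤ ((N + 1 : ℕ) : ℕ∞) := by exact_mod_cast Nat.le_succ N
    rw [h1, h2, Matrix.sub_apply, sub_eq_add_neg]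
    refine le_trans (le_min ?_ ?_) min_order_le_add
    · exact hsum _ _ (Or.inr fun i j => hle.trans (htr C₀ i j)) i j
    · rw [order_neg]
      exact hsum _ _ (Or.inl fun i j => hle.trans (htr A₀ i j)) i j
  -- The error `(det M) y Y` is absorbed into the left factor, since `(det M) = (adj M) M`; as `y`
  -- vanishes at the origin, this does not affect invertibility.
  have hA : IsUnit (tr A₀ - A' - y • (Y * M.adjugate)) := by
    refine hR.isUnit_matrix_of_approx A₀.isUnit fun i j => ?_
    simp only [Matrix.sub_apply, Matrix.smul_apply, smul_eq_mul, AddSubgroupClass.coe_sub,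
      MulMemClass.coe_mul, map_sub, map_mul, hy0, zero_mul, sub_zero, h𝔪 _ (hA' i j), htr0]
  have hC : IsUnit (tr C₀ - C') := by
    refine hR.isUnit_matrix_of_approx (B₀⁻¹).isUnit fun i j => ?_
    simp only [Matrix.sub_apply, AddSubgroupClass.coe_sub, map_sub, sub_zero, h𝔪 _ (hC' i j), htr0]
    rfl
  have hfin : (tr A₀ - A' - y • (Y * M.adjugate)) * M = T * (tr C₀ - C') := by
    rw [Matrix.sub_mul, Matrix.sub_mul, Matrix.mul_sub, Matrix.smul_mul, Matrix.mul_assoc Y,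
      Matrix.adjugate_mul, Matrix.mul_smul, Matrix.mul_one, smul_smul, mul_comm y, hy]
    rw [sub_eq_iff_eq_add] at hY
    rw [hY]
    abel
  refine ⟨hA.unit, hC.unit⁻¹, ?_⟩
  rw [IsUnit.unit_spec, hfin, Matrix.mul_assoc]
  have : (tr C₀ - C') * ((hC.unit⁻¹ : GL _ _) : Matrix (Fin d) (Fin d) R) = 1 := by
    exact hC.mul_val_inv
  rw [this, Matrix.mul_one]

end IsGermRing

/-! ### The tangent cone and the intersection multiplicities of the branches -/

/-- If the leading form of a product is `c x₁ ^ p`, then the leading form of a factor of order one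
is a multiple of `x₁`. -/
theorem hasLeading_of_dvd {k : Type*} [Field k] {f G : MvPowerSeries (Fin 2) k}
    (hf : f.order = 1) (hfG : f ∣ G) {p : ℕ} {c : k} (hp : G.order = p) (hc : c ≠ 0)
    (hG : ∀ n : Fin 2 →₀ ℕ, n.degree = p → coeff n G = if n = Finsupp.single 0 p then c else 0) :
    HasLeading expOne f := by
  classical
  obtain ⟨G', rfl⟩ := hfG
  set a := coeff (Finsupp.single 0 1) f with ha
  set b := coeff (Finsupp.single 1 1) f with hb
  have hdeg1 : ∀ n : Fin 2 →₀ ℕ, n.degree = 1 →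
      n = Finsupp.single 0 1 ∨ n = Finsupp.single 1 1 := by
    intro n hn
    rw [Finsupp.degree_eq_sum, Fin.sum_univ_two] at hn
    rcases Nat.eq_zero_or_pos (n 0) with h | h
    · right
      ext i
      fin_cases i
      · simpa using h
      · simp; omega
    · left
      ext i
      fin_cases i
      · simp; omega
      · simp; omega
  have hf0 : coeff 0 f = 0 := coeff_of_lt_order (by rw [hf]; simp)
  have hf0' : constantCoeff f = 0 := by
    rw [← coeff_zero_eq_constantCoeff_apply]
    exact hf0
  have hf2 : ((2 : ℕ) : ℕ∞) ≤ (f - (C a * X 0 + C b * X 1)).order := by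
    refine nat_le_order fun n hn => ?_
    have h1 : n.degree = 0 ∨ n.degree = 1 := by omega
    rcases h1 with h | h
    · rw [Finsupp.degree_eq_zero_iff] at h
      rw [h]
      simp [hf0']
    · rcases hdeg1 n h with rfl | rfl
      · simp [coeff_X, ha, Finsupp.single_left_inj]
      · simp [coeff_X, hb, Finsupp.single_left_inj]
  rw [order_mul, hf] at hp
  obtain ⟨q, hq, rfl⟩ : ∃ q : ℕ, G'.order = q ∧ p = q + 1 := by
    cases hG' : G'.order with
    | top => simp [hG'] at hp
    | coe q =>
      refine ⟨q, rfl, ?_⟩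
      rw [hG'] at hp
      have : 1 + q = p := by exact_mod_cast hp
      omega
  have hcoeff : ∀ n : Fin 2 →₀ ℕ, n.degree = q + 1 →
      coeff n (f * G') = a * coeff n (X 0 * G') + b * coeff n (X 1 * G') := by
    intro n hn
    have h1 : f * G' = (f - (C a * X 0 + C b * X 1)) * G' +
        (C a * (X 0 * G') + C b * (X 1 * G')) := by ring
    rw [h1, map_add, coeff_of_lt_order, zero_add, map_add, coeff_C_mul, coeff_C_mul]
    rw [order_mul, hq, hn]
    refine lt_of_lt_of_le ?_ (add_le_add_left hf2 _)
    norm_cast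
    omega
  have hb0 : b = 0 := by
    by_contra hb0
    -- If `x₂` occurred in the linear part of `f`, comparing the coefficients of
    -- `x₁ ^ i x₂ ^ (j + 1)` would show that the leading form of `G'` vanishes.
    have hzero : ∀ i j : ℕ, i + j = q →
        coeff (Finsupp.single 0 i + Finsupp.single 1 j) G' = 0 := by
      intro i
      induction i with
      | zero =>
        intro j hj
        have hn : (Finsupp.single (0 : Fin 2) 0 + Finsupp.single 1 j + Finsupp.single 1 1).degree =
            q + 1 := by simp [Finsupp.degree_single]; omega
        have h1 := hcoeff _ hn
        rw [hG _ hn, coeff_X_mul_eq_zero (by simp), coeff_add_single_X_mul, if_neg, mul_zero,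
          zero_add] at h1
        · exact (mul_eq_zero.1 h1.symm).resolve_left hb0
        · intro h
          have := DFunLike.congr_fun h 1
          simp at this
      | succ i ih =>
        intro j hj
        have hn : (Finsupp.single (0 : Fin 2) (i + 1) + Finsupp.single 1 j +
            Finsupp.single 1 1).degree = q + 1 := by simp [Finsupp.degree_single]; omega
        have h1 := hcoeff _ hn
        have h2 : Finsupp.single (0 : Fin 2) (i + 1) + Finsupp.single 1 j + Finsupp.single 1 1 =
            (Finsupp.single 0 i + Finsupp.single 1 (j + 1)) + Finsupp.single 0 1 := by
          rw [Finsupp.single_add, Finsupp.single_add]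
          abel
        rw [hG _ hn, coeff_add_single_X_mul, if_neg, h2, coeff_add_single_X_mul,
          ih (j + 1) (by omega), mul_zero, zero_add] at h1
        · exact (mul_eq_zero.1 h1.symm).resolve_left hb0
        · intro h
          have := DFunLike.congr_fun h 1
          simp at this
    have hn : (Finsupp.single (0 : Fin 2) q + Finsupp.single 0 1).degree = q + 1 := by
      simp [Finsupp.degree_single]
    have h1 := hcoeff _ hn
    have h2 := hzero q 0 rfl
    rw [Finsupp.single_zero, add_zero] at h2
    rw [coeff_add_single_X_mul, h2, coeff_X_mul_eq_zero (by simp), hG _ hn, if_pos] at h1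
    · simp at h1
      exact hc h1
    · rw [← Finsupp.single_add]
  constructor
  · intro ha0
    have ha0 : a = 0 := ha0
    rw [ha0, hb0] at hf2
    simp [hf] at hf2
  · intro n hn hdeg
    rw [Finsupp.degree_single] at hdeg
    rcases Nat.le_one_iff_eq_zero_or_eq_one.1 hdeg with h | h
    · rw [Finsupp.degree_eq_zero_iff] at h
      rw [h, hf0]
    · rcases hdeg1 n h with rfl | rfl
      · exact absurd rfl hn
      · exact hb0

/-- Two distinct branches with the same tangent meet with multiplicity `s ≥ 2`: the equation of one
of them restricts to a unit times `x₂ ^ s` on the other. -/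
theorem IsGermRing.exists_intersection {k : Type*} [Field k]
    {R : Subalgebra k (MvPowerSeries (Fin 2) k)} (hR : IsGermRing R) {f g : R}
    (hf : HasLeading expOne (f : MvPowerSeries (Fin 2) k))
    (hg : HasLeading expOne (g : MvPowerSeries (Fin 2) k)) (hfg : ¬ Associated f g) :
    ∃ s : ℕ, 2 ≤ s ∧
      (X 1 ^ s : MvPowerSeries (Fin 2) k) ∈ Ideal.span {(f : MvPowerSeries (Fin 2) k), ↑g} ∧
      (g : MvPowerSeries (Fin 2) k) ∈ Ideal.span {(f : MvPowerSeries (Fin 2) k), X 1 ^ s} := by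
  rcases hR.dvd_or_exists_unit hf g with ⟨q, hq⟩ | ⟨s, u, q, hq⟩
  · refine absurd ?_ hfg
    have h1 : (g : MvPowerSeries (Fin 2) k).order = 1 := by rw [hg.order_eq]; simp
    have hq' : (g : MvPowerSeries (Fin 2) k) =
        (f : MvPowerSeries (Fin 2) k) * (q : MvPowerSeries (Fin 2) k) := congrArg Subtype.val hq
    have h2 : (q : MvPowerSeries (Fin 2) k).order = 0 := by
      rw [hq', order_mul, hf.order_eq, Finsupp.degree_single, Nat.cast_one] at h1
      cases hqo : (q : MvPowerSeries (Fin 2) k).order with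
      | top => simp [hqo] at h1
      | coe n =>
        rw [hqo] at h1
        norm_cast at h1 ⊢
        omega
    have hu : IsUnit q := by
      rw [hR.isUnit_iff]
      intro h0
      exact order_ne_zero_iff_constCoeff_eq_zero.2 h0 h2
    exact ⟨hu.unit, by rw [IsUnit.unit_spec, hq]⟩
  · have hq' : (g : MvPowerSeries (Fin 2) k) - X 1 ^ s * ((u : R) : MvPowerSeries (Fin 2) k) =
        (f : MvPowerSeries (Fin 2) k) * (q : MvPowerSeries (Fin 2) k) := congrArg Subtype.val hq
    have hu : IsUnit ((u : R) : MvPowerSeries (Fin 2) k) := u.isUnit.map R.val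
    have hu0 : constantCoeff ((u : R) : MvPowerSeries (Fin 2) k) ≠ 0 :=
      (isUnit_iff_constantCoeff.1 hu).ne_zero
    refine ⟨s, ?_, ?_, ?_⟩
    · by_contra! hs
      have h01 : s = 0 ∨ s = 1 := by omega
      rcases h01 with rfl | rfl
      · have h1 := congrArg constantCoeff hq'
        rw [map_sub, map_mul, map_mul, hf.constantCoeff_eq, hg.constantCoeff_eq] at h1
        simp at h1
        exact hu0 h1
      · have h1 := congrArg (coeff (Finsupp.single 1 1)) hq'
        have hne : (Finsupp.single 1 1 : Fin 2 →₀ ℕ) ≠ expOne := by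
          intro h
          have := DFunLike.congr_fun h 1
          simp at this
        have h2 : coeff (Finsupp.single 1 1)
            ((f : MvPowerSeries (Fin 2) k) * (q : MvPowerSeries (Fin 2) k)) = 0 := by
          classical
          rw [MvPowerSeries.coeff_mul]
          refine Finset.sum_eq_zero fun p hp => ?_
          have hp' := Finset.HasAntidiagonal.mem_antidiagonal.1 hp
          rw [hf.coeff_eq p.1, zero_mul]
          · intro h
            rw [h] at hp'
            have := DFunLike.congr_fun hp' 0
            simp at this
          · have h3 := congrArg Finsupp.degree hp'
            rw [map_add, Finsupp.degree_single] at h3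
            rw [Finsupp.degree_single]
            omega
        have h3 := coeff_add_single_X_mul 1 0 ((u : R) : MvPowerSeries (Fin 2) k)
        rw [zero_add] at h3
        rw [h2, map_sub, pow_one, h3, hg.coeff_eq _ hne (by simp [Finsupp.degree_single])] at h1
        simp at h1
        exact hu0 h1
    · obtain ⟨v, hv⟩ := hu
      have hvv : (v : MvPowerSeries (Fin 2) k) *
          ((v⁻¹ : (MvPowerSeries (Fin 2) k)ˣ) : MvPowerSeries (Fin 2) k) = 1 := v.mul_inv
      generalize ((v⁻¹ : (MvPowerSeries (Fin 2) k)ˣ) : MvPowerSeries (Fin 2) k) = w at hvv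
      rw [Ideal.mem_span_pair]
      refine ⟨-(q : MvPowerSeries (Fin 2) k) * w, w, ?_⟩
      rw [← hv] at hq'
      calc _ = w * ((g : MvPowerSeries (Fin 2) k) -
            (f : MvPowerSeries (Fin 2) k) * (q : MvPowerSeries (Fin 2) k)) := by ring
        _ = X 1 ^ s * ((v : MvPowerSeries (Fin 2) k) * w) := by rw [← hq']; ring
        _ = _ := by rw [hvv, mul_one]
    · rw [Ideal.mem_span_pair]
      exact ⟨q, (u : R), by rw [mul_comm (q : MvPowerSeries (Fin 2) k), ← hq']; ring⟩

/-- The powers `1, x₂, …, x₂ ^ (s - 1)` are linearly independent modulo `(f, g)`, if `g` lies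
in `(f, x₂ ^ s)`. -/
theorem le_intersectionMult {k : Type*} [NormedField k] {κ : FunctionKind}
    {f g : regularFunctions k κ} (hf : HasLeading expOne (f : MvPowerSeries (Fin 2) k)) {s : ℕ}
    (hg : (g : MvPowerSeries (Fin 2) k) ∈ Ideal.span {(f : MvPowerSeries (Fin 2) k), X 1 ^ s}) :
    (s : ℕ∞) ≤ intersectionMult f g := by
  let φ : (Fin s → k) →ₗ[k] (regularFunctions k κ ⧸ Ideal.span {f, g}) :=
    (Ideal.Quotient.mkₐ k (Ideal.span {f, g})).toLinearMap ∘ₗ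
      Fintype.linearCombination k (fun i : Fin s => coordTwo k κ ^ (i : ℕ))
  have hφ : Function.Injective φ := by
    rw [injective_iff_map_eq_zero]
    intro v hv
    have h1 : (∑ i, v i • coordTwo k κ ^ (i : ℕ)) ∈ Ideal.span {f, g} :=
      Ideal.Quotient.eq_zero_iff_mem.1 hv
    have h2 : inclTwo k (∑ i, v i • PowerSeries.X ^ (i : ℕ)) ∈
        Ideal.span {(f : MvPowerSeries (Fin 2) k), X 1 ^ s} := by
      obtain ⟨x, y, hxy⟩ := Ideal.mem_span_pair.1 h1
      have h3 : inclTwo k (∑ i, v i • PowerSeries.X ^ (i : ℕ)) =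
          (x : MvPowerSeries (Fin 2) k) * f + y * g := by
        have := congrArg (regularFunctions k κ).val hxy
        rw [map_add, map_mul, map_mul, map_sum] at this
        refine Eq.trans ?_ this.symm
        rw [map_sum]
        refine Finset.sum_congr rfl fun i _ => ?_
        rw [map_smul, map_pow, inclTwo_X, map_smul, map_pow]
        rfl
      rw [h3]
      exact Ideal.add_mem _ (Ideal.mul_mem_left _ _ (Ideal.subset_span (by simp)))
        (Ideal.mul_mem_left _ _ hg)
    obtain ⟨x, y, hxy⟩ := Ideal.mem_span_pair.1 h2
    obtain ⟨q, ρ, hy⟩ := hf.exists_div_inclTwo y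
    have h4 : (f : MvPowerSeries (Fin 2) k) ∣
        inclTwo k (∑ i, v i • PowerSeries.X ^ (i : ℕ) - PowerSeries.X ^ s * ρ) := by
      refine ⟨x + q * X 1 ^ s, ?_⟩
      rw [map_sub, map_mul, map_pow, inclTwo_X, ← hxy, hy]
      ring
    have h5 := sub_eq_zero.1 (hf.eq_zero_of_dvd h4)
    funext j
    have h6 := congrArg (PowerSeries.coeff (j : ℕ)) h5
    rw [PowerSeries.X_pow_dvd_iff.1 (dvd_mul_right (PowerSeries.X ^ s) ρ) j j.2, map_sum,
      Finset.sum_eq_single j] at h6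
    · simpa using h6
    · intro i _ hi
      rw [PowerSeries.coeff_smul, PowerSeries.coeff_X_pow, if_neg, smul_zero]
      exact fun h => hi (Fin.ext h.symm)
    · simp
  have h := Module.length_le_of_injective φ hφ
  rw [Module.length_eq_finrank, Module.finrank_fin_fun] at h
  exact h

theorem intersectionMult_self {k : Type*} [NormedField k] {κ : FunctionKind}
    {f : regularFunctions k κ} (hf : HasLeading expOne (f : MvPowerSeries (Fin 2) k)) :
    intersectionMult f f = ⊤ :=
  ENat.eq_top_iff_forall_ge.2 fun _ => le_intersectionMult hf (Ideal.subset_span (by simp))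

/-! ### The list of the branches -/

/-- The list of the branches with their multiplicities, in increasing order. -/
theorem exists_monotone_fiber_card {r d : ℕ} {m : Fin r → ℕ} (hd : d = ∑ α, m α) :
    ∃ c : Fin d → Fin r, Monotone c ∧ ∀ α, (Finset.univ.filter fun i => c i = α).card = m α := by
  subst hd
  let c₀ : Fin (∑ α, m α) → Fin r := fun i => (finSigmaFinEquiv.symm i).1
  refine ⟨c₀ ∘ Tuple.sort c₀, Tuple.monotone_sort c₀, fun α => ?_⟩
  let e : {i // c₀ (Tuple.sort c₀ i) = α} ≃ Fin (m α) :=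
    ((Tuple.sort c₀).trans finSigmaFinEquiv.symm).subtypeEquiv (fun _ => Iff.rfl) |>.trans
      (Equiv.sigmaSubtype α)
  have := Fintype.card_congr e
  rw [Fintype.card_subtype, Fintype.card_fin] at this
  exact this

theorem prod_eq_prod_pow {R : Type*} [CommMonoid R] {r d : ℕ} {m : Fin r → ℕ} {c : Fin d → Fin r}
    (hc : ∀ α, (Finset.univ.filter fun i => c i = α).card = m α) (f : Fin r → R) :
    ∏ i, f (c i) = ∏ α, f α ^ m α := by
  rw [← Finset.prod_fiberwise' Finset.univ c f]
  exact Finset.prod_congr rfl fun α _ => by rw [Finset.prod_const, hc]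

theorem mainTheorem10 {k : Type*} [NormedField k] [CompleteSpace k] [IsAlgClosed k] [CharZero k]
    (κ : FunctionKind) {r d : ℕ}
    (f : Fin r → regularFunctions k κ) (m : Fin r → ℕ) (hm : ∀ α, 1 ≤ m α)
    (hsmooth : ∀ α, multAtZero (f α) = 1)
    (hdistinct : ∀ α β, α ≠ β → ¬ Associated (f α) (f β))
    (htangent : HasTangentConeXOnePow (∏ α, f α ^ m α))
    (M : Matrix (Fin d) (Fin d) (regularFunctions k κ))
    (hM0 : valueAtZero M = 0)
    (hdet : Associated M.det (∏ α, f α ^ m α))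
    (hgen : MaximallyGeneratedAtZero M) :
    ∃ c : Fin d → Fin r, Monotone c ∧ (∀ α, (Finset.univ.filter fun i => c i = α).card = m α) ∧
      ∃ T : Matrix (Fin d) (Fin d) (regularFunctions k κ),
        LocallyEquivalent M T ∧ IsNormalForm (fun i => f (c i)) T := by
  classical
  have hR := isGermRing_regularFunctions (k := k) κ
  let ν : regularFunctions k κ →+* MvPowerSeries (Fin 2) k := (regularFunctions k κ).val
  have hf : ∀ α, HasLeading expOne (f α : MvPowerSeries (Fin 2) k) := by
    intro α
    obtain ⟨p, hp, c, hc, hcoeff⟩ := htangent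
    have hdvd : f α ∣ ∏ α, f α ^ m α :=
      (dvd_pow_self _ (by have := hm α; omega)).trans
        (Finset.dvd_prod_of_mem (fun α => f α ^ m α) (Finset.mem_univ α))
    exact hasLeading_of_dvd (hsmooth α) (map_dvd ν hdvd) hp hc hcoeff
  have hd : d = ∑ α, m α := by
    have h1 : (∏ α, f α ^ m α : regularFunctions k κ).1.order = ((∑ α, m α : ℕ) : ℕ∞) := by
      change (ν (∏ α, f α ^ m α)).order = _
      rw [map_prod, order_prod]
      push_cast
      refine Finset.sum_congr rfl fun α _ => ?_
      have h2 : ∀ n : ℕ, (ν (f α ^ n)).order = n := by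
        intro n
        induction n with
        | zero =>
          rw [pow_zero, map_one]
          exact (order_eq_nat (n := 0)).2 ⟨⟨0, by simp, by simp⟩, fun i hi => absurd hi (by simp)⟩
        | succ n ih =>
          rw [pow_succ, map_mul, order_mul, ih, Nat.cast_succ]
          congr 1
          exact hsmooth α
      exact h2 _
    have h3 : multAtZero M.det = (∏ α, f α ^ m α : regularFunctions k κ).1.order := by
      obtain ⟨u, hu⟩ := hdet
      rw [← hu, MulMemClass.coe_mul, order_mul]
      have h4 : ((u : regularFunctions k κ) : MvPowerSeries (Fin 2) k).order = 0 := by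
        by_contra h
        exact (hR.isUnit_iff _).1 u.isUnit (order_ne_zero_iff_constCoeff_eq_zero.1 h)
      rw [h4, add_zero]
      rfl
    rw [MaximallyGeneratedAtZero, corankAtZero, hM0, Matrix.rank_zero, Nat.sub_zero, h3, h1] at hgen
    exact_mod_cast hgen
  obtain ⟨c, hc, hcard⟩ := exists_monotone_fiber_card hd
  refine ⟨c, hc, hcard, ?_⟩
  rw [← prod_eq_prod_pow hcard f] at hdet
  have hs : ∀ α β, ∃ s : ℕ, α ≠ β → 2 ≤ s ∧
      (X 1 ^ s : MvPowerSeries (Fin 2) k) ∈ Ideal.span {ν (f α), ν (f β)} ∧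
      ν (f β) ∈ Ideal.span {ν (f α), X 1 ^ s} := by
    intro α β
    by_cases h : α = β
    · exact ⟨0, fun h' => absurd h h'⟩
    · obtain ⟨s, hs⟩ := hR.exists_intersection (hf α) (hf β) (hdistinct α β h)
      exact ⟨s, fun _ => hs⟩
  choose s hs using hs
  have hMν0 : (M.map ν).map constantCoeff = 0 := hM0
  obtain ⟨T', hMT', hlow, hdiag, hsup, hup⟩ := exists_formal_normal_form (fun α => ν (f α)) hf s
    (fun α β h => (hs α β h).2.1) c hc (M.map ν) hMν0 (by
      have h1 : (M.map ν).det = ν M.det := (ν.map_det M).symm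
      rw [h1, ← map_prod]
      exact hdet.map ν)
  have hT'0 := hMT'.map_eq_zero constantCoeff hMν0
  have hX : ∀ h : Polynomial k, Polynomial.aeval (X 1 : MvPowerSeries (Fin 2) k) h =
      ν (Polynomial.aeval (coordTwo k κ) h) := fun h =>
    (Polynomial.aeval_algHom_apply (regularFunctions k κ).val (coordTwo k κ) h)
  have hmem : ∀ i j, ∃ x : regularFunctions k κ, ν x = T' i j := by
    intro i j
    rcases lt_trichotomy i j with h | rfl | h
    · by_cases hadj : (i : ℕ) + 1 = j
      · rcases hsup i j hadj with h0 | ⟨n, hn, -⟩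
        · exact ⟨0, by rw [h0, map_zero]⟩
        · exact ⟨coordTwo k κ ^ n, by rw [hn, map_pow]; rfl⟩
      · have h : (i : ℕ) < j := h
        obtain ⟨h, hh, -⟩ := hup i j (by omega)
        exact ⟨_, by rw [hh, hX]⟩
    · exact ⟨_, (hdiag i).symm⟩
    · exact ⟨0, by rw [hlow i j h, map_zero]⟩
  choose T hT using hmem
  have hν : Function.Injective ν := Subtype.val_injective
  have hTmap : (Matrix.of T).map ν = T' := by
    ext1 i j
    exact hT i j
  have hequiv : LocallyEquivalent M (Matrix.of T) := by
    rcases Nat.eq_zero_or_pos d with rfl | hpos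
    · rw [Subsingleton.elim (Matrix.of T) M]
      exact .refl M
    · obtain ⟨u, hu⟩ := hdet
      -- The product of the branches is taken twice, so that the cofactor of `det M` vanishes at the
      -- origin.
      refine hR.locallyEquivalent_of_formal (ι := Fin d ⊕ Fin d)
        (Sum.elim (fun i => f (c i)) fun i => f (c i)) ?_ (y := u * ∏ i, f (c i)) ?_ ?_ ?_
      · rintro (i | i) <;> exact hf (c i)
      · rw [← mul_assoc, hu, Fintype.prod_sum_type]
        rfl
      · have h1 : ν (∏ i, f (c i)) = ν (f (c ⟨0, hpos⟩)) *
            ν (∏ i ∈ Finset.univ.erase ⟨0, hpos⟩, f (c i)) := by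
          rw [← map_mul, Finset.mul_prod_erase Finset.univ (fun i => f (c i)) (Finset.mem_univ _)]
        change constantCoeff (ν (u * ∏ i, f (c i))) = 0
        rw [map_mul, h1, map_mul, map_mul, show constantCoeff (ν (f (c ⟨0, hpos⟩))) = 0 from
          (hf _).constantCoeff_eq, zero_mul, mul_zero]
      · change LocallyEquivalent (M.map ν) ((Matrix.of T).map ν)
        rw [hTmap]
        exact hMT'
  have hι : ∀ i j (n : ℕ), (c i ≠ c j → n < s (c i) (c j)) →
      (n : ℕ∞) < intersectionMult (f (c i)) (f (c j)) := by
    intro i j n hn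
    by_cases h : c i = c j
    · rw [h, intersectionMult_self (hf _)]
      exact ENat.natCast_lt_top n
    · exact lt_of_lt_of_le (Nat.cast_lt.2 (hn h))
        (le_intersectionMult (hf _) (hs (c i) (c j) h).2.2)
  refine ⟨Matrix.of T, hequiv, fun i j hij => hν ?_, fun i => hν ?_, fun i j hij => ?_,
    fun i j hij => ?_⟩
  · rw [map_zero, ← hlow i j hij]
    exact hT i j
  · exact (hT i i).trans (hdiag i)
  · rcases hsup i j hij with h0 | ⟨n, hn, hlt⟩
    · -- The exponent next to `β = 0` is irrelevant; `1` is admissible since branches are tangent.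
      refine ⟨0, 1, Or.inl rfl, le_rfl, hι i j 1 fun h => (hs _ _ h).1, hν ?_⟩
      rw [zero_smul, map_zero, ← h0]
      exact hT i j
    · refine ⟨1, n, Or.inr rfl, ?_, hι i j n hlt, hν ?_⟩
      · by_contra h
        have h0 : n = 0 := by omega
        have h1 : constantCoeff (T' i j) = 0 := congrFun (congrFun hT'0 i) j
        rw [hn, h0] at h1
        simp at h1
      · rw [one_smul, map_pow]
        exact (hT i j).trans hn
  · obtain ⟨h, hh, hdeg⟩ := hup i j hij
    refine ⟨h, hν ?_, ?_⟩
    · rw [← hX, ← hh]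
      exact hT i j
    · by_cases h0 : h = 0
      · exact Or.inl h0
      · refine Or.inr ⟨?_, hι i j _ fun hne => ?_⟩
        · rw [Nat.one_le_iff_ne_zero]
          intro htr
          rw [Polynomial.natTrailingDegree_eq_zero] at htr
          refine htr.elim h0 fun hc0 => hc0 ?_
          have h1 : constantCoeff (T' i j) = 0 := congrFun (congrFun hT'0 i) j
          rw [hh, ← inclTwo_aeval, constantCoeff_inclTwo] at h1
          simpa using h1
        · exact (Polynomial.natDegree_lt_iff_degree_lt h0).2 (hdeg hne)
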